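/- There is a universal constant $C>0$ such that for every $\delta\in(0,0.1)$ there is a $\delta$-correct algorithm for Best-1-Arm (best arm identification) whose expected total number of samples, on every instance with $n\ge 2$ arms, is at most $$ C\Big(\Delta_{[2]}^{-2}\,\mathrm{lnln}\,\Delta_{[2]}^{-1}+\sum_{i=2}^{n}\Delta_{[i]}^{-2}\ln\delta^{-1}+\sum_{i=2}^{n}\Delta_{[i]}^{-2}\,\mathrm{lnln}\min\big(n,\Delta_{[i]}^{-1}\big)\Big). $$ Here a Best-1-Arm instance consists of $n\ge 2$ arms, where arm $i$ has a reward distribution $\mathcal D_i$ on $\mathbb R$, unknown to the algorithm, with mean $\mu_i\in[0,1]$. Each $\mathcal D_i$ is $1$-sub-Gaussian, that is, $\mathbb E\big[\exp(tX-t\,\mathbb E[X])\big]\le\exp(t^2/2)$ for $X\sim\mathcal D_i$ and all $t\in\mathbb R$. The largest mean is strictly larger than the second largest. Let $\mu_{[1]}>\mu_{[2]}\ge\dots\ge\mu_{[n]}$ be the sorted means and $\Delta_{[i]}=\mu_{[1]}-\mu_{[i]}$. An algorithm (which may depend on $n$ and $\delta$) is a randomized adaptive procedure. At each step, using only its internal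 randomness and the arms played and rewards received so far, it either plays an arm, and receives an independent sample from that arm's reward distribution, or stops and returns an arm. It is $\delta$-correct if on every instance, for every $n\ge2$, it stops and returns the arm with the largest mean with probability at least $1-\delta$. Finally, $\mathrm{lnln}\,x$ denotes $\max(0,\ln\ln x)$ for $x>1$, and $0$ for $x\le1$. -/

import Mathlib

open MeasureTheory ProbabilityTheory
open scoped ENNReal

noncomputable section

/-- A distribution `D` on `ℝ` is `1`-sub-Gaussian: if `X` is drawn from `D`, then for every real `t`
the variable `exp (t (X - E X))` is integrable with expectation at most `exp (t ^ 2 / 2)`.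
In particular `X` is integrable, so the Bochner integral below is the true mean. -/
def IsOneSubGaussian (D : Measure ℝ) : Prop :=
  HasSubgaussianMGF (fun x => x - ∫ y, y ∂D) 1 D

/-- An instance of best arm identification with `n` arms: the reward distributions are
`1`-sub-Gaussian probability measures with means in `[0, 1]`, and one arm (necessarily unique)
has a mean strictly larger than the mean of every other arm. -/
structure BestArmInstance (n : ℕ) where
  dist : Fin n → Measure ℝ
  isProb : ∀ i, IsProbabilityMeasure (dist i)
  subGaussian : ∀ i, IsOneSubGaussian (dist i)
  mean_mem : ∀ i, (∫ x, x ∂(dist i)) ∈ Set.Icc (0 : ℝ) 1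
  best : Fin n
  best_spec : ∀ i, i ≠ best → (∫ x, x ∂(dist i)) < ∫ x, x ∂(dist best)

namespace BestArmInstance

variable {n : ℕ} (I : BestArmInstance n)

instance (i : Fin n) : IsProbabilityMeasure (I.dist i) := I.isProb i

/-- The mean reward of arm `i`. -/
def mean (i : Fin n) : ℝ := ∫ x, x ∂(I.dist i)

/-- The gap of arm `i`: the largest mean minus the mean of arm `i`. -/
def gap (i : Fin n) : ℝ := I.mean I.best - I.mean i

/-- The gap of the second best arm: the smallest gap of an arm other than the best one
(a minimum over a finite set, which is nonempty when there are at least two arms). -/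
def gapTwo : ℝ := ⨅ i : {i : Fin n // i ≠ I.best}, I.gap i

/-- The law of the rewards: an infinite table with independent entries, whose entry `(t, i)` has the
distribution of arm `i` and is the reward received if arm `i` is the one played at step `t`. -/
def rewardLaw : Measure (ℕ → Fin n → ℝ) :=
  Measure.infinitePi fun _ : ℕ => Measure.pi I.dist

end BestArmInstance

/-- A (randomized, adaptive) algorithm for `n` arms. It first draws an internal random seed. After
`t` samples it looks at the seed and at the `t` pairs (arm played, reward received) seen so far, and
either plays one more arm `i` (`Sum.inl i`) or stops and returns an arm `i` (`Sum.inr i`). -/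
structure BanditAlgorithm (n : ℕ) where
  Seed : Type
  [seedMeasurableSpace : MeasurableSpace Seed]
  seedLaw : Measure Seed
  [isProb : IsProbabilityMeasure seedLaw]
  decide : (t : ℕ) → Seed × (Fin t → Fin n × ℝ) → Fin n ⊕ Fin n
  measurable_decide : ∀ t, Measurable (decide t)

attribute [instance] BanditAlgorithm.seedMeasurableSpace BanditAlgorithm.isProb

namespace BanditAlgorithm

variable {n : ℕ}

/-- The first `t` pairs (arm played, reward received) of the run with seed `s` and reward table `x`.
What is recorded from the stopping step on is irrelevant: nothing below looks at it. -/
def history (A : BanditAlgorithm n) (s : A.Seed) (x : ℕ → Fin n → ℝ) : (t : ℕ) → Fin t → Fin n × ℝ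
  | 0 => Fin.elim0
  | t + 1 =>
    let i : Fin n := Sum.elim id id (A.decide t (s, history A s x t))
    Fin.snoc (history A s x t) (i, x t i)

/-- The decision taken after `t` samples in the run with seed `s` and reward table `x`. -/
def action (A : BanditAlgorithm n) (s : A.Seed) (x : ℕ → Fin n → ℝ) (t : ℕ) : Fin n ⊕ Fin n :=
  A.decide t (s, history A s x t)

/-- The run stops after exactly `t` samples and returns arm `i`. -/
def StopsWith (A : BanditAlgorithm n) (s : A.Seed) (x : ℕ → Fin n → ℝ) (t : ℕ) (i : Fin n) : Prop :=
  A.action s x t = Sum.inr i ∧ ∀ u < t, ∃ j, A.action s x u = Sum.inl j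

/-- The total number of samples taken by the run; it is `∞` if the run never stops. -/
def samples (A : BanditAlgorithm n) (s : A.Seed) (x : ℕ → Fin n → ℝ) : ℝ≥0∞ :=
  ⨅ (t : ℕ) (_ : ∃ i, A.StopsWith s x t i), (t : ℝ≥0∞)

/-- The joint law of the seed and the rewards (which are independent) on an instance. -/
def runLaw (A : BanditAlgorithm n) (I : BestArmInstance n) : Measure (A.Seed × (ℕ → Fin n → ℝ)) :=
  A.seedLaw.prod I.rewardLaw

/-- The probability that the algorithm stops and returns the best arm of the instance. -/
def successProb (A : BanditAlgorithm n) (I : BestArmInstance n) : ℝ≥0∞ :=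
  A.runLaw I {ω | ∃ t, A.StopsWith ω.1 ω.2 t I.best}

/-- The expected total number of samples taken by the algorithm on the instance. -/
def expectedSamples (A : BanditAlgorithm n) (I : BestArmInstance n) : ℝ≥0∞ :=
  ∫⁻ ω, A.samples ω.1 ω.2 ∂(A.runLaw I)

end BanditAlgorithm

/-- An algorithm for best arm identification (given for every number `n ≥ 2` of arms) is `δ`-correct
if on every instance it returns the best arm with probability at least `1 - δ`. -/
def IsDeltaCorrect (δ : ℝ) (A : (n : ℕ) → 2 ≤ n → BanditAlgorithm n) : Prop :=
  ∀ (n : ℕ) (hn : 2 ≤ n) (I : BestArmInstance n),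
    ENNReal.ofReal (1 - δ) ≤ (A n hn).successProb I

/-- The iterated logarithm with the usual convention for small arguments:
`max 0 (ln (ln x))` for `x > 1`, and `0` for `x ≤ 1` (in every use below `1 ≤ x`). -/
def lnln (x : ℝ) : ℝ := Real.log (max 1 (Real.log x))

end

/-! The procedure works in rounds at resolution ε = 2^(-r) on a set S of surviving arms. By repeated
halving it looks for an arm b of S within ε/8 of the best, then counts the arms whose empirical mean
is not below that of b by more than ε. If the count is at most about |S|/8, the empirically better
half of S is kept and the round goes on; otherwise the next round begins. Keeping a half is safe as
long as at most about a quarter of S has gap below ε/4.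

A union bound over all rounds would cost ln r for every arm. This is avoided as follows. A wrong
decision to eliminate requires that b is overestimated or that a fixed fraction of S is
underestimated. The second event has probability at most 2^|S| exp(-c|S|Nε²) with N pulls per arm,
so the confidence ln r can be shared by all of S, at the price of a bounded number of arms per
round: this is the term Δ₂⁻² lnln Δ₂⁻¹. All other confidences depend only on the number k of earlier
rounds with an elimination. Such rounds halve |S| - 1, so k is at most about log₂ n as well as at
most r, and ln k turns into lnln min(n, Δᵢ⁻¹).

The cost is amortised against 4^r |S| times a confidence weight. An elimination frees a fixed part
of this budget, which pays for the search, the test and the small risk of ending the round by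
mistake. If a sixteenth of S consists of suboptimal arms with gap below 2ε, the round may rightly
end without an elimination and is charged to those arms; each arm is charged only while Δᵢ < 2ε, and
the powers 4^r sum to order Δᵢ⁻². Error and cost are both bounded by potentials that satisfy a
one-stage inequality (`lintegral_failPotential_le`, `lintegral_costPotential_le`), summed up by
`lintegral_iSup_val_le`.

This controls the number of samples only off an event of probability exp(-λ) (`exists_event`). For a
true expectation, infinitely many copies with error δ/16^(l+1) share the sampling times, copy l
receiving a fraction 2^(-l-1). Copy l + 1 matters only if the independent copy l fails, and the
failure probabilities beat the slowdown (`parallel_expectedSamples_le`). -/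

/-! ### Splicing of i.i.d. sequences -/

/-- The sequence that follows `x` up to (and excluding) time `L`, and then runs through `y`. -/
def splice {α : Type*} (L : ℕ) (x y : ℕ → α) : ℕ → α := fun t => if t < L then x t else y (t - L)

/-- The sequence `x` from time `L` on. -/
def shiftSeq {α : Type*} (L : ℕ) (x : ℕ → α) : ℕ → α := fun t => x (L + t)

@[simp] lemma shiftSeq_splice {α : Type*} (L : ℕ) (x y : ℕ → α) :
    shiftSeq L (splice L x y) = y := by
  ext t; simp [shiftSeq, splice]

lemma splice_of_lt {α : Type*} {L t : ℕ} (h : t < L) (x y : ℕ → α) : splice L x y t = x t := by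
  simp [splice, h]

lemma measurable_splice {α : Type*} [MeasurableSpace α] (L : ℕ) :
    Measurable fun p : (ℕ → α) × (ℕ → α) => splice L p.1 p.2 := by
  refine measurable_pi_lambda _ fun t => ?_
  by_cases h : t < L
  · simp only [splice, h, if_true]; fun_prop
  · simp only [splice, h, if_false]; fun_prop

lemma measurable_shiftSeq {α : Type*} [MeasurableSpace α] (L : ℕ) :
    Measurable (shiftSeq L : (ℕ → α) → ℕ → α) := by
  refine measurable_pi_lambda _ fun t => ?_
  simp only [shiftSeq]; fun_prop

/-- Splicing two independent i.i.d. sequences gives an i.i.d. sequence. -/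
lemma map_splice_infinitePi {α : Type*} [MeasurableSpace α] (μ : Measure α)
    [IsProbabilityMeasure μ] (L : ℕ) :
    ((Measure.infinitePi fun _ : ℕ => μ).prod (Measure.infinitePi fun _ : ℕ => μ)).map
      (fun p => splice L p.1 p.2) = Measure.infinitePi fun _ : ℕ => μ := by
  refine Measure.eq_infinitePi _ fun s t ht => ?_
  rw [Measure.map_apply (measurable_splice L)
    (MeasurableSet.pi s.countable_toSet fun i _ => ht i)]
  -- The cylinder splits into its coordinates before `L`, which only see the first sequence, and
  -- those from `L` on, which only see the second.
  have h1 : (fun p : (ℕ → α) × (ℕ → α) => splice L p.1 p.2) ⁻¹' (Set.pi s t)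
      = (Set.pi (s.filter (· < L) : Finset ℕ) t) ×ˢ
        (Set.pi ((s.filter (fun i => ¬ i < L)).image (· - L) : Finset ℕ) fun u => t (L + u)) := by
    ext p
    simp only [Set.mem_preimage, Set.mem_pi, Set.mem_prod, Finset.mem_coe, Finset.mem_filter,
      Finset.mem_image]
    constructor
    · intro h
      refine ⟨fun i hi => by simpa [splice, hi.2] using h i hi.1, ?_⟩
      rintro u ⟨i, ⟨hi, hL⟩, rfl⟩
      have := h i hi
      rw [show L + (i - L) = i by omega]
      simpa [splice, hL] using this
    · rintro ⟨ha, hb⟩ i hi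
      by_cases hL : i < L
      · simpa [splice, hL] using ha i ⟨hi, hL⟩
      · have := hb (i - L) ⟨i, ⟨hi, hL⟩, rfl⟩
        rw [show L + (i - L) = i by omega] at this
        simpa [splice, hL] using this
  rw [h1, Measure.prod_prod, Measure.infinitePi_pi _ (fun i _ => ht i),
    Measure.infinitePi_pi _ (fun i _ => ht _), Finset.prod_image,
    ← Finset.prod_filter_mul_prod_filter_not s (· < L)]
  · congr 1
    refine Finset.prod_congr rfl fun i hi => ?_
    rw [show L + (i - L) = i by have := (Finset.mem_filter.1 hi).2; omega]
  · intro a ha b hb hab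
    have h1 := (Finset.mem_filter.1 ha).2
    have h2 := (Finset.mem_filter.1 hb).2
    simp only at hab
    omega

lemma lintegral_splice {α : Type*} [MeasurableSpace α] (μ : Measure α)
    [IsProbabilityMeasure μ] (L : ℕ) {G : (ℕ → α) → ℝ≥0∞} (hG : Measurable G) :
    ∫⁻ x, G x ∂(Measure.infinitePi fun _ : ℕ => μ) =
      ∫⁻ x, ∫⁻ y, G (splice L x y) ∂(Measure.infinitePi fun _ : ℕ => μ)
        ∂(Measure.infinitePi fun _ : ℕ => μ) := by
  conv_lhs => rw [← map_splice_infinitePi μ L]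
  rw [lintegral_map hG (measurable_splice L), lintegral_prod]
  exact (hG.comp (measurable_splice L)).aemeasurable

/-! ### Sub-Gaussian sums of rewards -/

namespace BestArmInstance

variable {n : ℕ} (I : BestArmInstance n)

instance : IsProbabilityMeasure I.rewardLaw := by
  unfold rewardLaw; infer_instance

/-- The centred reward at time `s` of a fixed arm is `1`-sub-Gaussian. -/
lemma hasSubgaussianMGF_reward (s : ℕ) (i : Fin n) :
    HasSubgaussianMGF (fun x : ℕ → Fin n → ℝ => x s i - I.mean i) 1 I.rewardLaw := by
  have h1 : I.rewardLaw.map (fun x => x s i) = I.dist i := by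
    have : (fun x : ℕ → Fin n → ℝ => x s i) = (fun r : Fin n → ℝ => r i) ∘ (fun x => x s) := rfl
    rw [this, ← Measure.map_map (by fun_prop) (by fun_prop), rewardLaw, Measure.infinitePi_map_eval]
    exact (measurePreserving_eval (μ := I.dist) i).map_eq
  have h2 : HasSubgaussianMGF (fun y => y - I.mean i) 1 (I.rewardLaw.map fun x => x s i) := by
    rw [h1]; exact I.subGaussian i
  have hm : Measurable fun x : ℕ → Fin n → ℝ => x s i :=
    (measurable_pi_apply i).comp (measurable_pi_apply s)
  exact HasSubgaussianMGF.of_map hm.aemeasurable h2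

/-- Rewards of fixed arms at distinct times: the centred sum is sub-Gaussian. -/
lemma hasSubgaussianMGF_sum_reward (arm : ℕ → Fin n) (P : Finset ℕ) :
    HasSubgaussianMGF (fun x : ℕ → Fin n → ℝ => ∑ s ∈ P, (x s (arm s) - I.mean (arm s)))
      P.card I.rewardLaw := by
  have hind : iIndepFun (fun s (x : ℕ → Fin n → ℝ) => x s (arm s) - I.mean (arm s))
      I.rewardLaw :=
    iIndepFun_infinitePi (P := fun _ : ℕ => Measure.pi I.dist)
      (X := fun s (r : Fin n → ℝ) => r (arm s) - I.mean (arm s)) (by fun_prop)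
  have := HasSubgaussianMGF.sum_of_iIndepFun hind (c := fun _ => 1) (s := P)
    fun s _ => I.hasSubgaussianMGF_reward s (arm s)
  simpa using this

end BestArmInstance

/-! ### Staged policies: trajectories, expected values, and the resulting algorithm -/

/-- A deterministic procedure that works in stages. In state `q` it either stops with answer
`out q`, or pulls every arm `i` exactly `pulls q i` times and passes to a new state that depends
on the sums of the rewards received from each arm during the stage. -/
structure StagedPolicy (n : ℕ) (Q : Type) where
  init : Q
  pulls : Q → Fin n → ℕ
  out : Q → Option (Fin n)
  next : Q → (Fin n → ℝ) → Q
  dflt : Fin n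

namespace StagedPolicy

variable {n : ℕ} {Q : Type} (M : StagedPolicy n Q)

/-- The number of samples taken in a stage. -/
def len (q : Q) : ℕ := ∑ i, M.pulls q i

/-- The arm pulled in position `s` of a stage. -/
def arm (q : Q) (s : ℕ) : Fin n :=
  if h : s < M.len q then (finSigmaFinEquiv.symm ⟨s, h⟩).1 else M.dflt

/-- The sums of the rewards of each arm in a stage whose rewards are read from the table `x`. -/
noncomputable def sums (q : Q) (x : ℕ → Fin n → ℝ) (i : Fin n) : ℝ :=
  ∑ s ∈ Finset.range (M.len q), if M.arm q s = i then x s i else 0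

/-- A state together with the position within the stage and the current sums. -/
abbrev Micro (n : ℕ) (Q : Type) : Type := Q × ℕ × (Fin n → ℝ)

noncomputable def step (σ : Micro n Q) (y : ℝ) : Micro n Q :=
  let v := Function.update σ.2.2 (M.arm σ.1 σ.2.1) (σ.2.2 (M.arm σ.1 σ.2.1) + y)
  if σ.2.1 + 1 < M.len σ.1 then (σ.1, σ.2.1 + 1, v) else (M.next σ.1 v, 0, 0)

def decision (σ : Micro n Q) : Fin n ⊕ Fin n :=
  (M.out σ.1).elim (Sum.inl (M.arm σ.1 σ.2.1)) Sum.inr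

noncomputable def stateOf : (t : ℕ) → (Fin t → Fin n × ℝ) → Micro n Q
  | 0, _ => (M.init, 0, 0)
  | t + 1, h => M.step (stateOf t (Fin.init h)) (h (Fin.last t)).2

/-- The trajectory of the procedure from the state `σ` when the rewards are read from `x`. -/
noncomputable def traj (σ : Micro n Q) (x : ℕ → Fin n → ℝ) : ℕ → Micro n Q
  | 0 => σ
  | t + 1 => M.step (traj σ x t) (x t (Sum.elim id id (M.decision (traj σ x t))))

/-- `finSigmaFinEquiv` lists the pairs (arm, pull of that arm) of the stage, so positions correspond
bijectively to such pairs. -/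
lemma card_filter_arm_mem (q : Q) (W : Finset (Fin n)) :
    ((Finset.range (M.len q)).filter (M.arm q · ∈ W)).card = ∑ i ∈ W, M.pulls q i := by
  have h : ∑ i ∈ W, M.pulls q i
      = (W.sigma fun i => (Finset.univ : Finset (Fin (M.pulls q i)))).card := by
    simp
  rw [h]
  symm
  refine Finset.card_bij (fun a _ => (finSigmaFinEquiv a : ℕ)) ?_ ?_ ?_
  · intro a ha
    have hlt : (finSigmaFinEquiv a : ℕ) < M.len q := (finSigmaFinEquiv a).2
    simp only [Finset.mem_sigma, Finset.mem_univ, and_true] at ha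
    refine Finset.mem_filter.2 ⟨Finset.mem_range.2 hlt, ?_⟩
    have h2 : finSigmaFinEquiv.symm ⟨(finSigmaFinEquiv a : ℕ), hlt⟩ = a :=
      finSigmaFinEquiv.symm_apply_apply a
    rw [arm, dif_pos hlt, h2]
    exact ha
  · intro a _ b _ hab
    exact finSigmaFinEquiv.injective (Fin.ext hab)
  · intro s hs
    obtain ⟨hs, hW⟩ := Finset.mem_filter.1 hs
    rw [Finset.mem_range] at hs
    refine ⟨finSigmaFinEquiv.symm ⟨s, hs⟩, ?_, by simp⟩
    simpa [arm, hs] using hW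

/-- Rewrites the joint deviation of several arms as a sum of centred rewards at distinct times,
which are independent. -/
lemma sum_sums_sub (q : Q) (x : ℕ → Fin n → ℝ) (m : Fin n → ℝ) (W : Finset (Fin n)) :
    ∑ i ∈ W, (M.sums q x i - M.pulls q i * m i) =
      ∑ s ∈ (Finset.range (M.len q)).filter (M.arm q · ∈ W),
        (x s (M.arm q s) - m (M.arm q s)) := by
  have h : ∀ i, M.sums q x i - M.pulls q i * m i =
      ∑ s ∈ Finset.range (M.len q), if M.arm q s = i then x s i - m i else 0 := by
    intro i
    have hc := M.card_filter_arm_mem q {i}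
    simp only [Finset.mem_singleton, Finset.sum_singleton] at hc
    rw [sums, ← hc, ← nsmul_eq_mul, ← Finset.sum_const, Finset.sum_filter, ← Finset.sum_sub_distrib]
    refine Finset.sum_congr rfl fun s _ => ?_
    split_ifs <;> simp
  simp_rw [h]
  rw [Finset.sum_comm, Finset.sum_filter]
  refine Finset.sum_congr rfl fun s _ => ?_
  rw [Finset.sum_ite_eq]

lemma sums_splice (q : Q) (x y : ℕ → Fin n → ℝ) :
    M.sums q (splice (M.len q) x y) = M.sums q x := by
  ext i
  refine Finset.sum_congr rfl fun s hs => ?_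
  rw [splice_of_lt (Finset.mem_range.1 hs)]

lemma measurable_sums (q : Q) : Measurable (M.sums q) := by
  refine measurable_pi_lambda _ fun i => Finset.measurable_sum _ fun s _ => ?_
  split_ifs
  · exact (measurable_pi_apply i).comp (measurable_pi_apply s)
  · exact measurable_const

section Concentration

variable (I : BestArmInstance n)

lemma measure_sum_sums_ge_le (q : Q) (W : Finset (Fin n)) {y : ℝ} (hy : 0 ≤ y) :
    I.rewardLaw.real {x | y ≤ ∑ i ∈ W, (M.sums q x i - M.pulls q i * I.mean i)} ≤
      Real.exp (-y ^ 2 / (2 * ∑ i ∈ W, (M.pulls q i : ℝ))) := by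
  have h := (I.hasSubgaussianMGF_sum_reward (M.arm q)
    ((Finset.range (M.len q)).filter (M.arm q · ∈ W))).measure_ge_le hy
  simp_rw [M.sum_sums_sub]
  rw [M.card_filter_arm_mem] at h
  simpa using h

lemma measure_sum_sums_le_le (q : Q) (W : Finset (Fin n)) {y : ℝ} (hy : 0 ≤ y) :
    I.rewardLaw.real {x | ∑ i ∈ W, (M.sums q x i - M.pulls q i * I.mean i) ≤ -y} ≤
      Real.exp (-y ^ 2 / (2 * ∑ i ∈ W, (M.pulls q i : ℝ))) := by
  have h := (I.hasSubgaussianMGF_sum_reward (M.arm q)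
    ((Finset.range (M.len q)).filter (M.arm q · ∈ W))).neg.measure_ge_le hy
  simp_rw [M.sum_sums_sub]
  rw [M.card_filter_arm_mem] at h
  simp only [Pi.neg_apply] at h
  simp_rw [le_neg (a := y)] at h
  simpa using h

end Concentration

section Trajectory

lemma traj_shift (σ : Micro n Q) (x : ℕ → Fin n → ℝ) (a b : ℕ) :
    M.traj σ x (a + b) = M.traj (M.traj σ x a) (shiftSeq a x) b := by
  induction b with
  | zero => rfl
  | succ b ih =>
    rw [← add_assoc, traj, ih]
    rfl

lemma traj_of_lt {q : Q} (hq : M.out q = none) (x : ℕ → Fin n → ℝ) {p : ℕ} (hp : p < M.len q) :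
    M.traj (q, 0, 0) x p =
      (q, p, fun i => ∑ s ∈ Finset.range p, if M.arm q s = i then x s i else 0) := by
  induction p with
  | zero => simp [traj]; rfl
  | succ p ih =>
    rw [traj, ih (by omega)]
    simp only [step, decision, hq, Option.elim_none, Sum.elim_inl, id, hp, if_true,
      Prod.mk.injEq, true_and]
    ext i
    rw [Finset.sum_range_succ]
    by_cases h : M.arm q p = i
    · subst h; simp
    · simp [h, Function.update_of_ne (Ne.symm h)]

lemma traj_len {q : Q} (hq : M.out q = none) (x : ℕ → Fin n → ℝ) (hp : 0 < M.len q) :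
    M.traj (q, 0, 0) x (M.len q) = (M.next q (M.sums q x), 0, 0) := by
  obtain ⟨p, hp'⟩ : ∃ p, M.len q = p + 1 := ⟨M.len q - 1, by omega⟩
  rw [hp', traj, M.traj_of_lt hq x (by omega)]
  simp only [step, decision, hq, Option.elim_none, Sum.elim_inl, id, hp', lt_irrefl, if_false]
  congr 2
  ext i
  rw [sums, hp', Finset.sum_range_succ]
  by_cases h : M.arm q p = i
  · subst h; simp
  · simp [h, Function.update_of_ne (Ne.symm h)]

end Trajectory

section Value

open Classical in
/-- The value collected in the first `k` stages: `c` in every stage, and `f` on absorption. -/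
noncomputable def val (acc : Q → Prop) (c f : Q → ℝ≥0∞) : ℕ → Q → (ℕ → Fin n → ℝ) → ℝ≥0∞
  | 0, _, _ => 0
  | k + 1, q, x => if acc q then f q else
      c q + val acc c f k (M.next q (M.sums q x)) (shiftSeq (M.len q) x)

variable (acc : Q → Prop) (c f : Q → ℝ≥0∞)

lemma val_succ_of_acc {q : Q} (h : acc q) (k : ℕ) (x : ℕ → Fin n → ℝ) :
    M.val acc c f (k + 1) q x = f q := by simp [val, h]

lemma val_succ_of_not_acc {q : Q} (h : ¬ acc q) (k : ℕ) (x : ℕ → Fin n → ℝ) :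
    M.val acc c f (k + 1) q x =
      c q + M.val acc c f k (M.next q (M.sums q x)) (shiftSeq (M.len q) x) := by simp [val, h]

lemma val_mono (q : Q) (x : ℕ → Fin n → ℝ) : Monotone fun k => M.val acc c f k q x := by
  refine monotone_nat_of_le_succ fun k => ?_
  induction k generalizing q x with
  | zero => simp [val]
  | succ k ih =>
    by_cases h : acc q
    · simp [val_succ_of_acc, h]
    · rw [val_succ_of_not_acc _ _ _ _ h, val_succ_of_not_acc _ _ _ _ h]
      gcongr
      exact ih _ _

variable [MeasurableSpace Q] [Countable Q] [DiscreteMeasurableSpace Q]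

lemma measurable_val (hM : ∀ q, Measurable (M.next q)) (k : ℕ) (q : Q) :
    Measurable (M.val acc c f k q) := by
  induction k generalizing q with
  | zero => exact measurable_const
  | succ k ih =>
    by_cases h : acc q
    · simp_rw [funext (M.val_succ_of_acc acc c f h k)]
      exact measurable_const
    · simp_rw [funext (M.val_succ_of_not_acc acc c f h k)]
      have h1 : Measurable fun p : Q × (ℕ → Fin n → ℝ) => M.val acc c f k p.1 p.2 :=
        measurable_from_prod_countable_right ih
      exact measurable_const.add (h1.comp
        (((hM q).comp (M.measurable_sums q)).prodMk (measurable_shiftSeq _)))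

/-- A supersolution of the one-stage inequality bounds the expected total value. -/
lemma lintegral_val_le (I : BestArmInstance n) (hM : ∀ q, Measurable (M.next q))
    (inv : Q → Prop) (hinv : ∀ q, inv q → ¬ acc q → ∀ v, inv (M.next q v))
    (Φ : Q → ℝ≥0∞) (hacc : ∀ q, inv q → acc q → f q ≤ Φ q)
    (hstep : ∀ q, inv q → ¬ acc q →
      c q + ∫⁻ x, Φ (M.next q (M.sums q x)) ∂I.rewardLaw ≤ Φ q)
    (k : ℕ) (q : Q) (hq : inv q) : ∫⁻ x, M.val acc c f k q x ∂I.rewardLaw ≤ Φ q := by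
  induction k generalizing q with
  | zero => simp [val]
  | succ k ih =>
    by_cases h : acc q
    · simp_rw [M.val_succ_of_acc acc c f h k]
      simpa using hacc q hq h
    · refine le_trans ?_ (hstep q hq h)
      -- Markov property: the stage reads only the first `len q` rows, so after splicing the next
      -- state depends on one table and the remaining value on a fresh independent one.
      rw [BestArmInstance.rewardLaw,
        lintegral_splice _ (M.len q) (M.measurable_val acc c f hM (k + 1) q)]
      simp_rw [M.val_succ_of_not_acc acc c f h k, M.sums_splice, shiftSeq_splice]
      simp_rw [lintegral_add_left measurable_const, lintegral_const, measure_univ, mul_one]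
      gcongr
      exact ih _ (hinv q hq h _)

/-- Monotone convergence removes the horizon. It is used twice: with the stage lengths as cost, and
with value one on absorption in a bad state. -/
lemma lintegral_iSup_val_le (I : BestArmInstance n) (hM : ∀ q, Measurable (M.next q))
    (inv : Q → Prop) (hinv : ∀ q, inv q → ¬ acc q → ∀ v, inv (M.next q v))
    (Φ : Q → ℝ≥0∞) (hacc : ∀ q, inv q → acc q → f q ≤ Φ q)
    (hstep : ∀ q, inv q → ¬ acc q →
      c q + ∫⁻ x, Φ (M.next q (M.sums q x)) ∂I.rewardLaw ≤ Φ q)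
    (q : Q) (hq : inv q) : ∫⁻ x, ⨆ k, M.val acc c f k q x ∂I.rewardLaw ≤ Φ q := by
  rw [lintegral_iSup (fun k => M.measurable_val acc c f hM k q)
    (fun i j hij x => M.val_mono acc c f q x hij)]
  exact iSup_le fun k => M.lintegral_val_le acc c f I hM inv hinv Φ hacc hstep k q hq

end Value

section Algorithm

lemma measurable_decision [MeasurableSpace Q] [Countable Q] [DiscreteMeasurableSpace Q] :
    Measurable M.decision := by
  have h : Measurable fun p : Q × ℕ => (M.out p.1).elim (Sum.inl (M.arm p.1 p.2)) Sum.inr :=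
    Measurable.of_discrete
  exact h.comp (measurable_fst.prodMk (measurable_fst.comp measurable_snd))

variable [MeasurableSpace Q] [Countable Q] [DiscreteMeasurableSpace Q]
  (hM : ∀ q, Measurable (M.next q))
include hM

lemma measurable_step : Measurable fun p : Micro n Q × ℝ => M.step p.1 p.2 := by
  have h : Measurable fun p : (Q × ℕ) × ((Fin n → ℝ) × ℝ) =>
      M.step (p.1.1, p.1.2, p.2.1) p.2.2 := by
    refine measurable_from_prod_countable_right fun a => ?_
    have hv : Measurable fun p : (Fin n → ℝ) × ℝ =>
        Function.update p.1 (M.arm a.1 a.2) (p.1 (M.arm a.1 a.2) + p.2) := by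
      refine measurable_pi_lambda _ fun i => ?_
      by_cases hi : i = M.arm a.1 a.2
      · subst hi; simp only [Function.update_self]; fun_prop
      · simp only [Function.update_of_ne hi]; fun_prop
    by_cases hlt : a.2 + 1 < M.len a.1
    · simp only [step, hlt, if_true]
      exact measurable_const.prodMk (measurable_const.prodMk hv)
    · simp only [step, hlt, if_false]
      exact ((hM a.1).comp hv).prodMk measurable_const
  exact h.comp (((measurable_fst.comp measurable_fst).prodMk
    (measurable_fst.comp (measurable_snd.comp measurable_fst))).prodMk
    ((measurable_snd.comp (measurable_snd.comp measurable_fst)).prodMk measurable_snd))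

lemma measurable_stateOf (t : ℕ) : Measurable (M.stateOf t) := by
  induction t with
  | zero => exact measurable_const
  | succ t ih =>
    have h1 : Measurable fun h : Fin (t + 1) → Fin n × ℝ => M.stateOf t (Fin.init h) :=
      ih.comp (measurable_pi_lambda _ fun i => measurable_pi_apply _)
    have h2 : Measurable fun h : Fin (t + 1) → Fin n × ℝ => (h (Fin.last t)).2 :=
      measurable_snd.comp (measurable_pi_apply _)
    exact (M.measurable_step hM).comp (h1.prodMk h2)

omit hM in
/-- The bandit algorithm that runs the staged procedure. -/
noncomputable def toAlgorithm (hM : ∀ q, Measurable (M.next q)) : BanditAlgorithm n where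
  Seed := Unit
  seedLaw := Measure.dirac ()
  decide t p := M.decision (M.stateOf t p.2)
  measurable_decide t :=
    (M.measurable_decision).comp ((M.measurable_stateOf hM t).comp measurable_snd)

lemma toAlgorithm_action (s : (M.toAlgorithm hM).Seed) (x : ℕ → Fin n → ℝ) (t : ℕ) :
    (M.toAlgorithm hM).action s x t = M.decision (M.traj (M.init, 0, 0) x t) := by
  have h : ∀ t, M.stateOf t ((M.toAlgorithm hM).history s x t) = M.traj (M.init, 0, 0) x t := by
    intro t
    induction t with
    | zero => rfl
    | succ t ih =>
      rw [stateOf, traj, ← ih]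
      simp only [BanditAlgorithm.history, Fin.init_snoc, Fin.snoc_last]
      rfl
  rw [← h]
  rfl

end Algorithm

section Stopping

/-- If absorption happens only in states that are bad or have an output, then a run with finite
total length that never meets a bad state stops, with the output of a state that is not bad. -/
lemma exists_halt (bad : Q → Prop) (inv : Q → Prop)
    (hinv : ∀ q, inv q → ¬ (bad q ∨ M.out q ≠ none) → ∀ v, inv (M.next q v))
    (hlen : ∀ q, M.out q = none → 0 < M.len q) (a : Fin n)
    (hout : ∀ q i, inv q → ¬ bad q → M.out q = some i → i = a)
    (x : ℕ → Fin n → ℝ) (q : Q) (hq : inv q)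
    (hfin : ⨆ k, M.val (fun q => bad q ∨ M.out q ≠ none) (fun q => M.len q) 0 k q x ≠ ⊤)
    (hbad : ⨆ k, M.val (fun q => bad q ∨ M.out q ≠ none) 0 (Set.indicator {q | bad q} 1) k q x < 1) :
    ∃ t : ℕ, (t : ℝ≥0∞) ≤
        ⨆ k, M.val (fun q => bad q ∨ M.out q ≠ none) (fun q => M.len q) 0 k q x ∧
      M.decision (M.traj (q, 0, 0) x t) = Sum.inr a ∧
      ∀ u < t, ∃ j, M.decision (M.traj (q, 0, 0) x u) = Sum.inl j := by
  set acc : Q → Prop := fun q => bad q ∨ M.out q ≠ none with hacc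
  obtain ⟨N, hN⟩ : ∃ N : ℕ, ⨆ k, M.val acc (fun q => M.len q) 0 k q x ≤ N :=
    (ENNReal.exists_nat_gt hfin).imp fun _ h => h.le
  clear hfin
  -- Every stage without output has positive length, so the bound on the total remaining length
  -- decreases.
  induction N using Nat.strong_induction_on generalizing q x with
  | _ N ih =>
  have hnb : ¬ bad q := by
    intro hb
    have h1 := (le_iSup (fun k => M.val acc 0 (Set.indicator {q | bad q} 1) k q x) 1).trans_lt hbad
    rw [M.val_succ_of_acc acc _ _ (Or.inl hb)] at h1
    simp [Set.indicator, hb] at h1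
  by_cases ho : M.out q = none
  · have hna : ¬ acc q := by simp [hacc, hnb, ho]
    have hl := hlen q ho
    have key : ∀ (c f : Q → ℝ≥0∞), ⨆ k, M.val acc c f k q x =
        c q + ⨆ k, M.val acc c f k (M.next q (M.sums q x)) (shiftSeq (M.len q) x) := by
      intro c f
      rw [ENNReal.add_iSup, ← sup_iSup_nat_succ]
      simp_rw [M.val_succ_of_not_acc acc c f hna]
      simp [val]
    rw [key] at hbad hN ⊢
    have hle : M.len q ≤ N := by
      have : (M.len q : ℝ≥0∞) ≤ N := le_self_add.trans hN
      exact_mod_cast this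
    obtain ⟨t, ht, hta, htu⟩ := ih (N - M.len q) (by omega) (shiftSeq (M.len q) x)
      (M.next q (M.sums q x)) (hinv q hq hna _) (by simpa using hbad) (by
        rw [ENNReal.natCast_sub]
        exact ENNReal.le_sub_of_add_le_left (by simp) hN)
    have htr : ∀ b, M.traj (q, 0, 0) x (M.len q + b) =
        M.traj (M.next q (M.sums q x), 0, 0) (shiftSeq (M.len q) x) b := fun b => by
      rw [M.traj_shift, M.traj_len ho x hl]
    refine ⟨M.len q + t, ?_, ?_, ?_⟩
    · push_cast; gcongr
    · rw [htr, hta]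
    · intro u hu
      by_cases hul : u < M.len q
      · rw [M.traj_of_lt ho x hul]
        simp [decision, ho]
      · obtain ⟨b, rfl⟩ : ∃ b, u = M.len q + b := ⟨u - M.len q, by omega⟩
        rw [htr]
        exact htu b (by omega)
  · obtain ⟨i, hi⟩ := Option.ne_none_iff_exists'.1 ho
    refine ⟨0, by simp, ?_, by simp⟩
    simp [traj, decision, hi, hout q i hq hnb hi]

end Stopping

end StagedPolicy

/-! ### Running infinitely many algorithms in parallel -/

/-- The time of the `u`-th sample of the `l`-th of infinitely many algorithms that share the
sampling times, the `l`-th one receiving a fraction `2 ^ (-l - 1)` of them. -/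
def slot (l u : ℕ) : ℕ := 2 ^ l * (2 * u + 1) - 1

lemma slot_add_one (l u : ℕ) : slot l u + 1 = 2 ^ l * (2 * u + 1) :=
  Nat.sub_add_cancel (Nat.mul_pos (by positivity) (by omega))

/-- The 2-adic valuation of `slot l u + 1` is `l`, and its odd part gives `u`. -/
lemma slot_injective : Function.Injective fun p : ℕ × ℕ => slot p.1 p.2 := by
  rintro ⟨l, u⟩ ⟨l', u'⟩ h
  have h' : 2 ^ l * (2 * u + 1) = 2 ^ l' * (2 * u' + 1) := by
    rw [← slot_add_one, ← slot_add_one]; exact congrArg (· + 1) h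
  have hl : l = l' := by
    have hv := congrArg (padicValNat 2) h'
    have hodd : ∀ v, padicValNat 2 (2 * v + 1) = 0 := fun v =>
      padicValNat.eq_zero_of_not_dvd (by omega)
    rw [padicValNat.mul (by positivity) (by omega), padicValNat.mul (by positivity) (by omega),
      padicValNat.prime_pow, padicValNat.prime_pow, hodd, hodd] at hv
    simpa using hv
  subst hl
  have := Nat.eq_of_mul_eq_mul_left (by positivity) h'
  simp only [Prod.mk.injEq, true_and]
  omega

lemma exists_slot_eq (t : ℕ) : ∃ p : ℕ × ℕ, slot p.1 p.2 = t := by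
  obtain ⟨l, m, hm, h⟩ := Nat.exists_eq_two_pow_mul_odd (n := t + 1) (by omega)
  obtain ⟨u, rfl⟩ := hm
  exact ⟨(l, u), by have := slot_add_one l u; simp only; omega⟩

/-- The algorithm that owns time `t`, and the index of `t` among the times of that algorithm. -/
noncomputable def owner (t : ℕ) : ℕ × ℕ := (exists_slot_eq t).choose

lemma slot_owner (t : ℕ) : slot (owner t).1 (owner t).2 = t := (exists_slot_eq t).choose_spec

lemma owner_slot (l u : ℕ) : owner (slot l u) = (l, u) :=
  slot_injective (slot_owner (slot l u))

lemma slot_strictMono (l : ℕ) : StrictMono (slot l) := by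
  intro u v huv
  have h1 := slot_add_one l u
  have h2 := slot_add_one l v
  have h3 : 2 ^ l * (2 * u + 1) < 2 ^ l * (2 * v + 1) :=
    Nat.mul_lt_mul_of_pos_left (by omega) (by positivity)
  omega

/-- The rewards at the times of the `l`-th algorithm. -/
def subTable {α : Type*} (l : ℕ) (x : ℕ → α) (u : ℕ) : α := x (slot l u)

lemma measurable_subTable {α : Type*} [MeasurableSpace α] (l : ℕ) :
    Measurable (subTable l : (ℕ → α) → ℕ → α) :=
  measurable_pi_lambda _ fun _ => measurable_pi_apply _

lemma measurePreserving_subTable {α : Type*} [MeasurableSpace α] (μ : Measure α)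
    [IsProbabilityMeasure μ] (l : ℕ) :
    MeasurePreserving (subTable l) (Measure.infinitePi fun _ : ℕ => μ)
      (Measure.infinitePi fun _ : ℕ => μ) :=
  ⟨measurable_subTable l, Measure.map_infinitePi_infinitePi_of_inj (P := fun _ : ℕ => μ)
    (slot_strictMono l).injective⟩

/-- The slots of different algorithms are disjoint: reindexing an i.i.d. sequence injectively by
pairs and currying gives an i.i.d. family of i.i.d. sequences. -/
lemma iIndepFun_subTable {α : Type*} [MeasurableSpace α] (μ : Measure α)
    [IsProbabilityMeasure μ] :
    iIndepFun (fun l => (subTable l : (ℕ → α) → ℕ → α)) (Measure.infinitePi fun _ : ℕ => μ) := by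
  rw [iIndepFun_iff_map_fun_eq_infinitePi_map measurable_subTable]
  simp_rw [fun l => (measurePreserving_subTable μ l).map_eq]
  rw [← Measure.infinitePi_map_curry (fun _ _ : ℕ => μ),
    ← Measure.map_infinitePi_infinitePi_of_inj (P := fun _ : ℕ => μ) slot_injective,
    Measure.map_map (MeasurableEquiv.measurable (MeasurableEquiv.curry ℕ ℕ α))
      (measurable_pi_lambda (fun (x : ℕ → α) (p : ℕ × ℕ) => x (slot p.1 p.2))
        fun _ => measurable_pi_apply _)]
  rfl

namespace BanditAlgorithm

variable {n : ℕ}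

lemma history_eq (A : BanditAlgorithm n) (s : A.Seed) (x : ℕ → Fin n → ℝ) (t : ℕ) :
    A.history s x t = fun u : Fin t =>
      (Sum.elim id id (A.action s x u), x u (Sum.elim id id (A.action s x u))) := by
  induction t with
  | zero => ext u <;> exact u.elim0
  | succ t ih =>
    funext u
    refine Fin.lastCases ?_ (fun v => ?_) u
    · simp [history, action]
    · simp only [history, Fin.snoc_castSucc, Fin.val_castSucc]
      rw [ih]

lemma StopsWith.unique {A : BanditAlgorithm n} {s : A.Seed} {x : ℕ → Fin n → ℝ} {t t' : ℕ}
    {i i' : Fin n} (h : A.StopsWith s x t i) (h' : A.StopsWith s x t' i') : i = i' := by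
  rcases lt_trichotomy t t' with hlt | rfl | hlt
  · obtain ⟨j, hj⟩ := h'.2 t hlt
    simp [h.1] at hj
  · exact Sum.inr_injective (h.1.symm.trans h'.1)
  · obtain ⟨j, hj⟩ := h.2 t' hlt
    simp [h'.1] at hj

lemma exists_stopsWith_of_action (A : BanditAlgorithm n) (s : A.Seed) (x : ℕ → Fin n → ℝ) {t : ℕ}
    {i : Fin n} (h : A.action s x t = Sum.inr i) : ∃ t' ≤ t, ∃ i', A.StopsWith s x t' i' := by
  classical
  have hex : ∃ t i, A.action s x t = Sum.inr i := ⟨t, i, h⟩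
  obtain ⟨i', hi'⟩ := Nat.find_spec hex
  refine ⟨Nat.find hex, Nat.find_le ⟨i, h⟩, i', hi', fun u hu => ?_⟩
  have := Nat.find_min hex hu
  cases hau : A.action s x u with
  | inl j => exact ⟨j, rfl⟩
  | inr j => exact absurd ⟨j, hau⟩ this

/-- Infinitely many algorithms (with fixed seeds) run in parallel until one of them stops. -/
noncomputable def parallel (A : ℕ → BanditAlgorithm n) (s : ∀ l, (A l).Seed) :
    BanditAlgorithm n where
  Seed := Unit
  seedLaw := Measure.dirac ()
  decide t p := (A (owner t).1).decide (owner t).2 (s _, fun v => p.2 ⟨slot (owner t).1 v,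
    lt_of_lt_of_eq (slot_strictMono _ v.2) (slot_owner t)⟩)
  measurable_decide _ := ((A _).measurable_decide _).comp
    (measurable_const.prodMk (measurable_pi_lambda _ fun _ =>
      (measurable_pi_apply _).comp measurable_snd))

section Parallel

variable (A : ℕ → BanditAlgorithm n) (s : ∀ l, (A l).Seed)

/-- By strong induction on time, what the parallel run recorded at the slots of one copy is that
copy's own history on its own table. -/
lemma parallel_action (x : ℕ → Fin n → ℝ) (t : ℕ) :
    (parallel A s).action () x t =
      (A (owner t).1).action (s _) (subTable (owner t).1 x) (owner t).2 := by
  induction t using Nat.strong_induction_on with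
  | _ t ih =>
  have h1 : (parallel A s).action () x t = (A (owner t).1).decide (owner t).2
      (s _, fun v => (parallel A s).history () x t ⟨slot (owner t).1 v,
        lt_of_lt_of_eq (slot_strictMono _ v.2) (slot_owner t)⟩) := rfl
  rw [h1, action, history_eq (A (owner t).1)]
  congr 2
  funext v
  refine (congrFun (history_eq (parallel A s) () x t) _).trans ?_
  have hv : slot (owner t).1 v < t := lt_of_lt_of_eq (slot_strictMono _ v.2) (slot_owner t)
  have h2 : (parallel A s).action () x (slot (owner t).1 v) =
      (A (owner t).1).action (s _) (subTable (owner t).1 x) v := by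
    rw [ih _ hv, owner_slot]
  simp only
  rw [h2]
  rfl

lemma parallel_action_slot (x : ℕ → Fin n → ℝ) (l u : ℕ) :
    (parallel A s).action () x (slot l u) = (A l).action (s l) (subTable l x) u := by
  rw [parallel_action, owner_slot]

lemma StopsWith.of_parallel {x : ℕ → Fin n → ℝ} {t : ℕ} {i : Fin n}
    (h : (parallel A s).StopsWith () x t i) :
    (A (owner t).1).StopsWith (s _) (subTable (owner t).1 x) (owner t).2 i := by
  refine ⟨by rw [← parallel_action]; exact h.1, fun u hu => ?_⟩
  rw [← parallel_action_slot]
  exact h.2 _ (lt_of_lt_of_eq (slot_strictMono _ hu) (slot_owner t))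

lemma parallel_samples_le {x : ℕ → Fin n → ℝ} {l t : ℕ} {i : Fin n}
    (h : (A l).StopsWith (s l) (subTable l x) t i) :
    (parallel A s).samples () x ≤ 2 ^ l * (2 * t + 1) := by
  obtain ⟨t', ht', i', hi'⟩ := exists_stopsWith_of_action (parallel A s) () x (t := slot l t)
    (by rw [parallel_action_slot]; exact h.1)
  refine (iInf₂_le t' ⟨i', hi'⟩).trans ?_
  have : t' ≤ 2 ^ l * (2 * t + 1) := by
    have := slot_add_one l t
    omega
  exact_mod_cast this

variable (I : BestArmInstance n) {B : ℕ → Set (ℕ → Fin n → ℝ)} (hB : ∀ l, MeasurableSet (B l))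
  {β : ℕ → ℝ≥0∞} (hβ : ∀ l, I.rewardLaw (B l) ≤ β l)
  {Y : ℕ → (ℕ → Fin n → ℝ) → ℝ≥0∞}
  (hhalt : ∀ l, ∀ x ∉ B l, ∃ t : ℕ, (t : ℝ≥0∞) ≤ Y l x ∧ (A l).StopsWith (s l) x t I.best)

include hβ hB in
lemma measure_subTable_mem_le (l : ℕ) : I.rewardLaw {x | subTable l x ∈ B l} ≤ β l :=
  ((measurePreserving_subTable (Measure.pi I.dist) l).measure_preimage
    (hB l).nullMeasurableSet).trans_le (hβ l)

include hβ hB hhalt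

/-- When no copy is bad, copy 0 forces the parallel run to stop, and the copy that stops it first,
whichever it is, answers correctly. A union bound over the copies does the rest. -/
lemma parallel_successProb_ge : 1 - ∑' l, β l ≤ (parallel A s).successProb I := by
  set E : Set (ℕ → Fin n → ℝ) := ⋃ l, {x | subTable l x ∈ B l} with hE
  have hEm : MeasurableSet E := MeasurableSet.iUnion fun l => measurable_subTable l (hB l)
  have h1 : I.rewardLaw E ≤ ∑' l, β l :=
    (measure_iUnion_le _).trans (ENNReal.tsum_le_tsum fun l => measure_subTable_mem_le I hB hβ l)
  have h2 : (Set.univ : Set Unit) ×ˢ Eᶜ ⊆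
      {ω : Unit × (ℕ → Fin n → ℝ) | ∃ t, (parallel A s).StopsWith ω.1 ω.2 t I.best} := by
    rintro ⟨⟨⟩, x⟩ ⟨-, hx⟩
    simp only [hE, Set.mem_compl_iff, Set.mem_iUnion, Set.mem_ofPred_eq, not_exists] at hx
    obtain ⟨t, -, ht⟩ := hhalt 0 _ (hx 0)
    obtain ⟨t', -, i', hi'⟩ := exists_stopsWith_of_action (parallel A s) () x (t := slot 0 t)
      (by rw [parallel_action_slot]; exact ht.1)
    obtain ⟨t'', -, h''⟩ := hhalt (owner t').1 _ (hx _)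
    have := (StopsWith.of_parallel A s hi').unique h''
    exact ⟨t', this ▸ hi'⟩
  calc 1 - ∑' l, β l ≤ 1 - I.rewardLaw E := by gcongr
    _ = I.rewardLaw Eᶜ := (prob_compl_eq_one_sub hEm).symm
    _ = ((Measure.dirac () : Measure Unit).prod I.rewardLaw) (Set.univ ×ˢ Eᶜ) := by
        rw [Measure.prod_prod]; simp
    _ ≤ _ := measure_mono h2

/-- The run ends no later than the first copy that is not bad does. If that is copy `l + 1`, then
copy `l` is bad; this event is independent of the table of copy `l + 1`, so the expectations
multiply. -/
lemma parallel_expectedSamples_le (hY : ∀ l, Measurable (Y l)) (hsum : ∑' l, β l ≠ ⊤)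
    {τ : ℕ → ℝ≥0∞} (hτ : ∀ l, ∫⁻ x, Y l x ∂I.rewardLaw ≤ τ l) :
    (parallel A s).expectedSamples I ≤
      (2 * τ 0 + 1) + ∑' l, β l * (2 ^ (l + 1) * (2 * τ (l + 1) + 1)) := by
  set g : (ℕ → Fin n → ℝ) → ℝ≥0∞ := fun x => (2 * Y 0 (subTable 0 x) + 1) +
    ∑' l, (B l).indicator 1 (subTable l x) *
      (2 ^ (l + 1) * (2 * Y (l + 1) (subTable (l + 1) x) + 1)) with hg
  have hind : ∀ l, Measurable fun x : ℕ → Fin n → ℝ => (B l).indicator (1 : (ℕ → Fin n → ℝ) → ℝ≥0∞) (subTable l x) :=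
    fun l => (measurable_one.indicator (hB l)).comp (measurable_subTable l)
  have hYm : ∀ l, Measurable fun y => (2 : ℝ≥0∞) ^ l * (2 * Y l y + 1) := fun l =>
    (((hY l).const_mul 2).add_const 1).const_mul _
  have hterm : ∀ l, ∫⁻ x, (2 : ℝ≥0∞) ^ l * (2 * Y l (subTable l x) + 1) ∂I.rewardLaw ≤
      2 ^ l * (2 * τ l + 1) := fun l => by
    rw [BestArmInstance.rewardLaw,
      (measurePreserving_subTable (Measure.pi I.dist) l).lintegral_comp (hYm l),
      lintegral_const_mul _ (((hY l).const_mul 2).add_const 1),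
      lintegral_add_right _ measurable_const, lintegral_const_mul _ (hY l), lintegral_const,
      measure_univ, mul_one]
    gcongr
    exact hτ l
  have hgm : Measurable g := by
    refine Measurable.add ?_ (Measurable.tsum fun l => (hind l).mul
      ((hYm _).comp (measurable_subTable _)))
    exact (((hY 0).comp (measurable_subTable 0)).const_mul 2).add_const 1
  -- The event that all copies are bad has probability at most every `β l`, and `β l` tends to zero.
  have hae : ∀ᵐ x ∂I.rewardLaw, ∃ l, subTable l x ∉ B l := by
    rw [ae_iff]
    push Not
    refine le_antisymm (ge_of_tendsto' (ENNReal.tendsto_atTop_zero_of_tsum_ne_top hsum)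
      fun l => ?_) zero_le
    exact (measure_mono fun x (hx : ∀ l, subTable l x ∈ B l) => hx l).trans (measure_subTable_mem_le I hB hβ l)
  have hle : ∀ᵐ x ∂I.rewardLaw, (parallel A s).samples () x ≤ g x := by
    filter_upwards [hae] with x hx
    classical
    obtain ⟨t, htY, ht⟩ := hhalt _ _ (Nat.find_spec hx)
    refine (parallel_samples_le A s ht).trans ?_
    rcases hl : Nat.find hx with _ | l
    · rw [hl] at htY
      refine le_trans ?_ le_self_add
      rw [pow_zero, one_mul]
      gcongr
    · rw [hl] at htY
      refine le_trans ?_ le_add_self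
      refine le_trans ?_ (ENNReal.le_tsum l)
      have : subTable l x ∈ B l := by
        have := Nat.find_min hx (m := l) (by omega)
        simpa using this
      rw [Set.indicator_of_mem this, Pi.one_apply, one_mul]
      gcongr
  have hint : (parallel A s).expectedSamples I ≤ ∫⁻ x, g x ∂I.rewardLaw := by
    have hsnd : MeasurePreserving (Prod.snd : Unit × (ℕ → Fin n → ℝ) → _)
        ((Measure.dirac () : Measure Unit).prod I.rewardLaw) I.rewardLaw := measurePreserving_snd
    rw [← hsnd.lintegral_comp hgm]
    exact lintegral_mono_ae (hsnd.quasiMeasurePreserving.ae hle)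
  refine hint.trans ?_
  have hY0 : Measurable fun x => 2 * Y 0 (subTable 0 x) + 1 :=
    (((hY 0).comp (measurable_subTable 0)).const_mul 2).add_const 1
  have hYs : ∀ l, Measurable fun x : ℕ → Fin n → ℝ =>
      (2 : ℝ≥0∞) ^ l * (2 * Y l (subTable l x) + 1) := fun l => (hYm l).comp (measurable_subTable l)
  have hprod : ∀ l, Measurable fun x : ℕ → Fin n → ℝ =>
      (B l).indicator (1 : (ℕ → Fin n → ℝ) → ℝ≥0∞) (subTable l x) *
        (2 ^ (l + 1) * (2 * Y (l + 1) (subTable (l + 1) x) + 1)) :=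
    fun l => (hind l).mul (hYs (l + 1))
  simp only [hg]
  rw [lintegral_add_left hY0, lintegral_tsum fun l => (hprod l).aemeasurable]
  refine add_le_add (by simpa using hterm 0) (ENNReal.tsum_le_tsum fun l => ?_)
  have hi : IndepFun (fun x => (B l).indicator (1 : (ℕ → Fin n → ℝ) → ℝ≥0∞) (subTable l x))
      (fun x => (2 : ℝ≥0∞) ^ (l + 1) * (2 * Y (l + 1) (subTable (l + 1) x) + 1)) I.rewardLaw :=
    ((iIndepFun_subTable (Measure.pi I.dist)).indepFun (show l ≠ l + 1 by omega)).comp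
      (measurable_one.indicator (hB l)) (hYm (l + 1))
  have := lintegral_mul_eq_lintegral_mul_lintegral_of_indepFun (hind l)
    (hYs (l + 1)) hi
  simp only [Pi.mul_apply] at this
  refine this.trans_le (mul_le_mul' ?_ (hterm _))
  have h3 : ∀ x : ℕ → Fin n → ℝ, (B l).indicator (1 : (ℕ → Fin n → ℝ) → ℝ≥0∞) (subTable l x) =
      ({x | subTable l x ∈ B l} : Set _).indicator 1 x := fun x => rfl
  simp_rw [h3]
  exact (lintegral_indicator_one_le _).trans (measure_subTable_mem_le I hB hβ l)

end Parallel

end BanditAlgorithm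

/-! ### Selecting the better half -/

section TopHalf

variable {n : ℕ}

lemma exists_top_subset (T : Finset (Fin n)) (v : Fin n → ℝ) (k : ℕ) (hk : k ≤ T.card) :
    ∃ U ⊆ T, U.card = k ∧ ∀ i ∈ U, ∀ i' ∈ T \ U, v i' ≤ v i := by
  induction k with
  | zero => exact ⟨∅, by simp, by simp, by simp⟩
  | succ k ih =>
    obtain ⟨U, hU, hc, hv⟩ := ih (by omega)
    have hne : (T \ U).Nonempty := by
      rw [← Finset.card_pos, Finset.card_sdiff_of_subset hU]; omega
    obtain ⟨a, ha, hmax⟩ := Finset.exists_max_image (T \ U) v hne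
    have haT := Finset.mem_sdiff.1 ha
    refine ⟨insert a U, Finset.insert_subset haT.1 hU, by
      rw [Finset.card_insert_of_notMem haT.2, hc], fun i hi i' hi' => ?_⟩
    have hi'' : i' ∈ T \ U := by
      simp only [Finset.mem_sdiff, Finset.mem_insert, not_or] at hi' ⊢
      exact ⟨hi'.1, hi'.2.2⟩
    rcases Finset.mem_insert.1 hi with rfl | hi
    · exact hmax i' hi''
    · exact hv i hi i' hi''

open Classical in
/-- The better half of the elements of `T` with respect to the preorder `R`. -/
noncomputable def topHalfRel (T : Finset (Fin n)) (R : Fin n → Fin n → Prop) : Finset (Fin n) :=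
  if h : ∃ U ⊆ T, U.card = (T.card + 1) / 2 ∧ ∀ i ∈ U, ∀ i' ∈ T \ U, R i' i then h.choose else ∅

/-- A half of `T` (rounded up) on which the values `v` are largest. -/
noncomputable def topHalf (T : Finset (Fin n)) (v : Fin n → ℝ) : Finset (Fin n) :=
  topHalfRel T fun i i' => v i ≤ v i'

lemma topHalf_spec (T : Finset (Fin n)) (v : Fin n → ℝ) :
    topHalf T v ⊆ T ∧ (topHalf T v).card = (T.card + 1) / 2 ∧
      ∀ i ∈ topHalf T v, ∀ i' ∈ T \ topHalf T v, v i' ≤ v i := by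
  have h := exists_top_subset T v ((T.card + 1) / 2) (by omega)
  rw [topHalf, topHalfRel, dif_pos h]
  exact h.choose_spec

/-- The chosen half depends on the values only through their pairwise comparisons, which range over
a finite space on which every function is measurable. -/
lemma measurable_topHalf [MeasurableSpace (Finset (Fin n))] (T : Finset (Fin n)) :
    Measurable (topHalf T) := by
  have h : Measurable fun (v : Fin n → ℝ) (i i' : Fin n) => v i ≤ v i' :=
    measurable_pi_lambda _ fun i => measurable_pi_lambda _ fun i' =>
      measurableSet_setOfPred.1 (measurableSet_le (measurable_pi_apply i) (measurable_pi_apply i'))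
  exact (measurable_of_countable (topHalfRel T)).comp h

end TopHalf

/-- Markov's inequality for the number of events that occur. -/
lemma measureReal_card_filter_ge_le {Ω ι : Type*} [MeasurableSpace Ω] (μ : Measure Ω)
    [IsProbabilityMeasure μ] (D : Finset ι) (P : ι → Ω → Prop) [∀ i x, Decidable (P i x)]
    (hP : ∀ i ∈ D, MeasurableSet {x | P i x}) {p c : ℝ} (hc : 0 < c)
    (hp : ∀ i ∈ D, μ.real {x | P i x} ≤ p) :
    μ.real {x | c ≤ (D.filter (P · x)).card} ≤ D.card * p / c := by
  have h1 : ∀ x, ((D.filter (P · x)).card : ℝ) = ∑ i ∈ D, {x | P i x}.indicator 1 x := by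
    intro x
    rw [Finset.card_filter]
    push_cast
    refine Finset.sum_congr rfl fun i _ => ?_
    by_cases h : P i x <;> simp [Set.indicator, h]
  simp_rw [h1]
  have hi : ∀ i ∈ D, Integrable ({x | P i x}.indicator (1 : Ω → ℝ)) μ := fun i hi =>
    (integrable_const (1 : ℝ)).indicator (hP i hi)
  have h2 := mul_meas_ge_le_integral_of_nonneg (μ := μ)
    (f := fun x => ∑ i ∈ D, {x | P i x}.indicator (1 : Ω → ℝ) x)
    (Filter.Eventually.of_forall fun x => Finset.sum_nonneg fun i _ =>
      Set.indicator_nonneg (fun _ _ => zero_le_one) x)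
    (integrable_finsetSum D hi) c
  rw [integral_finsetSum D hi] at h2
  rw [le_div_iff₀ hc, mul_comm]
  refine h2.trans ?_
  rw [← nsmul_eq_mul]
  refine Finset.sum_le_card_nsmul _ _ _ fun i hi => ?_
  rw [integral_indicator_one (hP i hi)]
  exact hp i hi

/-! ### Concentration for halving and for counting near optimal arms -/

namespace StagedPolicy

variable {n : ℕ} {Q : Type} (M : StagedPolicy n Q) (I : BestArmInstance n) (q : Q)

lemma measure_sums_ge_le (i : Fin n) {y : ℝ} (hy : 0 ≤ y) :
    I.rewardLaw.real {x | M.pulls q i * (I.mean i + y) ≤ M.sums q x i} ≤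
      Real.exp (-(M.pulls q i * y ^ 2 / 2)) := by
  have h := M.measure_sum_sums_ge_le I q {i} (y := M.pulls q i * y) (by positivity)
  simp only [Finset.sum_singleton] at h
  refine le_of_eq_of_le ?_ (h.trans (le_of_eq ?_))
  · congr 1; ext x; simp only [Set.mem_ofPred_eq]
    constructor <;> intro h <;> linarith
  · congr 1
    rcases Nat.eq_zero_or_pos (M.pulls q i) with h0 | h0
    · simp [h0]
    · have : (0 : ℝ) < M.pulls q i := by exact_mod_cast h0
      field_simp

lemma measure_sums_le_le (i : Fin n) {y : ℝ} (hy : 0 ≤ y) :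
    I.rewardLaw.real {x | M.sums q x i ≤ M.pulls q i * (I.mean i - y)} ≤
      Real.exp (-(M.pulls q i * y ^ 2 / 2)) := by
  have h := M.measure_sum_sums_le_le I q {i} (y := M.pulls q i * y) (by positivity)
  simp only [Finset.sum_singleton] at h
  refine le_of_eq_of_le ?_ (h.trans (le_of_eq ?_))
  · congr 1; ext x; simp only [Set.mem_ofPred_eq]
    constructor <;> intro h <;> linarith
  · congr 1
    rcases Nat.eq_zero_or_pos (M.pulls q i) with h0 | h0
    · simp [h0]
    · have : (0 : ℝ) < M.pulls q i := by exact_mod_cast h0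
      field_simp

lemma measurable_sums_apply (i : Fin n) : Measurable fun x => M.sums q x i :=
  (measurable_pi_apply i).comp (M.measurable_sums q)

/-- When all arms of `T` are pulled `N` times, it is unlikely that the better half of `T` misses
the arm `b` and nevertheless contains many arms that are worse than `b` by `e`. -/
lemma measure_topHalf_le (T : Finset (Fin n)) {N : ℕ} (hN : ∀ i ∈ T, M.pulls q i = N)
    {b : Fin n} (hb : b ∈ T) {e : ℝ} (he : 0 < e) :
    I.rewardLaw.real {x | b ∉ topHalf T (M.sums q x) ∧ T.card ≤
        4 * ((topHalf T (M.sums q x)).filter fun i => I.mean i ≤ I.mean b - e).card} ≤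
      5 * Real.exp (-(N * e ^ 2 / 8)) := by
  classical
  set p := Real.exp (-(N * e ^ 2 / 8)) with hp
  set D := T.filter fun i => I.mean i ≤ I.mean b - e with hD
  have hT : (0 : ℝ) < T.card := by exact_mod_cast Finset.card_pos.2 ⟨b, hb⟩
  have h1 : I.rewardLaw.real {x | M.sums q x b ≤ M.pulls q b * (I.mean b - e / 2)} ≤ p := by
    refine (M.measure_sums_le_le I q b (by positivity)).trans (le_of_eq ?_)
    rw [hN b hb, hp]; congr 1; ring
  -- Markov's inequality: each arm of `D` passes the midpoint `mean b - e / 2` with probability at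
  -- most `p`, `D` has at most `T.card` arms, and a quarter of `T.card` is required.
  have h2 : I.rewardLaw.real {x | (T.card / 4 : ℝ) ≤
      (D.filter fun i => N * (I.mean b - e / 2) ≤ M.sums q x i).card} ≤ 4 * p := by
    refine (measureReal_card_filter_ge_le I.rewardLaw D
      (fun i x => N * (I.mean b - e / 2) ≤ M.sums q x i)
      (fun i _ => measurableSet_le measurable_const (M.measurable_sums_apply q i))
      (p := p) (by positivity) fun i hi => ?_).trans ?_
    · obtain ⟨hiT, him⟩ := Finset.mem_filter.1 hi
      refine le_trans (measureReal_mono fun x hx => ?_)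
        ((M.measure_sums_ge_le I q i (y := e / 2) (by positivity)).trans (le_of_eq ?_))
      · simp only [Set.mem_ofPred_eq] at hx ⊢
        rw [hN i hiT]
        refine le_trans ?_ hx
        gcongr
        linarith
      · rw [hN i hiT, hp]; congr 1; ring
    · rw [div_le_iff₀ (by positivity)]
      have : (D.card : ℝ) ≤ T.card := by exact_mod_cast Finset.card_filter_le _ _
      have hp0 : 0 < p := Real.exp_pos _
      nlinarith
  calc _ ≤ I.rewardLaw.real ({x | M.sums q x b ≤ M.pulls q b * (I.mean b - e / 2)} ∪
        {x | (T.card / 4 : ℝ) ≤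
          (D.filter fun i => N * (I.mean b - e / 2) ≤ M.sums q x i).card}) := by
        refine measureReal_mono ?_
        rintro x ⟨hx1, hx2⟩
        by_cases hxb : M.sums q x b ≤ M.pulls q b * (I.mean b - e / 2)
        · exact Or.inl hxb
        · right
          rw [hN b hb] at hxb
          obtain ⟨hU, -, hv⟩ := topHalf_spec T (M.sums q x)
          have hsub : ((topHalf T (M.sums q x)).filter fun i => I.mean i ≤ I.mean b - e) ⊆
              D.filter fun i => N * (I.mean b - e / 2) ≤ M.sums q x i := by
            intro i hi
            obtain ⟨hiU, him⟩ := Finset.mem_filter.1 hi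
            refine Finset.mem_filter.2 ⟨Finset.mem_filter.2 ⟨hU hiU, him⟩, ?_⟩
            have := hv i hiU b (Finset.mem_sdiff.2 ⟨hb, hx1⟩)
            linarith
          have h3 : (T.card : ℝ) ≤
              4 * (D.filter fun i => N * (I.mean b - e / 2) ≤ M.sums q x i).card := by
            exact_mod_cast hx2.trans (Nat.mul_le_mul_left 4 (Finset.card_le_card hsub))
          simp only [Set.mem_ofPred_eq]
          linarith
    _ ≤ p + 4 * p := (measureReal_union_le _ _).trans (add_le_add h1 h2)
    _ = 5 * p := by ring

/-- The number of arms of `S` whose empirical mean is not below that of `b` by more than `e`. -/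
noncomputable def nearCount (S : Finset (Fin n)) (b : Fin n) (e : ℝ) (N : Fin n → ℕ)
    (v : Fin n → ℝ) : ℕ :=
  (S.filter fun i => v b / N b - e ≤ v i / N i).card

/-- It is unlikely that few arms look near optimal when in fact many arms are. -/
lemma measure_nearCount_le_le (S : Finset (Fin n)) (b : Fin n) {N : ℕ}
    (hN : ∀ i ∈ S, i ≠ b → M.pulls q i = N) (hN0 : 0 < N) (hb0 : 0 < M.pulls q b) {e : ℝ}
    (he : 0 < e) (hbest : ∀ i, I.mean i ≤ I.mean I.best)
    (hG : S.card + 4 < 4 * (S.filter fun i => I.gap i < e / 4).card) :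
    I.rewardLaw.real {x | 8 * nearCount S b e (M.pulls q) (M.sums q x) ≤ S.card + 8} ≤
      Real.exp (-(M.pulls q b * e ^ 2 / 32)) +
        2 ^ S.card * Real.exp (-(S.card * N * e ^ 2 / 64)) := by
  classical
  -- The sets of near optimal arms that could be overlooked. The arm `b` is never overlooked when it
  -- is in `S`, and is left out because it may be pulled a different number of times.
  set 𝒲 : Finset (Finset (Fin n)) := S.powerset.filter fun W =>
    S.card ≤ 8 * W.card ∧ b ∉ W ∧ ∀ i ∈ W, I.gap i < e / 4 with h𝒲
  have h1 : I.rewardLaw.real {x | M.pulls q b * (I.mean b + e / 4) ≤ M.sums q x b} ≤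
      Real.exp (-(M.pulls q b * e ^ 2 / 32)) := by
    refine (M.measure_sums_ge_le I q b (by positivity)).trans (le_of_eq ?_)
    congr 1; ring
  have h2 : ∀ W ∈ 𝒲, I.rewardLaw.real {x | ∑ i ∈ W, (M.sums q x i - M.pulls q i * I.mean i) ≤
      -(W.card * N * (e / 2))} ≤ Real.exp (-(S.card * N * e ^ 2 / 64)) := by
    intro W hW
    obtain ⟨hWS, hc, hbW, -⟩ := Finset.mem_filter.1 hW
    have hs : ∑ i ∈ W, (M.pulls q i : ℝ) = W.card * N := by
      rw [← nsmul_eq_mul, ← Finset.sum_const]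
      refine Finset.sum_congr rfl fun i hi => ?_
      rw [hN i (Finset.mem_powerset.1 hWS hi) (fun h => hbW (h ▸ hi))]
    refine (M.measure_sum_sums_le_le I q W (by positivity)).trans (Real.exp_le_exp.2 ?_)
    rw [hs]
    have hc' : (S.card : ℝ) ≤ 8 * W.card := by exact_mod_cast hc
    have hN' : (0 : ℝ) < N := by exact_mod_cast hN0
    rcases Nat.eq_zero_or_pos W.card with h0 | h0
    · have h0' : (W.card : ℝ) = 0 := by exact_mod_cast h0
      rw [h0'] at hc' ⊢
      have : (S.card : ℝ) = 0 := le_antisymm (by linarith) (by positivity)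
      simp [this]
    · have h0' : (0 : ℝ) < W.card := by exact_mod_cast h0
      have : -(W.card * N * (e / 2)) ^ 2 / (2 * (W.card * N)) = -(W.card * N * e ^ 2 / 8) := by
        field_simp; ring
      rw [this]
      have : (S.card : ℝ) * (N * e ^ 2) ≤ 8 * W.card * (N * e ^ 2) := by gcongr
      nlinarith
  have hsub : {x | 8 * nearCount S b e (M.pulls q) (M.sums q x) ≤ S.card + 8} ⊆
      {x | M.pulls q b * (I.mean b + e / 4) ≤ M.sums q x b} ∪
      ⋃ W ∈ 𝒲, {x | ∑ i ∈ W, (M.sums q x i - M.pulls q i * I.mean i) ≤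
        -(W.card * N * (e / 2))} := by
    intro x hx
    by_cases hxb : M.pulls q b * (I.mean b + e / 4) ≤ M.sums q x b
    · exact Or.inl hxb
    right
    simp only [Set.mem_ofPred_eq] at hx
    set G := S.filter fun i => I.gap i < e / 4
    set Z := S.filter fun i => M.sums q x b / M.pulls q b - e ≤ M.sums q x i / M.pulls q i
    have hZ : 8 * Z.card ≤ S.card + 8 := hx
    have hb0' : (0 : ℝ) < M.pulls q b := by exact_mod_cast hb0
    have hWc : G.card ≤ (G \ Z).card + Z.card := by
      have := Finset.le_card_sdiff Z G
      omega
    have hWS : G \ Z ⊆ S := Finset.sdiff_subset.trans (Finset.filter_subset _ _)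
    have hmem : ∀ i ∈ G \ Z, i ∈ S ∧ i ≠ b ∧ I.gap i < e / 4 ∧
        M.sums q x i / M.pulls q i < M.sums q x b / M.pulls q b - e := by
      intro i hi
      obtain ⟨hiG, hiZ⟩ := Finset.mem_sdiff.1 hi
      obtain ⟨hiS, hig⟩ := Finset.mem_filter.1 hiG
      have hlt : M.sums q x i / M.pulls q i < M.sums q x b / M.pulls q b - e := by
        by_contra hcon
        exact hiZ (Finset.mem_filter.2 ⟨hiS, not_lt.1 hcon⟩)
      refine ⟨hiS, ?_, hig, hlt⟩
      rintro rfl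
      linarith
    -- More than `S.card / 4 + 1` arms are near optimal and at most `S.card / 8 + 1` are counted,
    -- which leaves at least `S.card / 8` overlooked.
    refine Set.mem_biUnion (x := G \ Z) (Finset.mem_filter.2 ⟨Finset.mem_powerset.2 hWS,
      by omega, fun h => (hmem b h).2.1 rfl, fun i hi => (hmem i hi).2.2.1⟩) ?_
    simp only [Set.mem_ofPred_eq]
    have hle : ∀ i ∈ G \ Z, M.sums q x i - M.pulls q i * I.mean i ≤ -(N * (e / 2)) := by
      intro i hi
      obtain ⟨hiS, hib, hig, hlt⟩ := hmem i hi
      rw [hN i hiS hib] at hlt ⊢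
      have hN' : (0 : ℝ) < N := by exact_mod_cast hN0
      have h3 : M.sums q x b / M.pulls q b < I.mean b + e / 4 := by
        rw [div_lt_iff₀ hb0']; linarith
      rw [BestArmInstance.gap] at hig
      -- Of the apparent deficit `e` with respect to `b`, at most `e / 4` is due to the error of `b`
      -- and `e / 4` to the true gap, so `i` itself is off by more than `e / 2`.
      have h4 : M.sums q x i / N < I.mean i - e / 2 := by
        have := hbest b
        linarith
      rw [div_lt_iff₀ hN'] at h4
      nlinarith
    refine (Finset.sum_le_card_nsmul _ _ _ hle).trans (le_of_eq ?_)
    rw [nsmul_eq_mul]; ring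
  refine (measureReal_mono hsub).trans ((measureReal_union_le _ _).trans (add_le_add h1 ?_))
  refine (measureReal_biUnion_finset_le _ _).trans ((Finset.sum_le_card_nsmul _ _ _ h2).trans ?_)
  rw [nsmul_eq_mul]
  gcongr
  have : 𝒲.card ≤ 2 ^ S.card := (Finset.card_filter_le _ _).trans (Finset.card_powerset S).le
  exact_mod_cast this

/-- It is unlikely that many arms look near optimal when in fact only few arms are. -/
lemma measure_lt_nearCount_le (S : Finset (Fin n)) (b : Fin n) {N : ℕ}
    (hN : ∀ i ∈ S, i ≠ b → M.pulls q i = N) (hN0 : 0 < N) (hNb : N ≤ M.pulls q b) {e : ℝ}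
    (he : 0 < e) (hbm : I.mean I.best - e / 8 ≤ I.mean b) (hS : 0 < S.card)
    (hD : 16 * ((S.erase I.best).filter fun i => I.gap i < 2 * e).card ≤ S.card) :
    I.rewardLaw.real {x | S.card + 8 < 8 * nearCount S b e (M.pulls q) (M.sums q x)} ≤
      17 * Real.exp (-(N * e ^ 2 / 128)) := by
  classical
  set p := Real.exp (-(N * e ^ 2 / 128)) with hp
  set F := S.filter fun i => 2 * e ≤ I.gap i with hF
  have hN' : (0 : ℝ) < N := by exact_mod_cast hN0
  have hNb' : (N : ℝ) ≤ M.pulls q b := by exact_mod_cast hNb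
  have hS' : (0 : ℝ) < S.card := by exact_mod_cast hS
  have hFb : ∀ i ∈ F, i ∈ S ∧ i ≠ b ∧ I.mean i ≤ I.mean I.best - 2 * e := by
    intro i hi
    obtain ⟨hiS, hig⟩ := Finset.mem_filter.1 hi
    rw [BestArmInstance.gap] at hig
    refine ⟨hiS, ?_, by linarith⟩
    rintro rfl
    linarith
  have h1 : I.rewardLaw.real {x | M.sums q x b ≤ M.pulls q b * (I.mean b - e / 8)} ≤ p := by
    refine (M.measure_sums_le_le I q b (by positivity)).trans (Real.exp_le_exp.2 ?_)
    have : (N : ℝ) * e ^ 2 ≤ M.pulls q b * e ^ 2 := by gcongr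
    nlinarith
  -- Unless `b` is underestimated by `e / 8`, a counted arm looks at least as good as the best mean
  -- minus `e / 8 + e / 8 + e`. For an arm with gap at least `2 * e` this is an error of at least `3
  -- * e / 4`.
  have h2 : I.rewardLaw.real {x | (S.card / 16 : ℝ) ≤
      (F.filter fun i => N * (I.mean I.best - 5 * e / 4) ≤ M.sums q x i).card} ≤ 16 * p := by
    refine (measureReal_card_filter_ge_le I.rewardLaw F
      (fun i x => N * (I.mean I.best - 5 * e / 4) ≤ M.sums q x i)
      (fun i _ => measurableSet_le measurable_const (M.measurable_sums_apply q i))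
      (p := p) (by positivity) fun i hi => ?_).trans ?_
    · obtain ⟨hiS, hib, him⟩ := hFb i hi
      refine le_trans (measureReal_mono fun x hx => ?_)
        ((M.measure_sums_ge_le I q i (y := 3 * e / 4) (by positivity)).trans
          (Real.exp_le_exp.2 ?_))
      · simp only [Set.mem_ofPred_eq] at hx ⊢
        rw [hN i hiS hib]
        refine le_trans ?_ hx
        gcongr
        linarith
      · rw [hN i hiS hib]
        have : 0 ≤ (N : ℝ) * e ^ 2 := by positivity
        nlinarith
    · rw [div_le_iff₀ (by positivity)]
      have : (F.card : ℝ) ≤ S.card := by exact_mod_cast Finset.card_filter_le _ _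
      have hp0 : 0 < p := Real.exp_pos _
      nlinarith
  have hsub : {x | S.card + 8 < 8 * nearCount S b e (M.pulls q) (M.sums q x)} ⊆
      {x | M.sums q x b ≤ M.pulls q b * (I.mean b - e / 8)} ∪ {x | (S.card / 16 : ℝ) ≤
      (F.filter fun i => N * (I.mean I.best - 5 * e / 4) ≤ M.sums q x i).card} := by
    intro x hx
    by_cases hxb : M.sums q x b ≤ M.pulls q b * (I.mean b - e / 8)
    · exact Or.inl hxb
    right
    simp only [Set.mem_ofPred_eq] at hx ⊢
    have hb0' : (0 : ℝ) < M.pulls q b := hN'.trans_le hNb'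
    have h3 : I.mean b - e / 8 < M.sums q x b / M.pulls q b := by
      rw [lt_div_iff₀ hb0']; linarith
    set Z := S.filter fun i => M.sums q x b / M.pulls q b - e ≤ M.sums q x i / M.pulls q i
    set D := (S.erase I.best).filter fun i => I.gap i < 2 * e
    have hZ : S.card + 8 < 8 * Z.card := hx
    have hZs : Z ⊆ insert I.best D ∪
        F.filter fun i => N * (I.mean I.best - 5 * e / 4) ≤ M.sums q x i := by
      intro i hi
      obtain ⟨hiS, hiZ⟩ := Finset.mem_filter.1 hi
      rw [Finset.mem_union]
      by_cases hg : I.gap i < 2 * e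
      · left
        rw [Finset.mem_insert]
        by_cases hib : i = I.best
        · exact Or.inl hib
        · exact Or.inr (Finset.mem_filter.2 ⟨Finset.mem_erase.2 ⟨hib, hiS⟩, hg⟩)
      · right
        have hiF : i ∈ F := Finset.mem_filter.2 ⟨hiS, not_lt.1 hg⟩
        refine Finset.mem_filter.2 ⟨hiF, ?_⟩
        rw [hN i hiS (hFb i hiF).2.1] at hiZ
        have h4 : I.mean I.best - 5 * e / 4 ≤ M.sums q x i / N := by linarith
        rw [le_div_iff₀ hN'] at h4
        linarith
    have hc := (Finset.card_le_card hZs).trans (Finset.card_union_le _ _)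
    have hc2 := Finset.card_insert_le I.best D
    -- The summand 8 in the threshold makes room for the best arm itself, and `D` takes up at most
    -- half of the remaining `S.card / 8`.
    have h5 : S.card ≤
        16 * (F.filter fun i => N * (I.mean I.best - 5 * e / 4) ≤ M.sums q x i).card := by
      omega
    have h6 : (S.card : ℝ) ≤
        16 * (F.filter fun i => N * (I.mean I.best - 5 * e / 4) ≤ M.sums q x i).card := by
      exact_mod_cast h5
    linarith
  calc _ ≤ p + 16 * p :=
        (measureReal_mono hsub).trans ((measureReal_union_le _ _).trans (add_le_add h1 h2))
    _ = 17 * p := by ring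

end StagedPolicy

/-! ### The elimination procedure -/

/-- The state of the elimination procedure: the surviving arms `S`, the round `r` (arms are
compared at resolution `2 ^ (-r)`), the number `k` of earlier rounds with an elimination, the number
`j` of eliminations in the current round, the arms `T` that are still candidates in the search for a
near optimal arm of `S`, the number `l` of halvings in this search, and a flag that tells whether
the surviving arms are to be halved next. -/
@[ext]
structure ElimState (n : ℕ) where
  S : Finset (Fin n)
  r : ℕ
  k : ℕ
  j : ℕ
  T : Finset (Fin n)
  l : ℕ
  e : Bool

namespace ElimState

variable {n : ℕ}

instance : MeasurableSpace (ElimState n) := ⊤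

instance : DiscreteMeasurableSpace (ElimState n) := ⟨fun _ => trivial⟩

instance : Countable (ElimState n) :=
  Function.Injective.countable
    (f := fun q : ElimState n => (q.S, q.r, q.k, q.j, q.T, q.l, q.e)) fun a b h => by
      simp only [Prod.mk.injEq] at h
      ext1 <;> simp [h]

/-- The number of rounds with an elimination, including the current one. -/
def elimRounds (k j : ℕ) : ℕ := k + if j = 0 then 0 else 1

/-- The confidence exponent: `j` and `log (k + 2)` make the errors summable over the eliminations of
a round and over the rounds with an elimination. The round number deliberately does not enter. -/
noncomputable def wt (lam : ℝ) (k j : ℕ) : ℝ := lam + 1 + Real.log (k + 2) + j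

/-- Confidence in the round number. It is needed only before the first elimination of a round,
because rounds without an elimination are not counted by `k`. -/
noncomputable def extra (r j : ℕ) : ℝ := if j = 0 then Real.log (r + 2) else 0

/-- The constant is 2 · 8 · 80². Its most demanding use is the search, where the tolerance is a
multiple 1/80 of the resolution and the tail bound has exponent `N * e ^ 2 / 8`. -/
noncomputable def roundPulls (r : ℕ) (y : ℝ) : ℕ := ⌈102400 * 4 ^ r * y⌉₊

/-- An element of `T`, if there is one. -/
noncomputable def pick (d : Fin n) (T : Finset (Fin n)) : Fin n :=
  if h : T.Nonempty then h.choose else d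

lemma pick_mem (d : Fin n) {T : Finset (Fin n)} (h : T.Nonempty) : pick d T ∈ T := by
  rw [pick, dif_pos h]; exact h.choose_spec

/-- In the search, the factor 3/2 per halving outweighs the tolerance that shrinks by 9/10, since
(3/2)(9/10)² > 1, while the cost still decreases by about 3/4 per halving. In the test, only the
picked arm bears `extra` in full; the other arms share it, because only their joint error is
dangerous. -/
noncomputable def pullsOf (lam : ℝ) (q : ElimState n) (i : Fin n) : ℕ :=
  if q.e then (if i ∈ q.S then roundPulls q.r (wt lam q.k q.j) else 0)
  else if 2 ≤ q.T.card then
    (if i ∈ q.T then roundPulls q.r ((3 / 2) ^ q.l * wt lam q.k q.j) else 0)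
  else if i ∈ q.T then roundPulls q.r (wt lam q.k q.j + extra q.r q.j)
  else if i ∈ q.S then roundPulls q.r (wt lam q.k q.j + extra q.r q.j / q.S.card)
  else 0

/-- The state after an elimination that keeps the arms `U`. -/
def eliminate (q : ElimState n) (U : Finset (Fin n)) : ElimState n :=
  ⟨U, q.r, q.k, q.j + 1, U, 0, false⟩

/-- The state at the beginning of the next round. -/
def advance (q : ElimState n) : ElimState n :=
  ⟨q.S, q.r + 1, elimRounds q.k q.j, 0, q.S, 0, false⟩

/-- The state after a halving of the candidates that keeps the arms `U`. -/
def narrow (q : ElimState n) (U : Finset (Fin n)) : ElimState n :=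
  ⟨q.S, q.r, q.k, q.j, U, q.l + 1, false⟩

/-- The state after it has been decided to eliminate. -/
def accept (q : ElimState n) : ElimState n :=
  ⟨q.S, q.r, q.k, q.j, q.T, q.l, true⟩

/-- The threshold `S.card / 8 + 1` separates unsafe states, with more than `S.card / 4 + 1` arms of
gap below a quarter of the resolution, from states with at most `S.card / 16` suboptimal arms of gap
below twice the resolution. -/
noncomputable def nextOf (lam : ℝ) (d : Fin n) (q : ElimState n) (v : Fin n → ℝ) : ElimState n :=
  if q.e then q.eliminate (topHalf q.S v)
  else if 2 ≤ q.T.card then q.narrow (topHalf q.T v)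
  else if 8 * StagedPolicy.nearCount q.S (pick d q.T) ((1 / 2) ^ q.r) (pullsOf lam q) v ≤
      q.S.card + 8 then q.accept
  else q.advance

/-- The elimination procedure; its error probability is at most `exp (-lam)`. -/
noncomputable def policy (lam : ℝ) (d : Fin n) : StagedPolicy n (ElimState n) where
  init := ⟨Finset.univ, 0, 0, 0, Finset.univ, 0, false⟩
  pulls := pullsOf lam
  -- The case `q.T = ∅` is excluded by `Inv`, so in a run an output is given exactly when one arm is
  -- left.
  out q := if q.S.card ≤ 1 ∨ q.T = ∅ then some (pick d q.S) else none
  next := nextOf lam d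
  dflt := d

lemma measurable_nextOf (lam : ℝ) (d : Fin n) (q : ElimState n) :
    Measurable (nextOf lam d q) := by
  unfold nextOf
  let : MeasurableSpace (Finset (Fin n)) := ⊤
  have : DiscreteMeasurableSpace (Finset (Fin n)) := ⟨fun _ => trivial⟩
  by_cases he : q.e
  · simp only [he, if_true]
    exact (Measurable.of_discrete (f := q.eliminate)).comp (measurable_topHalf q.S)
  · simp only [he, if_false, Bool.false_eq_true]
    by_cases hT : 2 ≤ q.T.card
    · simp only [hT, if_true]
      exact (Measurable.of_discrete (f := q.narrow)).comp
        (measurable_topHalf q.T)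
    · simp only [hT, if_false]
      refine Measurable.ite ?_ measurable_const measurable_const
      have h : Measurable fun (v : Fin n → ℝ) (i : Fin n) =>
          v (pick d q.T) / pullsOf lam q (pick d q.T) - (1 / 2) ^ q.r ≤ v i / pullsOf lam q i :=
        measurable_pi_lambda _ fun i => measurableSet_setOfPred.1
          (measurableSet_le (by fun_prop) (by fun_prop))
      classical
      have h2 : Measurable fun R : Fin n → Prop => 8 * (q.S.filter fun i => R i).card :=
        measurable_of_countable _
      refine measurableSet_le ?_ measurable_const
      convert! h2.comp h

lemma wt_ge {lam : ℝ} (k j : ℕ) : lam + 1 + j ≤ wt lam k j := by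
  have : 0 ≤ Real.log (k + 2) := Real.log_nonneg (by linarith [k.cast_nonneg (α := ℝ)])
  rw [wt]; linarith

lemma extra_nonneg (r j : ℕ) : 0 ≤ extra r j := by
  unfold extra
  split_ifs
  · exact Real.log_nonneg (by linarith [r.cast_nonneg (α := ℝ)])
  · exact le_rfl

lemma le_roundPulls_mul (r : ℕ) (y : ℝ) :
    102400 * y ≤ roundPulls r y * ((1 / 2 : ℝ) ^ r) ^ 2 := by
  have h1 : 102400 * 4 ^ r * y ≤ roundPulls r y := Nat.le_ceil _
  have h2 : ((1 / 2 : ℝ) ^ r) ^ 2 = (4 ^ r)⁻¹ := by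
    rw [← pow_mul, mul_comm, pow_mul, ← inv_pow]; norm_num
  rw [h2, ← div_eq_mul_inv, le_div_iff₀ (by positivity)]
  linarith

lemma roundPulls_pos (r : ℕ) {y : ℝ} (hy : 0 < y) : 0 < roundPulls r y :=
  Nat.ceil_pos.2 (by positivity)

lemma roundPulls_le (r : ℕ) {y : ℝ} (hy : 1 ≤ y) : (roundPulls r y : ℝ) ≤ 204800 * 4 ^ r * y := by
  have h1 : (roundPulls r y : ℝ) < 102400 * 4 ^ r * y + 1 := Nat.ceil_lt_add_one (by positivity)
  have h2 : (1 : ℝ) ≤ 4 ^ r := one_le_pow₀ (by norm_num)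
  nlinarith [mul_le_mul h2 hy zero_le_one (by positivity)]

lemma roundPulls_mono (r : ℕ) {y z : ℝ} (h : y ≤ z) : roundPulls r y ≤ roundPulls r z :=
  Nat.ceil_mono (by gcongr)

/-- The properties that all states of a run have. -/
structure Inv (q : ElimState n) : Prop where
  sub : q.T ⊆ q.S
  nonempty : q.T.Nonempty
  k_le : q.k ≤ q.r
  -- With halves rounded up it is `card - 1`, not `card`, that is at least halved by an elimination.
  -- While two arms survive, the rounds with an elimination therefore number at most log₂ n.
  card_le : 2 ^ elimRounds q.k q.j * (q.S.card - 1) ≤ n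

lemma topHalf_nonempty {T : Finset (Fin n)} (hT : T.Nonempty) (v : Fin n → ℝ) :
    (topHalf T v).Nonempty := by
  rw [← Finset.card_pos, (topHalf_spec T v).2.1]
  have := hT.card_pos
  omega

lemma Inv.eliminate {q : ElimState n} (h : Inv q) (v : Fin n → ℝ) :
    Inv (q.eliminate (topHalf q.S v)) := by
  refine ⟨Finset.Subset.refl _, topHalf_nonempty (h.nonempty.mono h.sub) v, h.k_le, ?_⟩
  have hc := h.card_le
  simp only [ElimState.eliminate, (topHalf_spec q.S v).2.1]
  have h1 : elimRounds q.k (q.j + 1) = q.k + 1 := by simp [elimRounds]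
  have h2 : (q.S.card + 1) / 2 - 1 ≤ (q.S.card - 1) / 2 := by omega
  rw [h1]
  -- Only the first elimination of a round raises the exponent; later ones need only not enlarge the
  -- set.
  by_cases hj : q.j = 0
  · have h3 : elimRounds q.k q.j = q.k := by simp [elimRounds, hj]
    rw [h3] at hc
    calc 2 ^ (q.k + 1) * ((q.S.card + 1) / 2 - 1) ≤ 2 ^ q.k * (2 * ((q.S.card - 1) / 2)) := by
          rw [pow_succ, mul_assoc]; gcongr
      _ ≤ 2 ^ q.k * (q.S.card - 1) := by gcongr; omega
      _ ≤ n := hc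
  · have h3 : elimRounds q.k q.j = q.k + 1 := by simp [elimRounds, hj]
    rw [h3] at hc
    exact (Nat.mul_le_mul_left _ (by omega)).trans hc

lemma Inv.advance {q : ElimState n} (h : Inv q) : Inv q.advance := by
  refine ⟨Finset.Subset.refl _, h.nonempty.mono h.sub, ?_, ?_⟩
  · have := h.k_le
    simp only [ElimState.advance, elimRounds]
    split_ifs <;> omega
  · simpa [ElimState.advance, elimRounds] using h.card_le

lemma Inv.next {q : ElimState n} (h : Inv q) (lam : ℝ) (d : Fin n) (v : Fin n → ℝ) :
    Inv (nextOf lam d q v) := by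
  unfold nextOf
  split_ifs
  · exact h.eliminate v
  · exact ⟨(topHalf_spec q.T v).1.trans h.sub, topHalf_nonempty h.nonempty v, h.k_le, h.card_le⟩
  · exact ⟨h.sub, h.nonempty, h.k_le, h.card_le⟩
  · exact h.advance

section Stages

variable (lam : ℝ) (d : Fin n) (I : BestArmInstance n) {q : ElimState n}

lemma out_eq_none (q : ElimState n) :
    (policy lam d).out q = none ↔ 2 ≤ q.S.card ∧ q.T.Nonempty := by
  simp only [policy]
  split_ifs with h
  · simp only [false_iff, not_and]
    rcases h with h | h
    · omega
    · simp [h]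
  · rw [not_or] at h
    simp only [true_iff]
    exact ⟨by omega, Finset.nonempty_iff_ne_empty.2 h.2⟩

variable {lam}

lemma wt_pos (hlam : 0 ≤ lam) (k j : ℕ) : 0 < wt lam k j := by
  have := wt_ge (lam := lam) k j
  have := j.cast_nonneg (α := ℝ)
  linarith

lemma exists_pulls_pos (hlam : 0 ≤ lam) (hq : (policy lam d).out q = none) :
    0 < (policy lam d).len q := by
  obtain ⟨hS, i, hi⟩ := (out_eq_none lam d q).1 hq
  have hw := wt_pos hlam q.k q.j
  have hS' : q.S.Nonempty := Finset.card_pos.1 (by omega)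
  obtain ⟨i', hi'⟩ := hS'
  have key : ∀ i, 0 < pullsOf lam q i → 0 < (policy lam d).len q := fun i h =>
    h.trans_le (Finset.single_le_sum (f := pullsOf lam q) (fun _ _ => Nat.zero_le _)
      (Finset.mem_univ i))
  by_cases he : q.e
  · refine key i' ?_
    simp only [pullsOf, he, if_true, hi']
    exact roundPulls_pos _ hw
  · refine key i ?_
    by_cases hT : 2 ≤ q.T.card
    · simp only [pullsOf, he, hT, if_true, hi, if_false, Bool.false_eq_true]
      exact roundPulls_pos _ (by positivity)
    · simp only [pullsOf, he, hT, if_true, hi, if_false, Bool.false_eq_true]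
      exact roundPulls_pos _ (add_pos_of_pos_of_nonneg hw (extra_nonneg _ _))

end Stages

end ElimState

lemma BestArmInstance.mean_le_best {n : ℕ} (I : BestArmInstance n) (i : Fin n) :
    I.mean i ≤ I.mean I.best := by
  by_cases h : i = I.best
  · rw [h]
  · exact (I.best_spec i h).le

/-- A bound on an integral of a function that takes large values only on an event. -/
lemma lintegral_le_of_le_indicator {Ω : Type*} [MeasurableSpace Ω] (μ : Measure Ω)
    [IsProbabilityMeasure μ] {f : Ω → ℝ≥0∞} {E : Set Ω} {a b p : ℝ} (ha : 0 ≤ a) (hb : 0 ≤ b)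
    (hE : μ.real E ≤ p) (hf : ∀ x ∈ E, f x ≤ ENNReal.ofReal (a + b))
    (hf' : ∀ x ∉ E, f x ≤ ENNReal.ofReal b) :
    ∫⁻ x, f x ∂μ ≤ ENNReal.ofReal (p * a + b) := by
  have hp : 0 ≤ p := measureReal_nonneg.trans hE
  calc ∫⁻ x, f x ∂μ ≤ ∫⁻ x, (E.indicator (fun _ => ENNReal.ofReal a) x + ENNReal.ofReal b) ∂μ := by
        refine lintegral_mono fun x => ?_
        by_cases hx : x ∈ E
        · rw [Set.indicator_of_mem hx, ← ENNReal.ofReal_add ha hb]; exact hf x hx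
        · rw [Set.indicator_of_notMem hx, zero_add]; exact hf' x hx
    _ = (∫⁻ x, E.indicator (fun _ => ENNReal.ofReal a) x ∂μ) + ENNReal.ofReal b := by
        rw [lintegral_add_right _ measurable_const]; simp
    _ ≤ ENNReal.ofReal a * μ E + ENNReal.ofReal b := by
        gcongr; exact lintegral_indicator_const_le _ _
    _ ≤ ENNReal.ofReal a * ENNReal.ofReal p + ENNReal.ofReal b := by
        gcongr
        rw [← ofReal_measureReal]
        exact ENNReal.ofReal_le_ofReal hE
    _ = ENNReal.ofReal (p * a + b) := by
        rw [← ENNReal.ofReal_mul ha, ← ENNReal.ofReal_add (by positivity) hb, mul_comm]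

/-! ### The probability of error -/

namespace ElimState

variable {n : ℕ} {lam : ℝ} (d : Fin n) (I : BestArmInstance n) {q : ElimState n}

/-- Eliminating is unsafe when too many arms are near optimal at the current resolution. -/
def Unsafe (q : ElimState n) : Prop :=
  q.S.card + 4 < 4 * (q.S.filter fun i => I.gap i < (1 / 2) ^ q.r / 4).card

/-- A bad state: the best arm has been lost, or an unsafe elimination is about to be done. -/
def Bad (q : ElimState n) : Prop := I.best ∉ q.S ∨ (q.e ∧ q.Unsafe I)

/-- In a safe state at most a quarter of the arms, besides the best, have gap below ε/4. A half
without the best arm therefore contains at least a quarter of `S` with gap at least ε/4, as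
`measure_topHalf_le` requires. -/
lemma measure_best_notMem_topHalf_le (hq : q.e) (hb : I.best ∈ q.S) (hs : ¬ q.Unsafe I) :
    I.rewardLaw.real {x | I.best ∉ topHalf q.S ((policy lam d).sums q x)} ≤
      5 * Real.exp (-(5 * wt lam q.k q.j)) := by
  classical
  have hε : (0 : ℝ) < (1 / 2) ^ q.r / 4 := by positivity
  have hN : ∀ i ∈ q.S, (policy lam d).pulls q i = roundPulls q.r (wt lam q.k q.j) := by
    intro i hi
    simp [policy, pullsOf, hq, hi]
  refine le_trans (measureReal_mono ?_)
    (((policy lam d).measure_topHalf_le I q q.S hN hb hε).trans ?_)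
  · intro x hx
    refine ⟨hx, ?_⟩
    obtain ⟨hU, hUc, -⟩ := topHalf_spec q.S ((policy lam d).sums q x)
    set U := topHalf q.S ((policy lam d).sums q x)
    set G := q.S.filter fun i => I.gap i < (1 / 2) ^ q.r / 4 with hG
    have hbG : I.best ∈ G := Finset.mem_filter.2 ⟨hb, by simp [BestArmInstance.gap]⟩
    have h1 : U ⊆ (U.filter fun i => I.mean i ≤ I.mean I.best - (1 / 2) ^ q.r / 4) ∪
        G.erase I.best := by
      intro i hi
      by_cases hg : I.gap i < (1 / 2) ^ q.r / 4
      · refine Finset.mem_union_right _ (Finset.mem_erase.2 ⟨?_, Finset.mem_filter.2 ⟨hU hi, hg⟩⟩)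
        rintro rfl
        exact hx hi
      · refine Finset.mem_union_left _ (Finset.mem_filter.2 ⟨hi, ?_⟩)
        rw [BestArmInstance.gap] at hg
        linarith
    have h2 := (Finset.card_le_card h1).trans (Finset.card_union_le _ _)
    rw [Finset.card_erase_of_mem hbG] at h2
    have h3 : 4 * G.card ≤ q.S.card + 4 := not_lt.1 hs
    have h4 : 0 < G.card := Finset.card_pos.2 ⟨_, hbG⟩
    omega
  · have h := le_roundPulls_mul q.r (wt lam q.k q.j)
    have h0 : 0 ≤ roundPulls q.r (wt lam q.k q.j) * ((1 / 2 : ℝ) ^ q.r) ^ 2 := by positivity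
    gcongr
    nlinarith

lemma pulls_pick (hq : ¬ q.e) (hT : q.T.Nonempty) (hT2 : ¬ 2 ≤ q.T.card) :
    pullsOf lam q (pick d q.T) = roundPulls q.r (wt lam q.k q.j + extra q.r q.j) := by
  simp [pullsOf, hq, hT2, pick_mem d hT]

lemma pulls_of_ne_pick (hq : ¬ q.e) (hT : q.T.Nonempty) (hT2 : ¬ 2 ≤ q.T.card) :
    ∀ i ∈ q.S, i ≠ pick d q.T →
      pullsOf lam q i = roundPulls q.r (wt lam q.k q.j + extra q.r q.j / q.S.card) := by
  intro i hi hne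
  have : i ∉ q.T := fun h =>
    hne (Finset.card_le_one.1 (by omega) _ h _ (pick_mem d hT))
  simp [pullsOf, hq, hT2, this, hi]

/-- The factor `q.S.card` in the exponent for the joint error turns `extra / q.S.card` back into
`extra` and absorbs the number of subsets; the picked arm has the full `extra` of its own. -/
lemma measure_accept_le (hlam : 0 ≤ lam) (hq : ¬ q.e) (hT : q.T.Nonempty) (hT2 : ¬ 2 ≤ q.T.card)
    (hS : 0 < q.S.card) (hu : q.Unsafe I) :
    I.rewardLaw.real {x | 8 * StagedPolicy.nearCount q.S (pick d q.T) ((1 / 2) ^ q.r)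
        (pullsOf lam q) ((policy lam d).sums q x) ≤ q.S.card + 8} ≤
      2 * Real.exp (-(5 * (wt lam q.k q.j + extra q.r q.j))) := by
  have hw := wt_pos hlam q.k q.j
  have hw1 : 1 ≤ wt lam q.k q.j := by
    have := wt_ge (lam := lam) q.k q.j
    have := q.j.cast_nonneg (α := ℝ)
    linarith
  have hx := extra_nonneg q.r q.j
  have hS' : (1 : ℝ) ≤ q.S.card := by exact_mod_cast hS
  refine ((policy lam d).measure_nearCount_le_le I q q.S (pick d q.T)
    (N := roundPulls q.r (wt lam q.k q.j + extra q.r q.j / q.S.card))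
    (pulls_of_ne_pick d hq hT hT2) (roundPulls_pos _ (by positivity))
    ((roundPulls_pos _ (by positivity)).trans_eq (pulls_pick d hq hT hT2).symm)
    (by positivity) I.mean_le_best hu).trans ?_
  rw [two_mul]
  have h1 := le_roundPulls_mul q.r (wt lam q.k q.j + extra q.r q.j)
  have h2 := le_roundPulls_mul q.r (wt lam q.k q.j + extra q.r q.j / q.S.card)
  refine add_le_add (Real.exp_le_exp.2 ?_) ?_
  · have : (policy lam d).pulls q (pick d q.T) =
      roundPulls q.r (wt lam q.k q.j + extra q.r q.j) := pulls_pick d hq hT hT2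
    rw [this]
    nlinarith
  · have h3 : (2 : ℝ) ^ q.S.card ≤ Real.exp q.S.card := by
      have : (2 : ℝ) ≤ Real.exp 1 := by have := Real.add_one_le_exp 1; linarith
      calc (2 : ℝ) ^ q.S.card ≤ Real.exp 1 ^ q.S.card := by gcongr
        _ = Real.exp q.S.card := by rw [← Real.exp_nat_mul, mul_one]
    refine (mul_le_mul_of_nonneg_right h3 (Real.exp_pos _).le).trans ?_
    rw [← Real.exp_add]
    refine Real.exp_le_exp.2 ?_
    have h4 : q.S.card * (102400 * (wt lam q.k q.j + extra q.r q.j / q.S.card)) ≤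
      q.S.card * (roundPulls q.r (wt lam q.k q.j + extra q.r q.j / q.S.card) *
        ((1 / 2 : ℝ) ^ q.r) ^ 2) := by gcongr
    have h5 : q.S.card * (102400 * (wt lam q.k q.j + extra q.r q.j / q.S.card)) =
        102400 * (q.S.card * wt lam q.k q.j + extra q.r q.j) := by field_simp
    rw [h5] at h4
    have h6 : wt lam q.k q.j ≤ q.S.card * wt lam q.k q.j := by nlinarith
    have h7 : (q.S.card : ℝ) ≤ q.S.card * wt lam q.k q.j := by nlinarith
    linarith

/-- Ending a round by mistake costs samples but not correctness, so `extra` is not needed in the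
bound. -/
lemma measure_advance_le (hlam : 0 ≤ lam) (hq : ¬ q.e) (hT : q.T.Nonempty)
    (hT2 : ¬ 2 ≤ q.T.card) (hS : 0 < q.S.card)
    (hb : I.mean I.best - (1 / 2) ^ q.r / 8 ≤ I.mean (pick d q.T))
    (hD : 16 * ((q.S.erase I.best).filter fun i => I.gap i < 2 * (1 / 2) ^ q.r).card ≤ q.S.card) :
    I.rewardLaw.real {x | q.S.card + 8 < 8 * StagedPolicy.nearCount q.S (pick d q.T)
        ((1 / 2) ^ q.r) (pullsOf lam q) ((policy lam d).sums q x)} ≤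
      17 * Real.exp (-(5 * wt lam q.k q.j)) := by
  have hw := wt_pos hlam q.k q.j
  have hx := extra_nonneg q.r q.j
  have hS' : (1 : ℝ) ≤ q.S.card := by exact_mod_cast hS
  refine ((policy lam d).measure_lt_nearCount_le I q q.S (pick d q.T)
    (N := roundPulls q.r (wt lam q.k q.j + extra q.r q.j / q.S.card))
    (pulls_of_ne_pick d hq hT hT2) (roundPulls_pos _ (by positivity)) ?_
    (by positivity) hb hS hD).trans ?_
  · refine (roundPulls_mono q.r ?_).trans_eq (pulls_pick d hq hT hT2).symm
    gcongr
    exact div_le_self hx hS'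
  · have h2 := le_roundPulls_mul q.r (wt lam q.k q.j + extra q.r q.j / q.S.card)
    have h3 : 0 ≤ extra q.r q.j / q.S.card := by positivity
    gcongr
    linarith

section Failure

/-- The exponent is spent on `lam`, on a constant 5 with exp 5 ≥ 32, on `j`, and on twice the
logarithm of `k + 2`. -/
lemma exp_neg_wt_le (hlam : 0 ≤ lam) (k j : ℕ) {y : ℝ} (hy : 0 ≤ y) :
    Real.exp (-(5 * (wt lam k j + y))) ≤
      Real.exp (-lam) / 32 * ((1 / 2) ^ j / (k + 2) ^ 2) * Real.exp (-(2 * y)) := by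
  have hk : (0 : ℝ) < k + 2 := by positivity
  have hlk : 0 ≤ Real.log (k + 2) := Real.log_nonneg (by linarith [k.cast_nonneg (α := ℝ)])
  have h2 : (2 : ℝ) ≤ Real.exp 1 := by have := Real.add_one_le_exp 1; linarith
  have h32 : (32 : ℝ) ≤ Real.exp 5 := by
    calc (32 : ℝ) = 2 ^ 5 := by norm_num
      _ ≤ Real.exp 1 ^ 5 := by gcongr
      _ = Real.exp 5 := by rw [← Real.exp_nat_mul]; norm_num
  have hj : Real.exp (-j) ≤ (1 / 2) ^ j := by
    rw [Real.exp_neg, one_div, inv_pow]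
    refine inv_anti₀ (by positivity) ?_
    calc (2 : ℝ) ^ j ≤ Real.exp 1 ^ j := by gcongr
      _ = Real.exp j := by rw [← Real.exp_nat_mul, mul_one]
  have hlog : Real.exp (-(2 * Real.log (k + 2))) = ((k + 2 : ℝ) ^ 2)⁻¹ := by
    rw [Real.exp_neg, two_mul, Real.exp_add, Real.exp_log hk, sq]
  calc Real.exp (-(5 * (wt lam k j + y)))
      ≤ Real.exp (-lam + -5 + -j + -(2 * Real.log (k + 2)) + -(2 * y)) := by
        refine Real.exp_le_exp.2 ?_
        rw [wt]
        have := j.cast_nonneg (α := ℝ)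
        linarith
    _ = Real.exp (-lam) * (Real.exp 5)⁻¹ * Real.exp (-j) * ((k + 2 : ℝ) ^ 2)⁻¹ *
          Real.exp (-(2 * y)) := by
        rw [Real.exp_add, Real.exp_add, Real.exp_add, Real.exp_add, hlog, Real.exp_neg 5]
    _ ≤ Real.exp (-lam) * 32⁻¹ * (1 / 2) ^ j * ((k + 2 : ℝ) ^ 2)⁻¹ *
          Real.exp (-(2 * y)) := by gcongr
    _ = _ := by ring

/-- Bounds on the probability of reaching a bad state: when an elimination is due, and else. -/
noncomputable def failPending (lam : ℝ) (r k j : ℕ) : ℝ :=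
  Real.exp (-lam) / 4 * (1 / (r + 2) + 4 / (k + 2) + 3 * ((1 / 2) ^ j / (k + 2) ^ 2))

/-- Three budgets: the first telescopes over rounds and pays for their first tests, the second
telescopes over rounds with an elimination, and the third is geometric over the eliminations of the
current round. At the initial state the bracket equals 4, so the total is `exp (-lam)`. -/
noncomputable def failBound (lam : ℝ) (r k j : ℕ) : ℝ :=
  Real.exp (-lam) / 4 * ((if j = 0 then 1 / (r + 1 : ℝ) else 1 / (r + 2 : ℝ)) + 4 / (k + 2) +
    4 * ((1 / 2) ^ j / (k + 2) ^ 2))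

lemma failPending_nonneg (r k j : ℕ) : 0 ≤ failPending lam r k j := by
  unfold failPending; positivity

lemma failBound_nonneg (r k j : ℕ) : 0 ≤ failBound lam r k j := by
  unfold failBound
  split_ifs <;> positivity

lemma add_failBound_le_failPending (hlam : 0 ≤ lam) (r k j : ℕ) :
    5 * Real.exp (-(5 * wt lam k j)) + failBound lam r k (j + 1) ≤ failPending lam r k j := by
  have h0 := exp_neg_wt_le hlam k j le_rfl
  simp only [mul_zero, add_zero, neg_zero, Real.exp_zero, mul_one] at h0
  have h1 : 0 ≤ Real.exp (-lam) * ((1 / 2 : ℝ) ^ j / (k + 2) ^ 2) := by positivity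
  have h2 : failPending lam r k j - failBound lam r k (j + 1) =
      Real.exp (-lam) * ((1 / 2 : ℝ) ^ j / (k + 2) ^ 2) / 4 := by
    unfold failPending failBound
    rw [if_neg (by omega), pow_succ]; ring
  linarith

lemma exp_neg_wt_add_extra_le (hlam : 0 ≤ lam) (r k j : ℕ) :
    2 * Real.exp (-(5 * (wt lam k j + extra r j))) ≤ Real.exp (-lam) / 4 *
      (if j = 0 then 1 / ((r + 1) * (r + 2) : ℝ) else (1 / 2) ^ j / (k + 2 : ℝ) ^ 2) := by
  have h0 := exp_neg_wt_le hlam k j (extra_nonneg r j)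
  have hk2 : (1 : ℝ) ≤ (k + 2) ^ 2 := one_le_pow₀ (by linarith [k.cast_nonneg (α := ℝ)])
  rcases Nat.eq_zero_or_pos j with rfl | hj
  · simp only [if_true]
    have hr : (0 : ℝ) < r + 2 := by positivity
    have hlog : Real.exp (-(2 * extra r 0)) = 1 / (r + 2 : ℝ) ^ 2 := by
      rw [extra, if_pos rfl, Real.exp_neg, two_mul, Real.exp_add, Real.exp_log hr, sq, one_div]
    have h1 : Real.exp (-(2 * extra r 0)) ≤ 1 / ((r + 1) * (r + 2) : ℝ) := by
      rw [hlog]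
      exact one_div_le_one_div_of_le (by positivity) (by nlinarith)
    have h2 : (1 / 2 : ℝ) ^ 0 / (k + 2) ^ 2 ≤ 1 := by
      rw [pow_zero, div_le_one (by positivity)]; exact hk2
    calc _ ≤ 2 * (Real.exp (-lam) / 32 * ((1 / 2) ^ 0 / (k + 2) ^ 2) *
          Real.exp (-(2 * extra r 0))) := by gcongr
      _ ≤ 2 * (Real.exp (-lam) / 32 * 1 * (1 / ((r + 1) * (r + 2) : ℝ))) := by gcongr
      _ ≤ _ := by
        have : 0 ≤ Real.exp (-lam) * (1 / ((r + 1) * (r + 2) : ℝ)) := by positivity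
        linarith
  · rw [if_neg hj.ne']
    have h1 : Real.exp (-(2 * extra r j)) = 1 := by simp [extra, hj.ne']
    rw [h1, mul_one] at h0
    have : 0 ≤ Real.exp (-lam) * ((1 / 2) ^ j / (k + 2 : ℝ) ^ 2) := by positivity
    linarith

lemma add_failPending_le_failBound (hlam : 0 ≤ lam) (r k j : ℕ) :
    2 * Real.exp (-(5 * (wt lam k j + extra r j))) + failPending lam r k j ≤
      failBound lam r k j := by
  have h0 := exp_neg_wt_add_extra_le hlam r k j
  have hr : (1 / (r + 1) : ℝ) - 1 / (r + 2) = 1 / ((r + 1) * (r + 2)) := by field_simp; ring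
  have h1 : 0 ≤ Real.exp (-lam) / 4 * ((1 / 2) ^ j / (k + 2 : ℝ) ^ 2) := by positivity
  unfold failPending failBound
  split_ifs at h0 ⊢
  · rw [← hr] at h0; linarith
  · linarith

lemma add_failBound_succ_le_failBound (hlam : 0 ≤ lam) (r k j : ℕ) :
    2 * Real.exp (-(5 * (wt lam k j + extra r j))) + failBound lam (r + 1) (elimRounds k j) 0 ≤
      failBound lam r k j := by
  have h0 := exp_neg_wt_add_extra_le hlam r k j
  have hr : (1 / (r + 1) : ℝ) - 1 / (r + 2) = 1 / ((r + 1) * (r + 2)) := by field_simp; ring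
  rcases Nat.eq_zero_or_pos j with rfl | hj
  · simp only [failBound, elimRounds, if_true] at h0 ⊢
    rw [← hr] at h0
    push_cast
    rw [show (r : ℝ) + 1 + 1 = r + 2 by ring, add_zero]
    linarith
  · simp only [failBound, elimRounds, hj.ne', if_true, if_false] at h0 ⊢
    -- The drop of the second budget funds the fresh geometric budget `4 / (k + 3) ^ 2` of the next
    -- round.
    have h1 : (4 : ℝ) / (k + 2) - 4 / (k + 3) = 4 / ((k + 2) * (k + 3)) := by field_simp; ring
    have h2 : (4 : ℝ) / (k + 3) ^ 2 ≤ 4 / ((k + 2) * (k + 3)) := by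
      gcongr
      nlinarith
    have h3 : 0 ≤ (1 / 2) ^ j / (k + 2 : ℝ) ^ 2 := by positivity
    push_cast
    rw [show (r : ℝ) + 1 + 1 = r + 2 by ring, show (k : ℝ) + 1 + 2 = k + 3 by ring]
    rw [pow_zero]
    have h4 : 0 ≤ Real.exp (-lam) / 4 * ((4 / (k + 2) - 4 / (k + 3)) - 4 / (k + 3 : ℝ) ^ 2 +
        3 * ((1 / 2) ^ j / (k + 2 : ℝ) ^ 2)) := by
      refine mul_nonneg (by positivity) ?_
      linarith
    have h5 : (4 : ℝ) * (1 / (k + 3) ^ 2) = 4 / (k + 3) ^ 2 := by ring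
    rw [h5]
    linarith

open Classical in
/-- The potential that bounds the probability of reaching a bad state. -/
noncomputable def failPotential (lam : ℝ) (I : BestArmInstance n) (q : ElimState n) : ℝ≥0∞ :=
  if q.Bad I then 1
  else ENNReal.ofReal (if q.e then failPending lam q.r q.k q.j else failBound lam q.r q.k q.j)

/-- Only two transitions can create a bad state: an elimination that loses the best arm, and the
acceptance of an unsafe elimination. Their probabilities are covered by the decrease of the budgets;
the search carries no risk of error. -/
lemma lintegral_failPotential_le (hlam : 0 ≤ lam) (hbad : ¬ q.Bad I)
    (hout : (policy lam d).out q = none) :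
    ∫⁻ x, failPotential lam I ((policy lam d).next q ((policy lam d).sums q x)) ∂I.rewardLaw ≤
      failPotential lam I q := by
  obtain ⟨hS, hT⟩ := (out_eq_none lam d q).1 hout
  simp only [Bad, not_or, not_and, not_not] at hbad
  have hq : failPotential lam I q = ENNReal.ofReal
      (if q.e then failPending lam q.r q.k q.j else failBound lam q.r q.k q.j) := by
    rw [failPotential, if_neg]
    simpa [Bad] using hbad
  rw [hq]
  by_cases he : q.e
  · have hnext : ∀ v, (policy lam d).next q v = q.eliminate (topHalf q.S v) := fun v => by
      simp [policy, nextOf, he]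
    simp only [hnext, he, if_true]
    refine (lintegral_le_of_le_indicator I.rewardLaw (a := 1)
      (b := failBound lam q.r q.k (q.j + 1)) zero_le_one (failBound_nonneg q.r q.k (q.j + 1))
      (measure_best_notMem_topHalf_le (lam := lam) d I he hbad.1 (hbad.2 he)) ?_ ?_).trans
      (ENNReal.ofReal_le_ofReal ?_)
    · intro x hx
      rw [failPotential, if_pos (show Bad I
        (q.eliminate (topHalf q.S ((policy lam d).sums q x))) from Or.inl hx), ← ENNReal.ofReal_one]
      exact ENNReal.ofReal_le_ofReal (by linarith [failBound_nonneg (lam := lam) q.r q.k (q.j + 1)])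
    · intro x hx
      have : ¬ (q.eliminate (topHalf q.S ((policy lam d).sums q x))).Bad I := by
        simpa [Bad, eliminate] using hx
      rw [failPotential, if_neg this]
      simp [eliminate]
    · rw [mul_one]
      exact add_failBound_le_failPending hlam _ _ _
  · simp only [he, if_false, Bool.false_eq_true]
    by_cases hT2 : 2 ≤ q.T.card
    · have hnext : ∀ v, (policy lam d).next q v = q.narrow (topHalf q.T v) := fun v => by
        simp [policy, nextOf, he, hT2]
      simp only [hnext]
      have : ∀ U, failPotential lam I (q.narrow U) =
          ENNReal.ofReal (failBound lam q.r q.k q.j) := fun U => by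
        have : ¬ (q.narrow U).Bad I := by simpa [Bad, narrow] using hbad.1
        rw [failPotential, if_neg this]
        simp [narrow]
      simp [this]
    · have hnext : ∀ v, (policy lam d).next q v = if 8 * StagedPolicy.nearCount q.S (pick d q.T)
          ((1 / 2) ^ q.r) (pullsOf lam q) v ≤ q.S.card + 8 then q.accept else q.advance :=
        fun v => by simp [policy, nextOf, he, hT2]
      simp only [hnext]
      have hadv : failPotential lam I q.advance =
          ENNReal.ofReal (failBound lam (q.r + 1) (elimRounds q.k q.j) 0) := by
        have : ¬ q.advance.Bad I := by simpa [Bad, advance] using hbad.1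
        rw [failPotential, if_neg this]
        simp [advance]
      have h1 := add_failPending_le_failBound hlam q.r q.k q.j
      have h2 := add_failBound_succ_le_failBound hlam q.r q.k q.j
      have h3 := failPending_nonneg (lam := lam) q.r q.k q.j
      have h4 := failBound_nonneg (lam := lam) (q.r + 1) (elimRounds q.k q.j) 0
      set p := 2 * Real.exp (-(5 * (wt lam q.k q.j + extra q.r q.j))) with hp
      have hp0 : 0 ≤ p := by positivity
      by_cases hu : q.Unsafe I
      · refine (lintegral_le_of_le_indicator I.rewardLaw (a := 1)
          (b := failBound lam (q.r + 1) (elimRounds q.k q.j) 0) zero_le_one h4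
          (measure_accept_le d I hlam he hT hT2 (by omega) hu) ?_ ?_).trans
          (ENNReal.ofReal_le_ofReal ?_)
        · intro x hx
          simp only [Set.mem_ofPred_eq] at hx
          rw [if_pos hx, failPotential,
            if_pos (show Bad I q.accept from Or.inr ⟨rfl, hu⟩), ← ENNReal.ofReal_one]
          exact ENNReal.ofReal_le_ofReal (by linarith)
        · intro x hx
          simp only [Set.mem_ofPred_eq] at hx
          rw [if_neg hx, hadv]
        · rw [mul_one]; exact h2
      · have hacc : failPotential lam I q.accept =
            ENNReal.ofReal (failPending lam q.r q.k q.j) := by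
          have : ¬ q.accept.Bad I := by
            rintro (h | h)
            · exact h hbad.1
            · exact hu h.2
          rw [failPotential, if_neg this]
          simp [accept]
        refine (lintegral_mono (g := fun _ => ENNReal.ofReal (failBound lam q.r q.k q.j))
          fun x => ?_).trans (by simp)
        simp only
        split_ifs
        · rw [hacc]; exact ENNReal.ofReal_le_ofReal (by linarith)
        · rw [hadv]; exact ENNReal.ofReal_le_ofReal (by linarith)

end Failure

end ElimState

/-! ### Gaps and the iterated logarithm -/

namespace BestArmInstance

variable {n : ℕ} (I : BestArmInstance n)

lemma gap_pos {i : Fin n} (hi : i ≠ I.best) : 0 < I.gap i := sub_pos.2 (I.best_spec i hi)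

lemma gap_le_one (i : Fin n) : I.gap i ≤ 1 := by
  have h1 := (I.mean_mem I.best).2
  have h2 := (I.mean_mem i).1
  unfold gap mean
  linarith

lemma gapTwo_le {i : Fin n} (hi : i ≠ I.best) : I.gapTwo ≤ I.gap i :=
  ciInf_le (Set.finite_range _).bddBelow (⟨i, hi⟩ : {i : Fin n // i ≠ I.best})

lemma exists_gap_eq_gapTwo (hn : 2 ≤ n) : ∃ i, i ≠ I.best ∧ I.gap i = I.gapTwo := by
  have : Nontrivial (Fin n) := Fin.nontrivial_iff_two_le.2 hn
  obtain ⟨i, hi⟩ := exists_ne I.best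
  have : Nonempty {i : Fin n // i ≠ I.best} := ⟨⟨i, hi⟩⟩
  obtain ⟨⟨j, hj⟩, h⟩ := exists_eq_ciInf_of_finite (f := fun i : {i : Fin n // i ≠ I.best} => I.gap i)
  exact ⟨j, hj, h⟩

end BestArmInstance

lemma lnln_nonneg (x : ℝ) : 0 ≤ lnln x := Real.log_nonneg (le_max_left _ _)

/-- A number of rounds that is at most logarithmic in `y` has logarithm at most `lnln y`. -/
lemma log_le_lnln {k y : ℝ} (hk0 : 0 < k + 4) (hk : k * Real.log 2 ≤ Real.log y) :
    Real.log (k + 4) ≤ 2 + lnln y := by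
  have h2 : (0.69 : ℝ) < Real.log 2 := by have := Real.log_two_gt_d9; linarith
  set z := max 1 (Real.log y) with hz
  have hz1 : 1 ≤ z := le_max_left _ _
  have hz2 : Real.log y ≤ z := le_max_right _ _
  have h3 : k ≤ 3 * z := by
    by_contra h
    push Not at h
    nlinarith
  have he : (7 : ℝ) ≤ Real.exp 2 := by
    have h := Real.exp_one_gt_d9
    have : Real.exp 2 = Real.exp 1 * Real.exp 1 := by rw [← Real.exp_add]; norm_num
    rw [this]
    nlinarith
  have h4 : k + 4 ≤ Real.exp 2 * z := by nlinarith
  calc Real.log (k + 4) ≤ Real.log (Real.exp 2 * z) := Real.log_le_log hk0 h4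
    _ = 2 + lnln y := by
      rw [Real.log_mul (Real.exp_pos _).ne' (by linarith), Real.log_exp, lnln]

/-! ### Cost potential and charging -/

namespace ElimState

variable {n : ℕ} (lam : ℝ) (d : Fin n) (I : BestArmInstance n) {q : ElimState n}

/-- The maximum drops by exactly `4 ^ r` from `r` to `r + 1` as long as the gap is at most twice the
resolution. The constant is 16 · 704: one near optimal arm pays for up to 16 arms of `S`, at the
rate 704 = 4 · 176 of the next round. -/
noncomputable def chargeArm (i : Fin n) (r : ℕ) : ℝ :=
  11264 * (lam + 3 + lnln (min (n : ℝ) (I.gap i)⁻¹)) *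
    max 0 ((16 * ((I.gap i)⁻¹) ^ 2 - 4 ^ r) / 3)

/-- The part of the cost, from round `r` on, that is charged to the suboptimal arms. -/
noncomputable def charge (r : ℕ) : ℝ := ∑ i ∈ Finset.univ.erase I.best, chargeArm lam I i r

/-- Telescopes like `chargeArm`, with 64 in place of 16 so that it lasts one round longer: it is
drawn on for the round after one in which `2 ^ r * I.gapTwo < 2`. -/
noncomputable def refTail (r : ℕ) : ℝ :=
  8 * (2 + lnln (I.gapTwo)⁻¹) * max 0 ((64 * ((I.gapTwo)⁻¹) ^ 2 - 4 ^ r) / 3)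

/-- The part of the cost, from round `r` on, that is due to the confidence in the round number. -/
noncomputable def refCost (r j : ℕ) : ℝ :=
  8 * (1 / 2) ^ j * (4 ^ r * Real.log (r + 2)) + refTail I (r + 1)

/-- A bound on the cost of a run, in units of `204800`, from a state in which a round has just
begun or an elimination has just been done. -/
noncomputable def stepCost (m r k j : ℕ) : ℝ :=
  176 * 4 ^ r * m * wt lam k j + charge lam I r + refCost I r j

noncomputable def pendingCost (m r k j : ℕ) : ℝ :=
  4 ^ r * m * wt lam k j + stepCost lam I ((m + 1) / 2) r k (j + 1)

/-- Many arms are near optimal at the current resolution. -/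
def Near (q : ElimState n) : Prop :=
  q.S.card < 16 * ((q.S.erase I.best).filter fun i => I.gap i < 2 * (1 / 2) ^ q.r).card

open Classical in
/-- A bound on the additional cost if the current round ends without a further elimination. -/
noncomputable def excess (q : ElimState n) : ℝ :=
  if q.Near I then
    max 0 (stepCost lam I q.S.card (q.r + 1) (elimRounds q.k q.j) 0 -
      pendingCost lam I q.S.card q.r q.k q.j)
  else 176 * 4 ^ (q.r + 1) * q.S.card * wt lam (elimRounds q.k q.j) 0 +
    if 2 ^ q.r * I.gapTwo < 2 then 0 else refCost I (q.r + 1) 0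

/-- The candidates contain an arm that is good enough for the current stage of the search. -/
def Good (q : ElimState n) : Prop :=
  ∃ i ∈ q.T, I.mean I.best - (1 / 2) ^ q.r / 8 + (1 / 2) ^ q.r / 8 * (9 / 10) ^ q.l ≤ I.mean i

/-- The 1 accounts for the final test and the term `(1 / 2) ^ l` for the halvings still to come. The
factor `(1 / 2) ^ j` matches the one in `refCost`. -/
noncomputable def goodRisk (j l : ℕ) : ℝ := (1 / 2) ^ j * (1 + (1 / 2) ^ l) / 128

open Classical in
/-- A bound on the probability that the current round ends without a further elimination. -/
noncomputable def risk (q : ElimState n) : ℝ :=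
  if ¬ q.Near I ∧ q.Good I then goodRisk q.j q.l else 1

/-- The factor `T.card - 1` is at least halved when halves are rounded up, so this quantity shrinks
by 3/4 or more per halving and dominates a geometric series. -/
noncomputable def searchCost (q : ElimState n) : ℝ :=
  8 * 4 ^ q.r * (3 / 2) ^ q.l * (q.T.card - 1) * wt lam q.k q.j

noncomputable def testCost (q : ElimState n) : ℝ :=
  2 * 4 ^ q.r * (q.S.card * wt lam q.k q.j + extra q.r q.j)

/-- The first three terms pay for the case that the test accepts; `risk * excess` is the expected
surplus in case it does not. -/
noncomputable def runCost (q : ElimState n) : ℝ :=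
  if q.e then pendingCost lam I q.S.card q.r q.k q.j
  else searchCost lam q + testCost lam q + pendingCost lam I q.S.card q.r q.k q.j +
    risk I q * excess lam I q

variable {lam}

section Nonneg

lemma charge_nonneg (hlam : 0 ≤ lam) (r : ℕ) : 0 ≤ charge lam I r :=
  Finset.sum_nonneg fun i _ => mul_nonneg (mul_nonneg (by norm_num)
    (by have := lnln_nonneg (min (n : ℝ) (I.gap i)⁻¹); linarith)) (le_max_left _ _)

lemma log_nonneg_aux (r : ℕ) : 0 ≤ Real.log (r + 2) :=
  Real.log_nonneg (by linarith [r.cast_nonneg (α := ℝ)])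

lemma refTail_nonneg (r : ℕ) : 0 ≤ refTail I r :=
  mul_nonneg (mul_nonneg (by norm_num)
    (by have := lnln_nonneg (I.gapTwo)⁻¹; linarith)) (le_max_left _ _)

lemma refCost_nonneg (r j : ℕ) : 0 ≤ refCost I r j :=
  add_nonneg (by have := log_nonneg_aux r; positivity) (refTail_nonneg I _)

lemma stepCost_nonneg (hlam : 0 ≤ lam) (m r k j : ℕ) : 0 ≤ stepCost lam I m r k j := by
  have := wt_pos hlam k j
  have := charge_nonneg I hlam r
  have := refCost_nonneg I r j
  unfold stepCost
  positivity

lemma pendingCost_nonneg (hlam : 0 ≤ lam) (m r k j : ℕ) : 0 ≤ pendingCost lam I m r k j := by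
  have := wt_pos hlam k j
  have := stepCost_nonneg I hlam ((m + 1) / 2) r k (j + 1)
  unfold pendingCost
  positivity

lemma excess_nonneg (hlam : 0 ≤ lam) (q : ElimState n) : 0 ≤ excess lam I q := by
  have := wt_pos hlam (elimRounds q.k q.j) 0
  have := refCost_nonneg I (q.r + 1) 0
  unfold excess
  split_ifs
  · exact le_max_left _ _
  all_goals positivity

lemma goodRisk_nonneg (j l : ℕ) : 0 ≤ goodRisk j l := by unfold goodRisk; positivity

lemma goodRisk_le_one (j l : ℕ) : goodRisk j l ≤ 1 := by
  have h1 : (1 / 2 : ℝ) ^ j ≤ 1 := pow_le_one₀ (by norm_num) (by norm_num)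
  have h2 : (1 / 2 : ℝ) ^ l ≤ 1 := pow_le_one₀ (by norm_num) (by norm_num)
  have h3 : (0 : ℝ) ≤ (1 / 2) ^ l := by positivity
  unfold goodRisk
  nlinarith

lemma risk_nonneg (q : ElimState n) : 0 ≤ risk I q := by
  unfold risk
  split_ifs
  · exact goodRisk_nonneg _ _
  · exact zero_le_one

lemma risk_le_one (q : ElimState n) : risk I q ≤ 1 := by
  unfold risk
  split_ifs
  · exact goodRisk_le_one _ _
  · exact le_rfl

end Nonneg

section Charging

lemma two_pow_mul_half_pow (r : ℕ) : (2 : ℝ) ^ r * (1 / 2) ^ r = 1 := by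
  rw [← mul_pow]; norm_num

lemma charge_succ_le (hlam : 0 ≤ lam) (r : ℕ) : charge lam I (r + 1) ≤ charge lam I r := by
  refine Finset.sum_le_sum fun i _ => ?_
  have := lnln_nonneg (min (n : ℝ) (I.gap i)⁻¹)
  unfold chargeArm
  gcongr
  · norm_num
  · omega

/-- In a round in which many arms are near optimal, they pay for the round. -/
lemma charge_succ_add_le (hlam : 0 ≤ lam) (hinv : Inv q) (hS : 2 ≤ q.S.card) (hq : q.Near I) :
    charge lam I (q.r + 1) + 704 * 4 ^ q.r * q.S.card * wt lam (elimRounds q.k q.j) 0 ≤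
      charge lam I q.r := by
  classical
  set D := (q.S.erase I.best).filter fun i => I.gap i < 2 * (1 / 2) ^ q.r with hD
  set K := elimRounds q.k q.j with hK
  have hw : 0 < wt lam K 0 := wt_pos hlam K 0
  have harm : ∀ i ∈ D, chargeArm lam I i (q.r + 1) + 11264 * 4 ^ q.r * wt lam K 0 ≤
      chargeArm lam I i q.r := by
    intro i hi
    obtain ⟨hiS, hig⟩ := Finset.mem_filter.1 hi
    have hg := I.gap_pos (Finset.mem_erase.1 hiS).1
    have h2r : (2 : ℝ) ^ q.r * I.gap i < 2 := by
      have := mul_lt_mul_of_pos_left hig (show (0 : ℝ) < 2 ^ q.r by positivity)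
      have h := two_pow_mul_half_pow q.r
      linarith
    have h2r' : (2 : ℝ) ^ q.r < 2 * (I.gap i)⁻¹ := by
      rw [← div_eq_mul_inv, lt_div_iff₀ hg]; exact h2r
    have h4r : (4 : ℝ) ^ (q.r + 1) < 16 * ((I.gap i)⁻¹) ^ 2 := by
      have : (4 : ℝ) ^ (q.r + 1) = 4 * (2 ^ q.r) ^ 2 := by
        rw [← pow_mul, mul_comm q.r, pow_mul, pow_succ]; norm_num; ring
      rw [this]
      have h0 : (0 : ℝ) < 2 ^ q.r := by positivity
      nlinarith
    have h4r' : (4 : ℝ) ^ (q.r + 1) = 4 * 4 ^ q.r := by rw [pow_succ]; ring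
    have hKr : K ≤ q.r + 1 := by
      have := hinv.k_le
      rw [hK, elimRounds]; split_ifs <;> omega
    have hKn : 2 ^ K ≤ n := by
      refine le_trans ?_ hinv.card_le
      exact Nat.le_mul_of_pos_right _ (by omega)
    set y := min (n : ℝ) (I.gap i)⁻¹ with hy
    have hn0 : (0 : ℝ) < n := by
      have : 0 < n := lt_of_lt_of_le (by positivity) hKn
      exact_mod_cast this
    have hy0 : 0 < y := lt_min hn0 (by positivity)
    -- Both bounds on `K` are used: halvings give `2 ^ K ≤ n`, and `K ≤ r + 1` in a round that has
    -- not yet resolved the gap gives the inverse gap.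
    have hKy : (2 : ℝ) ^ K ≤ 4 * y := by
      rw [hy, mul_min_of_nonneg _ _ (by norm_num)]
      refine le_min ?_ ?_
      · have : (2 : ℝ) ^ K ≤ n := by exact_mod_cast hKn
        linarith
      · calc (2 : ℝ) ^ K ≤ 2 ^ (q.r + 1) := pow_le_pow_right₀ (by norm_num) hKr
          _ = 2 * 2 ^ q.r := by rw [pow_succ]; ring
          _ ≤ 4 * (I.gap i)⁻¹ := by linarith
    have hlog : Real.log ((K : ℝ) + 2) ≤ 2 + lnln y := by
      have h := log_le_lnln (k := (K : ℝ) - 2) (by linarith [K.cast_nonneg (α := ℝ)]) (by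
        have h1 := Real.log_le_log (by positivity) hKy
        rw [Real.log_pow, Real.log_mul (by norm_num) hy0.ne',
          show (4 : ℝ) = 2 ^ 2 by norm_num, Real.log_pow] at h1
        push_cast at h1
        linarith)
      rwa [show (K : ℝ) - 2 + 4 = K + 2 by ring] at h
    have hwL : wt lam K 0 ≤ lam + 3 + lnln y := by
      rw [wt]; push_cast; linarith
    have h0 : (0 : ℝ) < 4 ^ q.r := by positivity
    unfold chargeArm
    rw [max_eq_right (by linarith), max_eq_right (by linarith), h4r']
    nlinarith [mul_le_mul_of_nonneg_right hwL h0.le]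
  have hsub : D ⊆ Finset.univ.erase I.best := fun i hi =>
    Finset.mem_erase.2 ⟨(Finset.mem_erase.1 (Finset.mem_filter.1 hi).1).1, Finset.mem_univ _⟩
  unfold charge
  rw [← Finset.sum_sdiff hsub, ← Finset.sum_sdiff hsub (f := fun i => chargeArm lam I i q.r)]
  have h1 : ∑ i ∈ Finset.univ.erase I.best \ D, chargeArm lam I i (q.r + 1) ≤
      ∑ i ∈ Finset.univ.erase I.best \ D, chargeArm lam I i q.r := by
    refine Finset.sum_le_sum fun i _ => ?_
    have := lnln_nonneg (min (n : ℝ) (I.gap i)⁻¹)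
    unfold chargeArm
    gcongr
    · norm_num
    · omega
  have h2 := Finset.sum_le_sum harm
  rw [Finset.sum_add_distrib, Finset.sum_const, nsmul_eq_mul] at h2
  have h3 : (q.S.card : ℝ) ≤ 16 * D.card := by exact_mod_cast hq.le
  have h4 : 704 * 4 ^ q.r * (q.S.card : ℝ) * wt lam K 0 ≤
      D.card * (11264 * 4 ^ q.r * wt lam K 0) := by
    have : 0 ≤ 704 * 4 ^ q.r * wt lam K 0 := by positivity
    nlinarith
  linarith

lemma Near.early (hq : q.Near I) : 2 ^ q.r * I.gapTwo < 2 := by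
  have : 0 < ((q.S.erase I.best).filter fun i => I.gap i < 2 * (1 / 2) ^ q.r).card := by
    unfold Near at hq; omega
  obtain ⟨i, hi⟩ := Finset.card_pos.1 this
  obtain ⟨hiS, hig⟩ := Finset.mem_filter.1 hi
  have h1 := (I.gapTwo_le (Finset.mem_erase.1 hiS).1).trans_lt hig
  have h2 := mul_lt_mul_of_pos_left h1 (show (0 : ℝ) < 2 ^ q.r by positivity)
  have h := two_pow_mul_half_pow q.r
  linarith

lemma gapTwo_pos (hn : 2 ≤ n) : 0 < I.gapTwo := by
  obtain ⟨i, hi, h⟩ := I.exists_gap_eq_gapTwo hn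
  exact h ▸ I.gap_pos hi

/-- While the smallest gap is unresolved, the round number is of order log Δ₂⁻¹, so the drop of the
tail pays for the logarithm of the next round. -/
lemma refCost_succ_le_refTail (hn : 2 ≤ n) {r : ℕ} (hr : 2 ^ r * I.gapTwo < 2) :
    refCost I (r + 1) 0 ≤ refTail I (r + 1) := by
  have hg := gapTwo_pos I hn
  have h2r : (2 : ℝ) ^ r < 2 * (I.gapTwo)⁻¹ := by
    rw [← div_eq_mul_inv, lt_div_iff₀ hg]; exact hr
  have h4r : (4 : ℝ) ^ (r + 1 + 1) < 64 * ((I.gapTwo)⁻¹) ^ 2 := by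
    have : (4 : ℝ) ^ (r + 1 + 1) = 16 * (2 ^ r) ^ 2 := by
      rw [← pow_mul, mul_comm r, pow_mul, pow_succ, pow_succ]; norm_num; ring
    rw [this]
    have h0 : (0 : ℝ) < 2 ^ r := by positivity
    nlinarith
  have hlog : Real.log ((r + 1 : ℕ) + 2) ≤ 2 + lnln (I.gapTwo)⁻¹ := by
    have h := log_le_lnln (k := (r : ℝ) - 1) (y := (I.gapTwo)⁻¹)
      (by linarith [r.cast_nonneg (α := ℝ)]) (by
        have h1 := Real.log_le_log (by positivity) h2r.le
        rw [Real.log_pow, Real.log_mul (by norm_num) (by positivity)] at h1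
        linarith)
    push_cast
    rwa [show (r : ℝ) - 1 + 4 = r + 1 + 2 by ring] at h
  have h4r' : (4 : ℝ) ^ (r + 1 + 1) = 4 * 4 ^ (r + 1) := by rw [pow_succ]; ring
  unfold refCost refTail
  have h0 : (0 : ℝ) < 4 ^ (r + 1) := by positivity
  rw [max_eq_right (by linarith), max_eq_right (by linarith), h4r', pow_zero]
  nlinarith [mul_le_mul_of_nonneg_right hlog h0.le]

/-- Once the smallest gap is resolved the tail vanishes. The constant is 8 · 4 · 2, for the
coefficient, the next power of 4, and `log (r + 3) ≤ 2 * log (r + 2)`; a risk of 1/64 will cancel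
it. -/
lemma refCost_succ_le (hn : 2 ≤ n) {r : ℕ} (hr : ¬ 2 ^ r * I.gapTwo < 2) :
    refCost I (r + 1) 0 ≤ 64 * (4 ^ r * Real.log (r + 2)) := by
  have hg := gapTwo_pos I hn
  have h4r : 64 * ((I.gapTwo)⁻¹) ^ 2 ≤ (4 : ℝ) ^ (r + 1 + 1) := by
    have : (4 : ℝ) ^ (r + 1 + 1) = 16 * (2 ^ r) ^ 2 := by
      rw [← pow_mul, mul_comm r, pow_mul, pow_succ, pow_succ]; norm_num; ring
    rw [this]
    have h1 : 2 * (I.gapTwo)⁻¹ ≤ 2 ^ r := by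
      rw [← div_eq_mul_inv, div_le_iff₀ hg]; exact not_lt.1 hr
    have h0 : 0 < (I.gapTwo)⁻¹ := by positivity
    nlinarith
  have hlog : Real.log ((r + 1 : ℕ) + 2) ≤ 2 * Real.log (r + 2) := by
    have : 2 * Real.log ((r : ℝ) + 2) = Real.log (((r : ℝ) + 2) ^ 2) := by
      rw [Real.log_pow]; norm_num
    rw [this]
    refine Real.log_le_log (by positivity) ?_
    push_cast
    nlinarith [r.cast_nonneg (α := ℝ)]
  unfold refCost refTail
  rw [max_eq_left (by linarith), pow_zero, mul_zero, add_zero]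
  have h0 : (0 : ℝ) < 4 ^ r := by positivity
  have h4r' : (4 : ℝ) ^ (r + 1) = 4 * 4 ^ r := by rw [pow_succ]; ring
  rw [h4r']
  nlinarith [mul_le_mul_of_nonneg_left hlog h0.le]

end Charging

end ElimState

/-! ### The one-stage inequality for the cost -/

namespace ElimState

variable {n : ℕ} {lam : ℝ} (d : Fin n) (I : BestArmInstance n) {q : ElimState n}

lemma one_le_wt (hlam : 0 ≤ lam) (k j : ℕ) : 1 ≤ wt lam k j := by
  have := wt_ge (lam := lam) k j
  have := j.cast_nonneg (α := ℝ)
  linarith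

lemma exp_neg_nat_le (m : ℕ) : Real.exp (-m) ≤ (1 / 2) ^ m := by
  have h2 : (2 : ℝ) ≤ Real.exp 1 := by have := Real.add_one_le_exp 1; linarith
  rw [Real.exp_neg, one_div, inv_pow]
  refine inv_anti₀ (by positivity) ?_
  calc (2 : ℝ) ^ m ≤ Real.exp 1 ^ m := by gcongr
    _ = Real.exp m := by rw [← Real.exp_nat_mul, mul_one]

lemma len_pending_le (hlam : 0 ≤ lam) (he : q.e) :
    ((policy lam d).len q : ℝ) ≤ 204800 * (4 ^ q.r * q.S.card * wt lam q.k q.j) := by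
  have h : (policy lam d).len q = q.S.card * roundPulls q.r (wt lam q.k q.j) := by
    simp [StagedPolicy.len, policy, pullsOf, he]
  rw [h]
  push_cast
  have := roundPulls_le q.r (one_le_wt hlam q.k q.j)
  calc _ ≤ q.S.card * (204800 * 4 ^ q.r * wt lam q.k q.j) := by gcongr
    _ = _ := by ring

lemma len_search_le (hlam : 0 ≤ lam) (he : ¬ q.e) (hT : 2 ≤ q.T.card) :
    ((policy lam d).len q : ℝ) ≤
      204800 * (4 ^ q.r * (3 / 2) ^ q.l * q.T.card * wt lam q.k q.j) := by
  have h : (policy lam d).len q =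
      q.T.card * roundPulls q.r ((3 / 2) ^ q.l * wt lam q.k q.j) := by
    simp [StagedPolicy.len, policy, pullsOf, he, hT]
  rw [h]
  push_cast
  have h1 : (1 : ℝ) ≤ (3 / 2) ^ q.l := one_le_pow₀ (by norm_num)
  have := roundPulls_le q.r (one_le_mul_of_one_le_of_one_le h1 (one_le_wt hlam q.k q.j))
  calc _ ≤ q.T.card * (204800 * 4 ^ q.r * ((3 / 2) ^ q.l * wt lam q.k q.j)) := by gcongr
    _ = _ := by ring

lemma len_test_le (hlam : 0 ≤ lam) (he : ¬ q.e) (hT : ¬ 2 ≤ q.T.card) (hS : 0 < q.S.card) :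
    ((policy lam d).len q : ℝ) ≤ 204800 * testCost lam q := by
  have hS' : (1 : ℝ) ≤ q.S.card := by exact_mod_cast hS
  have hx := extra_nonneg q.r q.j
  have hw := one_le_wt hlam q.k q.j
  set N₁ := roundPulls q.r (wt lam q.k q.j + extra q.r q.j) with hN₁
  set N₂ := roundPulls q.r (wt lam q.k q.j + extra q.r q.j / q.S.card) with hN₂
  have h : (policy lam d).len q ≤ q.T.card * N₁ + q.S.card * N₂ := by
    calc (policy lam d).len q ≤ ∑ i, ((if i ∈ q.T then N₁ else 0) + if i ∈ q.S then N₂ else 0) := by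
          refine Finset.sum_le_sum fun i _ => ?_
          simp only [policy, pullsOf, he, hT, if_false, Bool.false_eq_true]
          split_ifs <;> omega
      _ = _ := by rw [Finset.sum_add_distrib]; simp
  have h' : ((policy lam d).len q : ℝ) ≤ q.T.card * N₁ + q.S.card * N₂ := by exact_mod_cast h
  have hT' : (q.T.card : ℝ) ≤ 1 := by exact_mod_cast (show q.T.card ≤ 1 by omega)
  have h1 : (N₁ : ℝ) ≤ _ := roundPulls_le q.r (y := wt lam q.k q.j + extra q.r q.j) (by linarith)
  have h2 : (N₂ : ℝ) ≤ _ := roundPulls_le q.r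
    (y := wt lam q.k q.j + extra q.r q.j / q.S.card) (by
      have : 0 ≤ extra q.r q.j / q.S.card := by positivity
      linarith)
  have h3 : q.S.card * (204800 * 4 ^ q.r * (wt lam q.k q.j + extra q.r q.j / q.S.card)) =
      204800 * 4 ^ q.r * (q.S.card * wt lam q.k q.j + extra q.r q.j) := by field_simp
  have h4 : wt lam q.k q.j ≤ q.S.card * wt lam q.k q.j := by nlinarith
  calc ((policy lam d).len q : ℝ) ≤ q.T.card * N₁ + q.S.card * N₂ := h'
    _ ≤ 1 * N₁ + q.S.card * N₂ := by gcongr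
    _ ≤ 204800 * 4 ^ q.r * (wt lam q.k q.j + extra q.r q.j) +
        q.S.card * (204800 * 4 ^ q.r * (wt lam q.k q.j + extra q.r q.j / q.S.card)) := by
      rw [one_mul]; gcongr
    _ = 204800 * 4 ^ q.r * (wt lam q.k q.j + extra q.r q.j) +
        204800 * 4 ^ q.r * (q.S.card * wt lam q.k q.j + extra q.r q.j) := by rw [h3]
    _ ≤ 204800 * 4 ^ q.r * (q.S.card * wt lam q.k q.j + extra q.r q.j) +
        204800 * 4 ^ q.r * (q.S.card * wt lam q.k q.j + extra q.r q.j) := by gcongr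
    _ = _ := by rw [testCost]; ring

/-- Passing from `l` to `l + 1` relaxes the requirement by ε/80 · (9/10)^l, and all these losses add
up to ε/8. If no arm kept meets the new requirement, every kept arm is worse by this amount than a
good arm that was dropped. -/
lemma measure_not_good_le (hlam : 5 ≤ lam) (he : ¬ q.e) (hT : 2 ≤ q.T.card) (hg : q.Good I) :
    I.rewardLaw.real {x | ¬ (q.narrow (topHalf q.T ((policy lam d).sums q x))).Good I} ≤
      goodRisk q.j q.l - goodRisk q.j (q.l + 1) := by
  obtain ⟨b, hb, hbm⟩ := hg
  set ε : ℝ := (1 / 2) ^ q.r with hε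
  have hε0 : 0 < ε := by positivity
  set e : ℝ := ε / 80 * (9 / 10) ^ q.l with hedef
  have he0 : 0 < e := by positivity
  set N := roundPulls q.r ((3 / 2) ^ q.l * wt lam q.k q.j) with hNdef
  have hN : ∀ i ∈ q.T, (policy lam d).pulls q i = N := by
    intro i hi
    simp [policy, pullsOf, he, hT, hi, hNdef]
  refine le_trans (measureReal_mono fun x hx => ?_)
    (((policy lam d).measure_topHalf_le I q q.T hN hb he0).trans ?_)
  · obtain ⟨hU, hUc, -⟩ := topHalf_spec q.T ((policy lam d).sums q x)
    simp only [Set.mem_ofPred_eq, Good, narrow, not_exists, not_and, not_le] at hx ⊢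
    set U := topHalf q.T ((policy lam d).sums q x)
    have hlt : ∀ i ∈ U, I.mean i < I.mean b - e := by
      intro i hi
      have := hx i hi
      rw [pow_succ] at this
      rw [hedef]
      linarith
    refine ⟨fun hbU => by have := hlt b hbU; linarith, ?_⟩
    rw [Finset.filter_true_of_mem fun i hi => (hlt i hi).le]
    omega
  · have h1 := le_roundPulls_mul q.r ((3 / 2) ^ q.l * wt lam q.k q.j)
    have hw : 6 + (q.j : ℝ) ≤ wt lam q.k q.j := by
      have := wt_ge (lam := lam) q.k q.j
      linarith
    have hj := q.j.cast_nonneg (α := ℝ)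
    have hl := q.l.cast_nonneg (α := ℝ)
    have h2 : N * e ^ 2 / 8 = (N * ε ^ 2) * (81 / 100) ^ q.l / 51200 := by
      have : ((9 / 10 : ℝ) ^ q.l) ^ 2 = (81 / 100) ^ q.l := by
        rw [← pow_mul, mul_comm, pow_mul]; norm_num
      rw [hedef, mul_pow, this]; ring
    have h3 : 2 * wt lam q.k q.j * (243 / 200) ^ q.l ≤ N * e ^ 2 / 8 := by
      rw [h2, le_div_iff₀ (by norm_num)]
      have : (243 / 200 : ℝ) ^ q.l = (3 / 2) ^ q.l * (81 / 100) ^ q.l := by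
        rw [← mul_pow]; norm_num
      rw [this]
      have := mul_le_mul_of_nonneg_right h1 (show (0 : ℝ) ≤ (81 / 100) ^ q.l by positivity)
      linarith
    have h4 : 1 + (q.l : ℝ) * (43 / 200) ≤ (243 / 200) ^ q.l := by
      have := one_add_mul_le_pow (a := (43 / 200 : ℝ)) (by norm_num) q.l
      norm_num at this ⊢
      linarith
    have h5 : ((12 + q.j + q.l : ℕ) : ℝ) ≤ N * e ^ 2 / 8 := by
      refine le_trans ?_ h3
      push_cast
      have h6 := mul_le_mul_of_nonneg_left h4 (show (0 : ℝ) ≤ 2 * wt lam q.k q.j by linarith)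
      refine le_trans ?_ h6
      nlinarith
    have h7 : Real.exp (-(N * e ^ 2 / 8)) ≤ (1 / 2) ^ (12 + q.j + q.l) :=
      (Real.exp_le_exp.2 (neg_le_neg h5)).trans (exp_neg_nat_le _)
    have h8 : goodRisk q.j q.l - goodRisk q.j (q.l + 1) = (1 / 2) ^ q.j * (1 / 2) ^ q.l / 256 := by
      unfold goodRisk; rw [pow_succ]; ring
    rw [h8]
    rw [pow_add, pow_add] at h7
    have h9 : (0 : ℝ) ≤ (1 / 2) ^ q.j * (1 / 2) ^ q.l := by positivity
    have h10 : (1 / 2 : ℝ) ^ 12 = 1 / 4096 := by norm_num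
    rw [h10] at h7
    linarith

lemma measure_advance_le_goodRisk (hlam : 5 ≤ lam) (he : ¬ q.e) (hT : q.T.Nonempty)
    (hT2 : ¬ 2 ≤ q.T.card) (hS : 0 < q.S.card) (hg : q.Good I) (hnear : ¬ q.Near I) :
    I.rewardLaw.real {x | q.S.card + 8 < 8 * StagedPolicy.nearCount q.S (pick d q.T)
        ((1 / 2) ^ q.r) (pullsOf lam q) ((policy lam d).sums q x)} ≤ goodRisk q.j q.l := by
  obtain ⟨b, hb, hbm⟩ := hg
  have hpick : pick d q.T = b := Finset.card_le_one.1 (by omega) _ (pick_mem d hT) _ hb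
  refine (measure_advance_le d I (by linarith) he hT hT2 hS ?_ (not_lt.1 hnear)).trans ?_
  · rw [hpick]
    refine le_trans ?_ hbm
    have : (0 : ℝ) ≤ (1 / 2) ^ q.r / 8 * (9 / 10) ^ q.l := by positivity
    linarith
  · have hw := wt_ge (lam := lam) q.k q.j
    have hj := q.j.cast_nonneg (α := ℝ)
    have h1 : Real.exp (-(5 * wt lam q.k q.j)) ≤ (1 / 2) ^ (12 + q.j) := by
      refine le_trans (Real.exp_le_exp.2 ?_) (exp_neg_nat_le _)
      push_cast
      linarith
    rw [pow_add, show (1 / 2 : ℝ) ^ 12 = 1 / 4096 by norm_num] at h1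
    have h2 : (0 : ℝ) ≤ (1 / 2) ^ q.j := by positivity
    have h3 : (0 : ℝ) ≤ (1 / 2) ^ q.j * (1 / 2) ^ q.l := by positivity
    unfold goodRisk
    linarith

lemma wt_succ (k j : ℕ) : wt lam k (j + 1) = wt lam k j + 1 := by
  unfold wt; push_cast; ring

lemma wt_elimRounds_le (k j : ℕ) : wt lam (elimRounds k j) 0 ≤ wt lam k j := by
  unfold wt elimRounds
  rcases Nat.eq_zero_or_pos j with rfl | hj
  · simp
  · have h1 : (1 : ℝ) ≤ j := by exact_mod_cast hj
    have h0 : (0 : ℝ) < k + 2 := by positivity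
    have h2 : Real.log ((k : ℝ) + 1 + 2) ≤ Real.log (k + 2) + 1 := by
      have : (k : ℝ) + 1 + 2 = (k + 2) * ((k + 3) / (k + 2)) := by field_simp; ring
      rw [this, Real.log_mul h0.ne' (by positivity)]
      have h3 := Real.log_le_sub_one_of_pos (show (0 : ℝ) < (k + 3) / (k + 2) by positivity)
      have h4 : ((k : ℝ) + 3) / (k + 2) ≤ 2 := by rw [div_le_iff₀ h0]; linarith
      linarith
    rw [if_neg hj.ne']
    push_cast
    linarith

lemma extra_mul_le (r j : ℕ) : 2 * (4 ^ r * extra r j) ≤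
    2 * ((1 / 2) ^ j * (4 ^ r * Real.log (r + 2))) := by
  have := log_nonneg_aux r
  unfold extra
  split_ifs with h
  · subst h; simp
  · rw [mul_zero, mul_zero]; positivity

/-- For `m ≥ 2` a half rounded up has at most `3 * m / 4` arms, and since the weight is at least 6
it grows by at most 7/6. So one eighth of the 176 units, that is 22, is freed: one pays for the
elimination, 21 remain. -/
lemma pendingCost_add_le (hlam : 5 ≤ lam) {m : ℕ} (hm : 2 ≤ m) (r k j : ℕ) :
    pendingCost lam I m r k j + 21 * (4 ^ r * m * wt lam k j) +
      4 * ((1 / 2) ^ j * (4 ^ r * Real.log (r + 2))) ≤ stepCost lam I m r k j := by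
  have h1 : (((m + 1) / 2 : ℕ) : ℝ) ≤ 3 / 4 * m := by
    have : 4 * ((m + 1) / 2) ≤ 3 * m := by omega
    have : (4 : ℝ) * ((m + 1) / 2 : ℕ) ≤ 3 * m := by exact_mod_cast this
    linarith
  have hw := wt_ge (lam := lam) k j
  have hj := j.cast_nonneg (α := ℝ)
  have h2 : wt lam k (j + 1) ≤ 7 / 6 * wt lam k j := by rw [wt_succ]; linarith
  have h3 : 176 * 4 ^ r * (((m + 1) / 2 : ℕ) : ℝ) * wt lam k (j + 1) ≤
      176 * 4 ^ r * (3 / 4 * m) * (7 / 6 * wt lam k j) := by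
    have := wt_pos (show 0 ≤ lam by linarith) k (j + 1)
    gcongr
  unfold pendingCost stepCost refCost
  rw [pow_succ]
  linarith

/-- If many arms are near optimal, their charges and the tail pay for a possible next round.
Otherwise the best arm makes the search good from the start, and the 21 free units are used up as 8
for the search, 2 for the test and 704/64 = 11 for the risk of a next round. -/
lemma runCost_start_le (hlam : 5 ≤ lam) (hinv : Inv q) (hb : I.best ∈ q.S) (hS : 2 ≤ q.S.card)
    (he : q.e = false) (hT : q.T = q.S) (hl : q.l = 0) :
    runCost lam I q ≤ stepCost lam I q.S.card q.r q.k q.j := by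
  have hn : 2 ≤ n := hS.trans (by simpa using Finset.card_le_univ q.S)
  have hlam0 : 0 ≤ lam := by linarith
  have hw := wt_pos hlam0 q.k q.j
  have hw' := wt_elimRounds_le (lam := lam) q.k q.j
  have hp := pendingCost_add_le I hlam hS q.r q.k q.j
  have hx := extra_mul_le q.r q.j
  have hlog := log_nonneg_aux q.r
  set m := q.S.card
  set w := wt lam q.k q.j
  set w' := wt lam (elimRounds q.k q.j) 0
  set P := pendingCost lam I m q.r q.k q.j
  set D : ℝ := 4 ^ q.r * m * w with hD
  have hD0 : 0 ≤ D := by positivity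
  set A : ℝ := (1 / 2) ^ q.j * (4 ^ q.r * Real.log (q.r + 2)) with hA
  have hA0 : 0 ≤ A := by positivity
  have hD' : 4 ^ q.r * m * w' ≤ D := by rw [hD]; gcongr
  have hstep : stepCost lam I m q.r q.k q.j =
      176 * D + charge lam I q.r + (8 * A + refTail I (q.r + 1)) := by
    simp only [stepCost, refCost, hD, hA]; ring
  have hc := charge_nonneg I hlam0 q.r
  have ht := refTail_nonneg I (q.r + 1)
  have hsearch : searchCost lam q ≤ 8 * D := by
    have : 0 ≤ 4 ^ q.r * w := by positivity
    simp only [searchCost, hT, hl, hD, pow_zero, mul_one]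
    change 8 * 4 ^ q.r * ((m : ℝ) - 1) * w ≤ _
    nlinarith
  have htest : testCost lam q ≤ 2 * D + 2 * A := by
    simp only [testCost, hD]
    change 2 * 4 ^ q.r * ((m : ℝ) * w + _) ≤ _
    linarith
  have hrun : runCost lam I q = searchCost lam q + testCost lam q + P + risk I q * excess lam I q := by
    simp [runCost, he, P, m]
  suffices h : 10 * D + 2 * A + P + risk I q * excess lam I q ≤
      stepCost lam I m q.r q.k q.j by linarith
  by_cases hnear : q.Near I
  · have h1 : risk I q * excess lam I q ≤ excess lam I q :=
      mul_le_of_le_one_left (excess_nonneg I hlam0 q) (risk_le_one I q)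
    have h2 : excess lam I q = max 0 (stepCost lam I m (q.r + 1) (elimRounds q.k q.j) 0 - P) := by
      simp only [excess, if_pos hnear]; rfl
    rcases max_cases 0 (stepCost lam I m (q.r + 1) (elimRounds q.k q.j) 0 - P) with h | h
    · linarith
    · have h3 := charge_succ_add_le I hlam0 hinv hS hnear
      have h4 := refCost_succ_le_refTail I hn (hnear.early I)
      have h5 : stepCost lam I m (q.r + 1) (elimRounds q.k q.j) 0 =
          704 * 4 ^ q.r * m * w' + charge lam I (q.r + 1) + refCost I (q.r + 1) 0 := by
        simp only [stepCost, pow_succ]; ring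
      have h6 : charge lam I (q.r + 1) + 704 * 4 ^ q.r * m * w' ≤ charge lam I q.r := h3
      linarith
  · have hgood : q.Good I := ⟨I.best, hT ▸ hb, by rw [hl, pow_zero]; linarith⟩
    have h1 : risk I q = (1 / 2) ^ q.j / 64 := by
      simp only [risk, hnear, hgood, not_false_eq_true, and_self, if_true, goodRisk, hl, pow_zero]
      ring
    have hj1 : (1 / 2 : ℝ) ^ q.j ≤ 1 := pow_le_one₀ (by norm_num) (by norm_num)
    have hj0 : (0 : ℝ) < (1 / 2) ^ q.j := by positivity
    have h2 : excess lam I q ≤ 704 * D + 64 * (4 ^ q.r * Real.log (q.r + 2)) := by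
      simp only [excess, if_neg hnear]
      have h3 : 176 * 4 ^ (q.r + 1) * (m : ℝ) * w' ≤ 704 * D := by
        rw [pow_succ]; linarith
      have h4 : (if 2 ^ q.r * I.gapTwo < 2 then 0 else refCost I (q.r + 1) 0) ≤
          64 * (4 ^ q.r * Real.log (q.r + 2)) := by
        split_ifs with h
        · positivity
        · exact refCost_succ_le I hn h
      exact add_le_add h3 h4
    have h3 := mul_le_mul_of_nonneg_left h2 (show 0 ≤ (1 / 2 : ℝ) ^ q.j / 64 by positivity)
    rw [h1]
    have h4 : (1 / 2 : ℝ) ^ q.j / 64 * (704 * D + 64 * (4 ^ q.r * Real.log (q.r + 2))) =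
        11 * ((1 / 2) ^ q.j * D) + A := by rw [hA]; ring
    have h5 : (1 / 2 : ℝ) ^ q.j * D ≤ D := mul_le_of_le_one_left hD0 hj1
    linarith

/-- The cost after a round that ends without a further elimination. -/
lemma stepCost_succ_le (hlam : 0 ≤ lam) (hn : 2 ≤ n) (q : ElimState n) :
    stepCost lam I q.S.card (q.r + 1) (elimRounds q.k q.j) 0 ≤
      pendingCost lam I q.S.card q.r q.k q.j + excess lam I q := by
  by_cases hnear : q.Near I
  · simp only [excess, if_pos hnear]
    have := le_max_right 0 (stepCost lam I q.S.card (q.r + 1) (elimRounds q.k q.j) 0 -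
      pendingCost lam I q.S.card q.r q.k q.j)
    linarith
  · have hw := wt_pos hlam q.k q.j
    have hw' := wt_pos hlam q.k (q.j + 1)
    have hc := charge_succ_le I hlam q.r
    have hlog := log_nonneg_aux q.r
    have ht := refTail_nonneg I (q.r + 1)
    have h0 : (0 : ℝ) ≤ 8 * (1 / 2) ^ (q.j + 1) * (4 ^ q.r * Real.log (q.r + 2)) := by positivity
    have h1 : (0 : ℝ) ≤ 4 ^ q.r * q.S.card * wt lam q.k q.j := by positivity
    have h2 : (0 : ℝ) ≤ 176 * 4 ^ q.r * ((q.S.card + 1) / 2 : ℕ) * wt lam q.k (q.j + 1) := by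
      positivity
    simp only [excess, if_neg hnear]
    have h3 : refCost I (q.r + 1) 0 ≤ refTail I (q.r + 1) +
        if 2 ^ q.r * I.gapTwo < 2 then 0 else refCost I (q.r + 1) 0 := by
      split_ifs with h
      · rw [add_zero]; exact refCost_succ_le_refTail I hn h
      · linarith
    have h4 : refCost I q.r (q.j + 1) =
      8 * (1 / 2) ^ (q.j + 1) * (4 ^ q.r * Real.log (q.r + 2)) + refTail I (q.r + 1) := rfl
    unfold pendingCost stepCost
    linarith

lemma lintegral_le_of_forall_le {Ω : Type*} [MeasurableSpace Ω] (μ : Measure Ω)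
    [IsProbabilityMeasure μ] {f : Ω → ℝ≥0∞} {c : ℝ≥0∞} (h : ∀ x, f x ≤ c) : ∫⁻ x, f x ∂μ ≤ c :=
  (lintegral_mono h).trans_eq (by simp)

open Classical in
/-- A bound on the expected number of samples from a state on. -/
noncomputable def costPotential (lam : ℝ) (I : BestArmInstance n) (q : ElimState n) : ℝ≥0∞ :=
  if q.Bad I ∨ q.S.card ≤ 1 then 0 else ENNReal.ofReal (204800 * runCost lam I q)

lemma costPotential_le {c : ℝ}
    (h : I.best ∈ q.S → 2 ≤ q.S.card → runCost lam I q ≤ c) :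
    costPotential lam I q ≤ ENNReal.ofReal (204800 * c) := by
  unfold costPotential
  split_ifs with hq
  · exact zero_le
  · rw [not_or, Bad, not_or, not_not] at hq
    exact ENNReal.ofReal_le_ofReal (by linarith [h hq.1.1 (by omega)])

/-- Each kind of stage pays its length from one term of `runCost`: an elimination from
`pendingCost`, a halving of candidates from `searchCost`, a test from `testCost`. Failure
probabilities are paid by the decrease of `risk`. -/
lemma lintegral_costPotential_le (hlam : 5 ≤ lam) (hinv : Inv q) (hbad : ¬ q.Bad I)
    (hout : (policy lam d).out q = none) :
    ((policy lam d).len q : ℝ≥0∞) + ∫⁻ x, costPotential lam I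
      ((policy lam d).next q ((policy lam d).sums q x)) ∂I.rewardLaw ≤ costPotential lam I q := by
  obtain ⟨hS, hTne⟩ := (out_eq_none lam d q).1 hout
  have hn : 2 ≤ n := hS.trans (by simpa using Finset.card_le_univ q.S)
  have hlam0 : 0 ≤ lam := by linarith
  have hb : I.best ∈ q.S := by_contra fun h => hbad (Or.inl h)
  have hphi : costPotential lam I q = ENNReal.ofReal (204800 * runCost lam I q) := by
    rw [costPotential, if_neg]
    rintro (h | h)
    · exact hbad h
    · omega
  have hcomb : ∀ {L c : ℝ}, 0 ≤ L → 0 ≤ c → ((policy lam d).len q : ℝ) ≤ 204800 * L →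
      (∫⁻ x, costPotential lam I ((policy lam d).next q ((policy lam d).sums q x)) ∂I.rewardLaw ≤
        ENNReal.ofReal (204800 * c)) → L + c ≤ runCost lam I q →
      ((policy lam d).len q : ℝ≥0∞) + ∫⁻ x, costPotential lam I
        ((policy lam d).next q ((policy lam d).sums q x)) ∂I.rewardLaw ≤ costPotential lam I q := by
    intro L c hL hc h1 h2 h3
    rw [hphi]
    calc _ ≤ ENNReal.ofReal (204800 * L) + ENNReal.ofReal (204800 * c) := by
          gcongr
          rw [← ENNReal.ofReal_natCast]
          exact ENNReal.ofReal_le_ofReal h1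
      _ = ENNReal.ofReal (204800 * (L + c)) := by
          rw [← ENNReal.ofReal_add (by positivity) (by positivity), mul_add]
      _ ≤ _ := ENNReal.ofReal_le_ofReal (by linarith)
  have hw := wt_pos hlam0 q.k q.j
  have hP := pendingCost_nonneg I hlam0 q.S.card q.r q.k q.j
  have hX := excess_nonneg I hlam0 q
  by_cases he : q.e
  · refine hcomb (L := 4 ^ q.r * q.S.card * wt lam q.k q.j)
      (c := stepCost lam I ((q.S.card + 1) / 2) q.r q.k (q.j + 1))
      (by positivity) (stepCost_nonneg I hlam0 _ _ _ _) (len_pending_le d hlam0 he) ?_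
      (by simp [runCost, he, pendingCost])
    refine lintegral_le_of_forall_le _ fun x => ?_
    have hnext : (policy lam d).next q ((policy lam d).sums q x) =
        q.eliminate (topHalf q.S ((policy lam d).sums q x)) := by simp [policy, nextOf, he]
    rw [hnext]
    refine costPotential_le I fun hb' hS' => ?_
    have h := runCost_start_le I hlam (hinv.eliminate ((policy lam d).sums q x)) hb' hS' rfl rfl rfl
    rwa [show (q.eliminate (topHalf q.S ((policy lam d).sums q x))).S.card = (q.S.card + 1) / 2 from
      (topHalf_spec q.S _).2.1] at h
  · have hrun : runCost lam I q = searchCost lam q + testCost lam q +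
        pendingCost lam I q.S.card q.r q.k q.j + risk I q * excess lam I q := by
      simp [runCost, he]
    have htest : 0 ≤ testCost lam q := by
      have := extra_nonneg q.r q.j
      unfold testCost; positivity
    have hT1 : (1 : ℝ) ≤ q.T.card := by exact_mod_cast hTne.card_pos
    by_cases hT : 2 ≤ q.T.card
    · set U := fun x => topHalf q.T ((policy lam d).sums q x) with hU
      have hnext : ∀ x, (policy lam d).next q ((policy lam d).sums q x) = q.narrow (U x) := by
        intro x; simp [policy, nextOf, he, hT, hU]
      set B : ℝ := 8 * 4 ^ q.r * (3 / 2) ^ (q.l + 1) * (((q.T.card + 1) / 2 : ℕ) - 1) *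
        wt lam q.k q.j + testCost lam q + pendingCost lam I q.S.card q.r q.k q.j with hB
      have hU1 : (1 : ℝ) ≤ ((q.T.card + 1) / 2 : ℕ) := by
        exact_mod_cast (show 1 ≤ (q.T.card + 1) / 2 by omega)
      have hB0 : 0 ≤ B := by
        have := sub_nonneg.2 hU1
        positivity
      have hrunU : ∀ x, runCost lam I (q.narrow (U x)) =
          B + risk I (q.narrow (U x)) * excess lam I q := by
        intro x
        have h1 : (q.narrow (U x)).T.card = (q.T.card + 1) / 2 := (topHalf_spec q.T _).2.1
        simp only [runCost, searchCost, h1]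
        rfl
      have hR := risk_nonneg I q
      refine hcomb (L := 4 ^ q.r * (3 / 2) ^ q.l * q.T.card * wt lam q.k q.j)
        (c := B + risk I q * excess lam I q) (by positivity) (by positivity)
        (len_search_le d hlam0 he hT) ?_ ?_
      · simp_rw [hnext]
        by_cases hg : ¬ q.Near I ∧ q.Good I
        · have hr : risk I q = goodRisk q.j q.l := if_pos hg
          have hg0 := goodRisk_nonneg q.j (q.l + 1)
          refine (lintegral_le_of_le_indicator (a := 204800 * excess lam I q)
            (b := 204800 * (B + goodRisk q.j (q.l + 1) * excess lam I q)) _ (by positivity)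
            (by positivity) (measure_not_good_le d I hlam he hT hg.2) ?_ ?_).trans_eq ?_
          · intro x _
            rw [← mul_add]
            refine costPotential_le I fun _ _ => ?_
            rw [hrunU]
            have := mul_le_of_le_one_left hX (risk_le_one I (q.narrow (U x)))
            have : 0 ≤ goodRisk q.j (q.l + 1) * excess lam I q := by positivity
            linarith
          · intro x hx
            refine costPotential_le I fun _ _ => ?_
            rw [hrunU, show risk I (q.narrow (U x)) = goodRisk q.j (q.l + 1) from
              if_pos ⟨hg.1, not_not.1 hx⟩]
          · rw [hr]; congr 1; ring
        · rw [show risk I q = 1 from if_neg hg]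
          refine lintegral_le_of_forall_le _ fun x => costPotential_le I fun _ _ => ?_
          rw [hrunU]
          gcongr
          exact risk_le_one I _
      · have h1 : (((q.T.card + 1) / 2 : ℕ) : ℝ) ≤ (q.T.card + 1) / 2 := by
          rw [le_div_iff₀ (by norm_num)]
          exact_mod_cast (show (q.T.card + 1) / 2 * 2 ≤ q.T.card + 1 by omega)
        have h2 : (2 : ℝ) ≤ q.T.card := by exact_mod_cast hT
        have h3 : 0 ≤ 4 ^ q.r * (3 / 2) ^ q.l * wt lam q.k q.j := by positivity
        -- Here 12 = 8 · 3/2, and the inequality amounts to `2 ≤ q.T.card`; this fixes the constant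
        -- 8 in `searchCost`.
        have h4 : (q.T.card : ℝ) + 12 * (((q.T.card + 1) / 2 : ℕ) - 1) ≤ 8 * (q.T.card - 1) := by
          linarith
        have h5 := mul_le_mul_of_nonneg_left h4 h3
        rw [hrun, hB, searchCost, pow_succ]
        linarith
    · have hsearch : 0 ≤ searchCost lam q := by
        have := sub_nonneg.2 hT1
        unfold searchCost; positivity
      have hR := risk_nonneg I q
      refine hcomb (L := testCost lam q)
        (c := risk I q * excess lam I q + pendingCost lam I q.S.card q.r q.k q.j) htest
        (by positivity) (len_test_le d hlam0 he hT (by omega)) ?_ (by rw [hrun]; linarith)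
      set E := {x | q.S.card + 8 < 8 * StagedPolicy.nearCount q.S (pick d q.T)
        ((1 / 2) ^ q.r) (pullsOf lam q) ((policy lam d).sums q x)} with hE
      have hp : I.rewardLaw.real E ≤ risk I q := by
        by_cases hg : ¬ q.Near I ∧ q.Good I
        · rw [show risk I q = goodRisk q.j q.l from if_pos hg]
          exact measure_advance_le_goodRisk d I hlam he hTne hT (by omega) hg.2 hg.1
        · rw [show risk I q = 1 from if_neg hg]
          exact measureReal_le_one
      refine (lintegral_le_of_le_indicator (a := 204800 * excess lam I q)
        (b := 204800 * pendingCost lam I q.S.card q.r q.k q.j) _ (by positivity)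
        (by positivity) hp ?_ ?_).trans_eq ?_
      · intro x hx
        have hx' : ¬ 8 * StagedPolicy.nearCount q.S (pick d q.T) ((1 / 2) ^ q.r) (pullsOf lam q)
            ((policy lam d).sums q x) ≤ q.S.card + 8 := not_le.2 hx
        have hnext : (policy lam d).next q ((policy lam d).sums q x) = q.advance := by
          simp [policy, nextOf, he, hT] at hx' ⊢
          omega
        rw [hnext, ← mul_add]
        refine costPotential_le I fun hb' hS' => ?_
        have h1 := runCost_start_le I hlam hinv.advance hb' hS' rfl rfl rfl
        have h2 := stepCost_succ_le I hlam0 hn q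
        have h3 : stepCost lam I q.advance.S.card q.advance.r q.advance.k q.advance.j =
          stepCost lam I q.S.card (q.r + 1) (elimRounds q.k q.j) 0 := rfl
        linarith
      · intro x hx
        have hx' : 8 * StagedPolicy.nearCount q.S (pick d q.T) ((1 / 2) ^ q.r) (pullsOf lam q)
            ((policy lam d).sums q x) ≤ q.S.card + 8 := not_lt.1 hx
        have hnext : (policy lam d).next q ((policy lam d).sums q x) = q.accept := by
          simp [policy, nextOf, he, hT] at hx' ⊢
          omega
        rw [hnext]
        refine costPotential_le I fun _ _ => ?_
        simp [runCost, accept]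
      · congr 1; ring

end ElimState

/-! ### Guarantees for a single run and comparison with the complexity -/

namespace ElimState

variable {n : ℕ} {lam : ℝ} (d : Fin n) (I : BestArmInstance n)

noncomputable def algorithm (lam : ℝ) (d : Fin n) : BanditAlgorithm n :=
  (policy lam d).toAlgorithm (measurable_nextOf lam d)

lemma inv_init : Inv (policy lam d).init :=
  ⟨Finset.Subset.refl _, ⟨d, Finset.mem_univ d⟩, le_rfl, by simp [policy, elimRounds]⟩

lemma not_bad_init : ¬ (policy lam d).init.Bad I := by simp [policy, Bad]

lemma failPotential_init : failPotential lam I (policy lam d).init =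
    ENNReal.ofReal (Real.exp (-lam)) := by
  rw [failPotential, if_neg (not_bad_init d I)]
  simp only [policy, failBound, Bool.false_eq_true, if_false]
  congr 1
  norm_num

lemma costPotential_init_le (hlam : 5 ≤ lam) :
    costPotential lam I (policy lam d).init ≤
      ENNReal.ofReal (204800 * stepCost lam I n 0 0 0) := by
  refine costPotential_le I fun hb hS => ?_
  have h := runCost_start_le I hlam (inv_init d) hb hS rfl rfl rfl
  simpa [policy] using h

/-- Off an event of probability at most `exp (-lam)` the elimination procedure stops and returns the
best arm after a number of samples whose expectation is bounded. -/
lemma exists_event (hlam : 5 ≤ lam) :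
    ∃ (B : Set (ℕ → Fin n → ℝ)) (Y : (ℕ → Fin n → ℝ) → ℝ≥0∞), MeasurableSet B ∧
      I.rewardLaw B ≤ ENNReal.ofReal (Real.exp (-lam)) ∧ Measurable Y ∧
      ∫⁻ x, Y x ∂I.rewardLaw ≤ ENNReal.ofReal (204800 * stepCost lam I n 0 0 0) ∧
      ∀ x ∉ B, ∃ t : ℕ, (t : ℝ≥0∞) ≤ Y x ∧ (algorithm lam d).StopsWith () x t I.best := by
  have hlam0 : 0 ≤ lam := by linarith
  set M := policy lam d with hM
  set acc : ElimState n → Prop := fun q => q.Bad I ∨ M.out q ≠ none with hacc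
  have hinv : ∀ q, Inv q → ¬ acc q → ∀ v, Inv (M.next q v) := fun q h _ v => h.next lam d v
  set Y : (ℕ → Fin n → ℝ) → ℝ≥0∞ := fun x =>
    ⨆ k, M.val acc (fun q => M.len q) 0 k M.init x with hY
  set Z : (ℕ → Fin n → ℝ) → ℝ≥0∞ := fun x =>
    ⨆ k, M.val acc 0 (Set.indicator {q | q.Bad I} 1) k M.init x with hZ
  have hYm : Measurable Y :=
    Measurable.iSup fun k => M.measurable_val acc _ _ (measurable_nextOf lam d) k _
  have hZm : Measurable Z :=
    Measurable.iSup fun k => M.measurable_val acc _ _ (measurable_nextOf lam d) k _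
  have hZi : ∫⁻ x, Z x ∂I.rewardLaw ≤ ENNReal.ofReal (Real.exp (-lam)) := by
    rw [← failPotential_init d I]
    refine M.lintegral_iSup_val_le acc _ _ I (measurable_nextOf lam d) Inv hinv _ ?_ ?_ _
      (inv_init d)
    · intro q _ _
      by_cases hq : q.Bad I
      · simp [failPotential, hq]
      · simp [hq]
    · intro q _ hq
      rw [hacc, not_or, not_not] at hq
      rw [Pi.zero_apply, zero_add]
      exact lintegral_failPotential_le d I hlam0 hq.1 hq.2
  have hYi : ∫⁻ x, Y x ∂I.rewardLaw ≤ ENNReal.ofReal (204800 * stepCost lam I n 0 0 0) := by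
    refine le_trans ?_ (costPotential_init_le d I hlam)
    refine M.lintegral_iSup_val_le acc _ _ I (measurable_nextOf lam d) Inv hinv _ ?_ ?_ _
      (inv_init d)
    · intro q _ _
      exact zero_le
    · intro q hi hq
      rw [hacc, not_or, not_not] at hq
      exact lintegral_costPotential_le d I hlam hi hq.1 hq.2
  have hYtop : I.rewardLaw {x | Y x = ⊤} = 0 :=
    measure_eq_top_of_lintegral_ne_top hYm.aemeasurable (hYi.trans_lt ENNReal.ofReal_lt_top).ne
  -- Absorption in a bad state has value one, so Markov's inequality for `Z` bounds its probability;
  -- infinite length is a null event.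
  refine ⟨{x | 1 ≤ Z x} ∪ {x | Y x = ⊤}, Y, ?_, ?_, hYm, hYi, ?_⟩
  · exact (measurableSet_le measurable_const hZm).union (hYm (measurableSet_singleton ⊤))
  · refine (measure_union_le _ _).trans ?_
    rw [hYtop, add_zero]
    have := mul_meas_ge_le_lintegral (μ := I.rewardLaw) hZm 1
    rw [one_mul] at this
    exact this.trans hZi
  · intro x hx
    simp only [Set.mem_union, Set.mem_ofPred_eq, not_or, not_le] at hx
    obtain ⟨t, ht, hta, htu⟩ := M.exists_halt (fun q => q.Bad I) Inv hinv
      (fun q hq => exists_pulls_pos d hlam0 hq) I.best (by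
        intro q i hi hq ho
        have hb : I.best ∈ q.S := by_contra fun h => hq (Or.inl h)
        simp only [hM, policy] at ho
        split_ifs at ho with h
        rw [← Option.some.inj ho]
        have hc : q.S.card ≤ 1 := h.resolve_right hi.nonempty.ne_empty
        exact Finset.card_le_one.1 hc _ (pick_mem d ⟨_, hb⟩) _ hb) x M.init (inv_init d) hx.2 hx.1
    have hact : ∀ u, (algorithm lam d).action () x u = M.decision (M.traj (M.init, 0, 0) x u) :=
      fun u => M.toAlgorithm_action (measurable_nextOf lam d) () x u
    refine ⟨t, ht, by rw [hact]; exact hta, fun u hu => ?_⟩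
    rw [hact]
    exact htu u hu

/-- The sample complexity of the theorem, with `L` in place of `log δ⁻¹`. -/
noncomputable def complexity (I : BestArmInstance n) (L : ℝ) : ℝ :=
  (I.gapTwo⁻¹) ^ 2 * lnln (I.gapTwo⁻¹)
    + ∑ i ∈ Finset.univ.erase I.best, ((I.gap i)⁻¹) ^ 2 * L
    + ∑ i ∈ Finset.univ.erase I.best, ((I.gap i)⁻¹) ^ 2 * lnln (min (n : ℝ) ((I.gap i)⁻¹))

section Bounds

lemma one_le_gap_inv_sq {i : Fin n} (hi : i ≠ I.best) : 1 ≤ ((I.gap i)⁻¹) ^ 2 :=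
  one_le_pow₀ ((one_le_inv₀ (I.gap_pos hi)).2 (I.gap_le_one i))

/-- Gaps are at most 1, so each of the `n - 1 ≥ n / 2` suboptimal arms contributes at least 1. -/
lemma card_le_two_mul_sum (hn : 2 ≤ n) :
    (n : ℝ) ≤ 2 * ∑ i ∈ Finset.univ.erase I.best, ((I.gap i)⁻¹) ^ 2 := by
  have h := Finset.card_nsmul_le_sum (Finset.univ.erase I.best) (fun i => ((I.gap i)⁻¹) ^ 2) 1
    fun i hi => one_le_gap_inv_sq I (Finset.mem_erase.1 hi).1
  rw [Finset.card_erase_of_mem (Finset.mem_univ _), Finset.card_univ, Fintype.card_fin,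
    nsmul_eq_mul, mul_one, Nat.cast_sub (by omega)] at h
  have : (2 : ℝ) ≤ n := by exact_mod_cast hn
  push_cast at h
  linarith

lemma gapTwo_inv_sq_le_sum (hn : 2 ≤ n) :
    (I.gapTwo⁻¹) ^ 2 ≤ ∑ i ∈ Finset.univ.erase I.best, ((I.gap i)⁻¹) ^ 2 := by
  obtain ⟨i, hi, h⟩ := I.exists_gap_eq_gapTwo hn
  rw [← h]
  exact Finset.single_le_sum (f := fun i => ((I.gap i)⁻¹) ^ 2) (fun _ _ => by positivity)
    (Finset.mem_erase.2 ⟨hi, Finset.mem_univ i⟩)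

lemma one_le_complexity (hn : 2 ≤ n) {L : ℝ} (hL : 1 ≤ L) : 1 ≤ complexity I L := by
  have h1 := card_le_two_mul_sum I hn
  have h2 : (2 : ℝ) ≤ n := by exact_mod_cast hn
  have h3 : 0 ≤ (I.gapTwo⁻¹) ^ 2 * lnln (I.gapTwo⁻¹) := mul_nonneg (by positivity) (lnln_nonneg _)
  have h4 : 0 ≤ ∑ i ∈ Finset.univ.erase I.best,
      ((I.gap i)⁻¹) ^ 2 * lnln (min (n : ℝ) ((I.gap i)⁻¹)) :=
    Finset.sum_nonneg fun i _ => mul_nonneg (by positivity) (lnln_nonneg _)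
  unfold complexity
  rw [← Finset.sum_mul]
  nlinarith

lemma stepCost_init_le (hlam : 5 ≤ lam) (hn : 2 ≤ n) :
    stepCost lam I n 0 0 0 ≤ 200000 * complexity I lam := by
  have hn2 : (2 : ℝ) ≤ n := by exact_mod_cast hn
  have h1 := card_le_two_mul_sum I hn
  have h2 := gapTwo_inv_sq_le_sum I hn
  have h3 := lnln_nonneg (I.gapTwo⁻¹)
  have hlog : Real.log 2 ≤ 1 := by have := Real.log_two_lt_d9; linarith
  unfold stepCost refCost complexity
  rw [← Finset.sum_mul]
  set O := ∑ i ∈ Finset.univ.erase I.best, ((I.gap i)⁻¹) ^ 2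
  have hO : 1 ≤ O := by linarith
  have hwt : wt lam 0 0 ≤ 2 * lam := by unfold wt; norm_num; linarith
  have h4 : 176 * 4 ^ 0 * (n : ℝ) * wt lam 0 0 ≤ 704 * (O * lam) := by
    have : (n : ℝ) * wt lam 0 0 ≤ (2 * O) * (2 * lam) :=
      mul_le_mul h1 hwt (wt_pos (by linarith) 0 0).le (by positivity)
    rw [pow_zero]
    linarith
  have h5 : charge lam I 0 ≤ 60100 * (2 * (O * lam) + ∑ i ∈ Finset.univ.erase I.best,
      ((I.gap i)⁻¹) ^ 2 * lnln (min (n : ℝ) ((I.gap i)⁻¹))) := by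
    rw [Finset.sum_mul, Finset.mul_sum, ← Finset.sum_add_distrib, Finset.mul_sum]
    refine Finset.sum_le_sum fun i _ => ?_
    have h6 := lnln_nonneg (min (n : ℝ) (I.gap i)⁻¹)
    have h7 : 0 ≤ ((I.gap i)⁻¹) ^ 2 := by positivity
    have h8 : max 0 ((16 * ((I.gap i)⁻¹) ^ 2 - 4 ^ 0) / 3) ≤ 16 / 3 * ((I.gap i)⁻¹) ^ 2 := by
      refine max_le (by positivity) ?_
      rw [pow_zero]; linarith
    calc chargeArm lam I i 0 ≤ 11264 * (2 * lam + lnln (min (n : ℝ) (I.gap i)⁻¹)) *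
          (16 / 3 * ((I.gap i)⁻¹) ^ 2) := by
          unfold chargeArm
          gcongr
          linarith
      _ ≤ _ := by
        have h9 : 0 ≤ ((I.gap i)⁻¹) ^ 2 * lam := by positivity
        have h10 : 0 ≤ ((I.gap i)⁻¹) ^ 2 * lnln (min (n : ℝ) (I.gap i)⁻¹) := mul_nonneg h7 h6
        linarith
  have h6 : refTail I (0 + 1) ≤ 342 * O + 171 * ((I.gapTwo⁻¹) ^ 2 * lnln (I.gapTwo⁻¹)) := by
    have h7 : 0 ≤ (I.gapTwo⁻¹) ^ 2 := by positivity
    have h8 : max 0 ((64 * (I.gapTwo⁻¹) ^ 2 - 4 ^ (0 + 1)) / 3) ≤ 64 / 3 * (I.gapTwo⁻¹) ^ 2 := by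
      refine max_le (by positivity) ?_
      rw [zero_add, pow_one]; linarith
    calc refTail I (0 + 1) ≤ 8 * (2 + lnln (I.gapTwo⁻¹)) * (64 / 3 * (I.gapTwo⁻¹) ^ 2) := by
          unfold refTail
          gcongr
      _ ≤ _ := by
        have := mul_nonneg h7 h3
        linarith
  have h7 : O * 5 ≤ O * lam := by gcongr
  have h8 : 0 ≤ (I.gapTwo⁻¹) ^ 2 * lnln (I.gapTwo⁻¹) := mul_nonneg (by positivity) h3
  have h9 : 0 ≤ ∑ i ∈ Finset.univ.erase I.best,
      ((I.gap i)⁻¹) ^ 2 * lnln (min (n : ℝ) ((I.gap i)⁻¹)) :=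
    Finset.sum_nonneg fun i _ => mul_nonneg (by positivity) (lnln_nonneg _)
  have h10 : 8 * (1 / 2) ^ 0 * (4 ^ 0 * Real.log ((0 : ℕ) + 2)) ≤ 8 := by norm_num; linarith
  linarith

lemma complexity_le_mul {L c : ℝ} (hc : 1 ≤ c) (hL : lam ≤ c * L) :
    complexity I lam ≤ c * complexity I L := by
  have h3 : 0 ≤ (I.gapTwo⁻¹) ^ 2 * lnln (I.gapTwo⁻¹) := mul_nonneg (by positivity) (lnln_nonneg _)
  have h4 : 0 ≤ ∑ i ∈ Finset.univ.erase I.best,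
      ((I.gap i)⁻¹) ^ 2 * lnln (min (n : ℝ) ((I.gap i)⁻¹)) :=
    Finset.sum_nonneg fun i _ => mul_nonneg (by positivity) (lnln_nonneg _)
  have h5 : 0 ≤ ∑ i ∈ Finset.univ.erase I.best, ((I.gap i)⁻¹) ^ 2 :=
    Finset.sum_nonneg fun i _ => by positivity
  unfold complexity
  rw [← Finset.sum_mul, ← Finset.sum_mul]
  nlinarith [mul_le_mul_of_nonneg_left hL h5]

end Bounds

end ElimState

/-! ### Confidence levels of the copies and conclusion -/

/-- The confidence parameter of the copy with index `l`. -/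
noncomputable def confidence (δ : ℝ) (l : ℕ) : ℝ := Real.log (16 ^ (l + 1) / δ)

section Confidence

variable {δ : ℝ}

lemma exp_neg_confidence (hδ : 0 < δ) (l : ℕ) : Real.exp (-confidence δ l) = δ / 16 ^ (l + 1) := by
  rw [confidence, Real.exp_neg, Real.exp_log (by positivity), inv_div]

lemma five_le_confidence (hδ : 0 < δ) (hδ1 : δ < 0.1) (l : ℕ) : 5 ≤ confidence δ l := by
  rw [confidence, Real.le_log_iff_exp_le (by positivity), le_div_iff₀ hδ]
  have h1 : Real.exp 5 ≤ 160 := by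
    have : Real.exp 5 = Real.exp 1 ^ 5 := by rw [← Real.exp_nat_mul]; norm_num
    rw [this]
    calc Real.exp 1 ^ 5 ≤ 2.72 ^ 5 := by
          gcongr
          have := Real.exp_one_lt_d9
          linarith
      _ ≤ 160 := by norm_num
  have h2 : (16 : ℝ) ≤ 16 ^ (l + 1) := le_self_pow₀ (by norm_num) (by omega)
  norm_num at hδ1
  nlinarith [Real.exp_pos 5]

lemma log_ten_le_log_inv (hδ : 0 < δ) (hδ1 : δ < 0.1) : Real.log 10 ≤ Real.log δ⁻¹ := by
  refine Real.log_le_log (by norm_num) ?_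
  rw [le_inv_comm₀ (by norm_num) hδ]
  norm_num at hδ1 ⊢
  linarith

lemma confidence_le (hδ : 0 < δ) (hδ1 : δ < 0.1) (l : ℕ) :
    confidence δ l ≤ (2 * l + 3) * Real.log δ⁻¹ := by
  have h1 := log_ten_le_log_inv hδ hδ1
  have h2 : Real.log 16 ≤ 2 * Real.log 10 := by
    rw [show 2 * Real.log 10 = Real.log (10 ^ 2) by rw [Real.log_pow]; norm_num]
    exact Real.log_le_log (by norm_num) (by norm_num)
  rw [confidence, div_eq_mul_inv, Real.log_mul (by positivity) (by positivity), Real.log_pow]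
  push_cast
  nlinarith [l.cast_nonneg (α := ℝ)]

lemma one_le_log_inv (hδ : 0 < δ) (hδ1 : δ < 0.1) : 1 ≤ Real.log δ⁻¹ := by
  refine le_trans ?_ (log_ten_le_log_inv hδ hδ1)
  rw [Real.le_log_iff_exp_le (by norm_num)]
  have := Real.exp_one_lt_d9
  linarith

end Confidence

lemma tsum_ofReal_half_geometric {c : ℝ} (hc : 0 ≤ c) :
    ∑' l : ℕ, ENNReal.ofReal (c / 2 / 2 ^ l) = ENNReal.ofReal c := by
  rw [← ENNReal.ofReal_tsum_of_nonneg (fun _ => by positivity) (summable_geometric_two' c),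
    tsum_geometric_two']

theorem mainTheorem1 :
    ∃ C : ℝ, 0 < C ∧ ∀ δ : ℝ, 0 < δ → δ < 0.1 →
      ∃ A : (n : ℕ) → 2 ≤ n → BanditAlgorithm n,
        IsDeltaCorrect δ A ∧
        ∀ (n : ℕ) (hn : 2 ≤ n) (I : BestArmInstance n),
          (A n hn).expectedSamples I ≤ ENNReal.ofReal (C *
            ((I.gapTwo⁻¹) ^ 2 * lnln (I.gapTwo⁻¹)
              + ∑ i ∈ Finset.univ.erase I.best, ((I.gap i)⁻¹) ^ 2 * Real.log δ⁻¹
              + ∑ i ∈ Finset.univ.erase I.best,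
                  ((I.gap i)⁻¹) ^ 2 * lnln (min (n : ℝ) ((I.gap i)⁻¹)))) := by
  set K : ℝ := 204800 * 200000 with hK
  have hK1 : 1 ≤ K := by norm_num [hK]
  -- Copy 0 contributes at most 2 · 3 · K · O + 1 and the other copies 4 · K · O, where O is the
  -- complexity and K · O ≥ 1.
  refine ⟨11 * K, by positivity, fun δ hδ hδ1 => ?_⟩
  have hsum : ∑' l : ℕ, ENNReal.ofReal (δ / 16 ^ (l + 1)) ≤ ENNReal.ofReal δ := by
    rw [← tsum_ofReal_half_geometric hδ.le]
    refine ENNReal.tsum_le_tsum fun l => ENNReal.ofReal_le_ofReal ?_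
    rw [div_div, ← pow_succ']
    gcongr
    norm_num
  have key : ∀ (n : ℕ) (d : Fin n) (I : BestArmInstance n), ∃ (B : ℕ → Set (ℕ → Fin n → ℝ))
      (Y : ℕ → (ℕ → Fin n → ℝ) → ℝ≥0∞), (∀ l, MeasurableSet (B l)) ∧
      (∀ l, I.rewardLaw (B l) ≤ ENNReal.ofReal (δ / 16 ^ (l + 1))) ∧ (∀ l, Measurable (Y l)) ∧
      (∀ l, ∫⁻ x, Y l x ∂I.rewardLaw ≤
        ENNReal.ofReal (204800 * ElimState.stepCost (confidence δ l) I n 0 0 0)) ∧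
      ∀ l, ∀ x ∉ B l, ∃ t : ℕ, (t : ℝ≥0∞) ≤ Y l x ∧
        (ElimState.algorithm (confidence δ l) d).StopsWith () x t I.best := by
    intro n d I
    choose B Y hB hβ hY hτ hhalt using fun l =>
      ElimState.exists_event d I (five_le_confidence hδ hδ1 l)
    simp_rw [exp_neg_confidence hδ] at hβ
    exact ⟨B, Y, hB, hβ, hY, hτ, hhalt⟩
  refine ⟨fun n hn => BanditAlgorithm.parallel
    (fun l => ElimState.algorithm (confidence δ l) (⟨0, by omega⟩ : Fin n)) fun _ => (), ?_, ?_⟩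
  · intro n hn I
    obtain ⟨B, Y, hB, hβ, -, -, hhalt⟩ := key n ⟨0, by omega⟩ I
    refine le_trans ?_ (BanditAlgorithm.parallel_successProb_ge _ _ I hB hβ hhalt)
    rw [ENNReal.ofReal_sub _ hδ.le, ENNReal.ofReal_one]
    exact tsub_le_tsub_left hsum 1
  · intro n hn I
    obtain ⟨B, Y, hB, hβ, hY, hτ, hhalt⟩ := key n ⟨0, by omega⟩ I
    have hO := ElimState.one_le_complexity I hn (one_le_log_inv hδ hδ1)
    change _ ≤ ENNReal.ofReal (11 * K * ElimState.complexity I (Real.log δ⁻¹))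
    set O := ElimState.complexity I (Real.log δ⁻¹)
    have hKO : 1 ≤ K * O := one_le_mul_of_one_le_of_one_le hK1 hO
    have hτ' : ∀ l, ∫⁻ x, Y l x ∂I.rewardLaw ≤ ENNReal.ofReal ((2 * l + 3) * (K * O)) := by
      intro l
      refine (hτ l).trans (ENNReal.ofReal_le_ofReal ?_)
      have h1 := ElimState.stepCost_init_le I (five_le_confidence hδ hδ1 l) hn
      have h2 := ElimState.complexity_le_mul I (c := 2 * l + 3)
        (by linarith [l.cast_nonneg (α := ℝ)]) (confidence_le hδ hδ1 l)
      calc _ ≤ 204800 * (200000 * ((2 * l + 3) * O)) := by linarith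
        _ = _ := by rw [hK]; ring
    refine (BanditAlgorithm.parallel_expectedSamples_le _ _ I hB hβ hhalt hY
      (hsum.trans_lt ENNReal.ofReal_lt_top).ne hτ').trans ?_
    -- The failure probability 16^(-l-1) of copy `l` beats the slowdown 2^(l+1) and the linear
    -- growth of the confidence, leaving a geometric series.
    have hterm : ∀ l : ℕ, ENNReal.ofReal (δ / 16 ^ (l + 1)) * (2 ^ (l + 1) *
        (2 * ENNReal.ofReal ((2 * (l + 1 : ℕ) + 3) * (K * O)) + 1)) ≤
        ENNReal.ofReal (4 * (K * O) / 2 / 2 ^ l) := by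
      intro l
      have h2 : (2 : ℝ≥0∞) = ENNReal.ofReal 2 := by simp
      rw [h2, ← ENNReal.ofReal_one, ← ENNReal.ofReal_pow (by norm_num),
        ← ENNReal.ofReal_mul (by norm_num), ← ENNReal.ofReal_add (by positivity) (by norm_num),
        ← ENNReal.ofReal_mul (by positivity), ← ENNReal.ofReal_mul (by positivity)]
      refine ENNReal.ofReal_le_ofReal ?_
      have hl : 1 + (l : ℝ) ≤ 2 ^ l := by
        have := one_add_mul_le_pow (a := (1 : ℝ)) (by norm_num) l
        norm_num at this
        linarith
      set a : ℝ := 2 ^ l with ha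
      have ha1 : 1 ≤ a := one_le_pow₀ (by norm_num)
      have h16 : (16 : ℝ) ^ (l + 1) = 16 * a ^ 4 := by
        rw [pow_succ, ha, ← pow_mul, mul_comm l, pow_mul]; norm_num; ring
      set X : ℝ := 2 * ((2 * (l + 1 : ℕ) + 3) * (K * O)) + 1 with hX
      have hX1 : X ≤ 11 * a * (K * O) := by
        rw [hX]
        push_cast
        nlinarith
      have hX0 : 0 ≤ X := by positivity
      have hle : δ * (a ^ 2 * X) ≤ 16 * a ^ 4 * (K * O) := by
        have h1 : δ * (a ^ 2 * X) ≤ 1 * (a ^ 2 * X) := by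
          gcongr
          norm_num at hδ1
          linarith
        have h2 : a ^ 2 * X ≤ a ^ 2 * (11 * a * (K * O)) := by gcongr
        have h3 : a ^ 3 ≤ a ^ 4 := pow_le_pow_right₀ ha1 (by norm_num)
        have h4 : a ^ 3 * (K * O) ≤ a ^ 4 * (K * O) := by gcongr
        have h5 : 0 ≤ a ^ 4 * (K * O) := by positivity
        linarith
      rw [h16, show (2 : ℝ) ^ (l + 1) = a * 2 from pow_succ _ _, div_mul_eq_mul_div,
        div_div, div_le_div_iff₀ (by positivity) (by positivity)]
      linarith
    refine (add_le_add_right (ENNReal.tsum_le_tsum hterm) _).trans ?_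
    rw [tsum_ofReal_half_geometric (by positivity)]
    have h2 : (2 : ℝ≥0∞) = ENNReal.ofReal 2 := by simp
    rw [h2, ← ENNReal.ofReal_one, ← ENNReal.ofReal_mul (by norm_num),
      ← ENNReal.ofReal_add (by positivity) (by norm_num),
      ← ENNReal.ofReal_add (by positivity) (by positivity)]
    refine ENNReal.ofReal_le_ofReal ?_
    push_cast
    linarith
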